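/- Let $L,a,a_1>0$, $0\le d<1$, $M>0$, and let $\tau:[0,\infty)\to\mathbb R$ satisfy $\tau\in W^{2,\infty}(0,T)$ for every $T>0$, $0<\tau(0)\le\tau(t)\le M$ and $\dot\tau(t)\le d$ for all $t\ge 0$. Let $\alpha,\beta\in\mathbb R$ with $$\alpha>\frac{|\beta|}{2a_1}\,\frac{a_1^2+1-d}{1-d}.$$ Put $X_0=L^2(0,L)^2$, $H=X_0\times L^2(0,1)$, and for $t\ge0$ $$A(t)(\eta,\omega,z)=\Big(-\omega_x-a\omega_{xxx}-a_1\omega_{xxxxx},\ -\eta_x-a\eta_{xxx}-a_1\eta_{xxxxx},\ \tfrac{\dot\tau(t)\rho-1}{\tau(t)}\,z_\rho\Big),$$ with the time-independent domain $D$ of all $(\eta,\omega,z)\in[H^5(0,L)\cap H^2_0(0,L)]^2\times H^1(0,1)$ such that $\eta_{xx}(0)=0$, $z(0)=\eta_{xx}(L)$ and $\omega_{xx}(L)=\alpha\eta_{xx}(L)+\beta z(1)$. (This is the system $\eta_t+\omega_x+a\omega_{xxx}+a_1\omega_{xxxxx}=0$, $\omega_t+\eta_x+a\eta_{xxx}+a_1\eta_{xxxxx}=0$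 on $(0,L)$ with the delayed boundary feedback $\omega_{xx}(t,L)=\alpha\eta_{xx}(t,L)+\beta\eta_{xx}(t-\tau(t),L)$, where $z(t,\rho)=\eta_{xx}(t-\tau(t)\rho,L)$.) A classical solution on $[0,T]$ is a $U\in C([0,T],D)\cap C^1([0,T],H)$ with $U'(t)=A(t)U(t)$; a mild solution is a limit in $C([0,T],H)$ of classical solutions; the traces $\eta_{xx}(\cdot,L)$ and $z(\cdot,1)$ of a mild solution are the limits in $L^2(0,T)$ of these traces along classical solutions that converge to it. For every $T>0$ and every $U_0=(\eta_0,\omega_0,z_0)\in H$ (here $z_0$ is the initial value of $z$ as a function of $\rho\in(0,1)$) there is exactly one mild solution $U=(\eta,\omega,z)$ on $[0,T]$ with $U(0)=U_0$, its traces $\eta_{xx}(\cdot,L),z(\cdot,1)\in L^2(0,T)$ exist and are unique, and the following hold. 1. For all $t\in[0,T]$, $$\|(\eta,\omega)(t)\|_{X_0}^2+|\beta|\tau(t)\|z(t)\|_{L^2(0,1)}^2\le\|(\eta_0,\omega_0)\|_{X_0}^2+|\beta|\tau(0)\|z_0\|_{L^2(0,1)}^2 .$$ 2. There is a constant $C$,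 depending only on $a_1,\alpha,\beta,d,M$, with $$\|\eta_{xx}(\cdot,L)\|_{L^2(0,T)}^2+\|z(\cdot,1)\|_{L^2(0,T)}^2\le C\big(\|(\eta_0,\omega_0)\|_{X_0}^2+\|z_0\|_{L^2(0,1)}^2\big).$$ 3. $$\|(\eta_0,\omega_0)\|_{X_0}^2\le\frac1T\|(\eta,\omega)\|_{L^2(0,T;X_0)}^2+a_1(2\alpha+|\beta|)\|\eta_{xx}(\cdot,L)\|_{L^2(0,T)}^2+a_1|\beta|\,\|z(\cdot,1)\|_{L^2(0,T)}^2 .$$ 4. If $K\in\mathbb R$ and $\dot\tau\ge -K$ on $[0,T]$, then, with a constant $C_1$ depending only on $d$, $M$, $\tau(0)$ and $K$, $$\|z_0\|_{L^2(0,1)}^2\le C_1\big(\|z(T,\cdot)\|_{L^2(0,1)}^2+\|z(\cdot,1)\|_{L^2(0,T)}^2\big).$$ 5. If moreover $L<\pi\sqrt{5a_1/(3a)}$, then $(\eta,\omega)\in\mathcal B:=C([0,T],X_0)\cap L^2(0,T;[H^2_0(0,L)]^2)$ and $$\int_0^T\!\!\int_0^L(\eta_{xx}^2+\omega_{xx}^2)\,dx\,dt\le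 C\big(\|(\eta_0,\omega_0)\|_{X_0}^2+\|z_0\|_{L^2(0,1)}^2\big)$$ with a constant $C$ depending only on $L,T,a,a_1,\alpha,\beta,d,M$; and the map $U_0=(\eta_0,\omega_0,z_0)\mapsto(\eta,\omega;z)$ from $H$ to $\mathcal B\times C([0,T];L^2(0,1))$ is well defined and continuous. -/

import Mathlib

open MeasureTheory Set Filter Topology

noncomputable section

namespace Boussinesq

/-! ### Lebesgue and Sobolev spaces on an interval -/

/-- The real Hilbert space `L²(0,ℓ)`. -/
abbrev L2 (ℓ : ℝ) : Type := Lp ℝ 2 (volume.restrict (Ioo (0 : ℝ) ℓ))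

/-- `g` is the weak derivative of `f` on `(0,ℓ)`. -/
def HasWeakDeriv {ℓ : ℝ} (f g : L2 ℓ) : Prop :=
  ∀ φ : ℝ → ℝ, ContDiff ℝ ((⊤ : ℕ∞) : WithTop ℕ∞) φ → HasCompactSupport φ → tsupport φ ⊆ Ioo 0 ℓ →
    ∫ x in Ioo 0 ℓ, f x * deriv φ x = -∫ x in Ioo 0 ℓ, g x * φ x

/-- The class `f ∈ L²(0,ℓ)` has a representative that is continuous on `[0,ℓ]`, and its value
at `x` is `c`.  For `f ∈ H¹(0,ℓ)` this says that the trace of `f` at `x` is `c`. -/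
def HasTrace {ℓ : ℝ} (f : L2 ℓ) (x c : ℝ) : Prop :=
  ∃ F : ℝ → ℝ, ContinuousOn F (Icc 0 ℓ) ∧ f =ᵐ[volume.restrict (Ioo 0 ℓ)] F ∧ F x = c

theorem integrable_mul_of_test {ℓ : ℝ} (f : L2 ℓ) {φ : ℝ → ℝ} (hφ : Continuous φ)
    (hc : HasCompactSupport φ) :
    Integrable (fun x => f x * φ x) (volume.restrict (Ioo 0 ℓ)) :=
  MemLp.integrable_mul (Lp.memLp f)
    ((hφ.memLp_of_hasCompactSupport (p := 2) hc).restrict (Ioo 0 ℓ))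

theorem HasWeakDeriv.zero {ℓ : ℝ} : HasWeakDeriv (0 : L2 ℓ) 0 := by
  intro φ _ _ _
  have h : ∀ ψ : ℝ → ℝ, ∫ x in Ioo 0 ℓ, (0 : L2 ℓ) x * ψ x = 0 := by
    intro ψ
    rw [integral_congr_ae (g := fun _ => (0 : ℝ))]
    · simp
    · filter_upwards [Lp.coeFn_zero ℝ 2 (volume.restrict (Ioo (0 : ℝ) ℓ))] with x hx
      rw [hx]; simp
  rw [h, h, neg_zero]

theorem HasWeakDeriv.add {ℓ : ℝ} {f g f' g' : L2 ℓ} (h : HasWeakDeriv f g)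
    (h' : HasWeakDeriv f' g') : HasWeakDeriv (f + f') (g + g') := by
  intro φ h1 h2 h3
  have key : ∀ (u v : L2 ℓ) (ψ : ℝ → ℝ), Continuous ψ → HasCompactSupport ψ →
      ∫ x in Ioo 0 ℓ, (u + v : L2 ℓ) x * ψ x
        = (∫ x in Ioo 0 ℓ, u x * ψ x) + ∫ x in Ioo 0 ℓ, v x * ψ x := by
    intro u v ψ hψ hc
    rw [← integral_add (integrable_mul_of_test u hψ hc) (integrable_mul_of_test v hψ hc)]
    refine integral_congr_ae ?_
    filter_upwards [Lp.coeFn_add u v] with x hx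
    rw [hx, Pi.add_apply, add_mul]
  rw [key _ _ _ (h1.continuous_deriv (by simp)) h2.deriv, key _ _ _ h1.continuous h2,
    h φ h1 h2 h3, h' φ h1 h2 h3]
  ring

theorem HasWeakDeriv.smul {ℓ : ℝ} {f g : L2 ℓ} (c : ℝ) (h : HasWeakDeriv f g) :
    HasWeakDeriv (c • f) (c • g) := by
  intro φ h1 h2 h3
  have key : ∀ (u : L2 ℓ) (ψ : ℝ → ℝ),
      ∫ x in Ioo 0 ℓ, (c • u : L2 ℓ) x * ψ x = c * ∫ x in Ioo 0 ℓ, u x * ψ x := by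
    intro u ψ
    rw [← integral_const_mul]
    refine integral_congr_ae ?_
    filter_upwards [Lp.coeFn_smul c u] with x hx
    rw [hx, Pi.smul_apply, smul_eq_mul, mul_assoc]
  rw [key, key, h φ h1 h2 h3]
  ring

theorem HasTrace.zero {ℓ x : ℝ} : HasTrace (0 : L2 ℓ) x 0 :=
  ⟨fun _ => 0, continuousOn_const, Lp.coeFn_zero ℝ 2 _, rfl⟩

theorem HasTrace.add {ℓ x c c' : ℝ} {f f' : L2 ℓ} (h : HasTrace f x c) (h' : HasTrace f' x c') :
    HasTrace (f + f') x (c + c') := by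
  obtain ⟨F, h1, h2, rfl⟩ := h
  obtain ⟨G, h3, h4, rfl⟩ := h'
  exact ⟨F + G, h1.add h3, (Lp.coeFn_add f f').trans (h2.add h4), rfl⟩

theorem HasTrace.smul {ℓ x c : ℝ} {f : L2 ℓ} (k : ℝ) (h : HasTrace f x c) :
    HasTrace (k • f) x (k * c) := by
  obtain ⟨F, h1, h2, rfl⟩ := h
  exact ⟨k • F, h1.const_smul k, (Lp.coeFn_smul k f).trans (h2.const_smul k), rfl⟩

/-- The space `H²₀(0,ℓ)`, an element being recorded as the triple `(f, fₓ, fₓₓ)` and normed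
as a subspace of `L² × L² × L²`. -/
def H20 (ℓ : ℝ) : Submodule ℝ (L2 ℓ × L2 ℓ × L2 ℓ) where
  carrier := {f | HasWeakDeriv f.1 f.2.1 ∧ HasWeakDeriv f.2.1 f.2.2 ∧
    HasTrace f.1 0 0 ∧ HasTrace f.1 ℓ 0 ∧ HasTrace f.2.1 0 0 ∧ HasTrace f.2.1 ℓ 0}
  zero_mem' := ⟨.zero, .zero, .zero, .zero, .zero, .zero⟩
  add_mem' := by
    rintro f g ⟨a1, a2, a3, a4, a5, a6⟩ ⟨b1, b2, b3, b4, b5, b6⟩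
    exact ⟨a1.add b1, a2.add b2, by simpa using a3.add b3, by simpa using a4.add b4,
      by simpa using a5.add b5, by simpa using a6.add b6⟩
  smul_mem' := by
    rintro c f ⟨a1, a2, a3, a4, a5, a6⟩
    exact ⟨a1.smul c, a2.smul c, by simpa using a3.smul c, by simpa using a4.smul c,
      by simpa using a5.smul c, by simpa using a6.smul c⟩

/-! ### State space and solution space -/

/-- `X₀ = L²(0,L) × L²(0,L)`. -/
abbrev X0 (L : ℝ) : Type := L2 L × L2 L

/-- `‖(η,ω)‖²` in `X₀`, that is `∫₀ᴸ (η² + ω²) dx`. -/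
def X0.normSq {L : ℝ} (u : X0 L) : ℝ := ‖u.1‖ ^ 2 + ‖u.2‖ ^ 2

/-- The state space `H = X₀ × L²(0,1)`. -/
abbrev State (L : ℝ) : Type := X0 L × L2 1

/-- `ℬ = C([0,T], X₀) ∩ L²(0,T; [H²₀(0,L)]²)`: an element is a pair consisting of a curve in
`C([0,T], X₀)` and of the same curve (almost everywhere on `(0,T)`) seen in
`L²(0,T; [H²₀(0,L)]²)`; the norm is (equivalent to) the sum of the two norms. -/
def solutionSpace (L T : ℝ) : Submodule ℝ
    (C(Icc (0 : ℝ) T, X0 L) × Lp (H20 L × H20 L) 2 (volume.restrict (Ioo (0 : ℝ) T))) where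
  carrier := {w | ∀ᵐ t ∂(volume.restrict (Ioo (0 : ℝ) T)), ∀ ht : t ∈ Icc 0 T,
    (((w.2 t).1 : L2 L × L2 L × L2 L).1, ((w.2 t).2 : L2 L × L2 L × L2 L).1) = w.1 ⟨t, ht⟩}
  zero_mem' := by
    simp only [mem_ofPred_eq, Prod.fst_zero, Prod.snd_zero]
    filter_upwards [Lp.coeFn_zero (H20 L × H20 L) 2 (volume.restrict (Ioo (0 : ℝ) T))]
      with t h ht
    rw [h]; rfl
  add_mem' := by
    rintro v w hv hw
    simp only [mem_ofPred_eq] at hv hw ⊢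
    filter_upwards [hv, hw, Lp.coeFn_add v.2 w.2] with t h1 h2 h3 ht
    simp only [Prod.snd_add, Prod.fst_add, h3, Pi.add_apply, ContinuousMap.add_apply, ← h1 ht,
      ← h2 ht, Submodule.coe_add, Prod.mk_add_mk]
  smul_mem' := by
    rintro c v hv
    simp only [mem_ofPred_eq] at hv ⊢
    filter_upwards [hv, Lp.coeFn_smul c v.2] with t h1 h3 ht
    simp only [Prod.smul_snd, Prod.smul_fst, h3, Pi.smul_apply, ContinuousMap.smul_apply, ← h1 ht,
      Submodule.coe_smul, Prod.smul_mk]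

/-! ### The delayed system -/

/-- The data of the linear system: length `L`, coefficients `a`, `a₁`, feedback gains `α`, `β`,
bounds `d`, `M` for the delay, and the delay `τ` (relevant on `[0,∞)` only). -/
structure Params where
  L : ℝ
  a : ℝ
  a₁ : ℝ
  α : ℝ
  β : ℝ
  d : ℝ
  M : ℝ
  τ : ℝ → ℝ

namespace Params

/-- The derivative of the delay on `[0,∞)` (one-sided at `0`). -/
def τ' (P : Params) (t : ℝ) : ℝ := derivWithin P.τ (Ici 0) t

/-- The standing assumptions.  `τ ∈ W^{2,∞}(0,T)` means that `τ` is differentiable with a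
derivative that is Lipschitz on `[0,T]`. -/
structure Admissible (P : Params) : Prop where
  L_pos : 0 < P.L
  a_pos : 0 < P.a
  a₁_pos : 0 < P.a₁
  d_nonneg : 0 ≤ P.d
  d_lt_one : P.d < 1
  τ_diff : DifferentiableOn ℝ P.τ (Ici 0)
  τ_lip : ∀ T : ℝ, 0 < T → ∃ K, LipschitzOnWith K P.τ' (Icc 0 T)
  τ_zero_pos : 0 < P.τ 0
  τ_ge : ∀ t, 0 ≤ t → P.τ 0 ≤ P.τ t
  τ_le : ∀ t, 0 ≤ t → P.τ t ≤ P.M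
  τ'_le : ∀ t, 0 ≤ t → P.τ' t ≤ P.d
  gain : |P.β| / (2 * P.a₁) * ((P.a₁ ^ 2 + 1 - P.d) / (1 - P.d)) < P.α

theorem memLp_transport (b c : ℝ) (g : L2 1) :
    MemLp (fun ρ : ℝ => (b * ρ - 1) / c * g ρ) 2 (volume.restrict (Ioo (0 : ℝ) 1)) := by
  refine MemLp.of_le_mul (c := (|b| + 1) / |c|) (Lp.memLp g)
    (AEStronglyMeasurable.mul (by fun_prop) (Lp.aestronglyMeasurable g)) ?_
  filter_upwards [ae_restrict_mem measurableSet_Ioo] with ρ hρ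
  rw [norm_mul, norm_div, Real.norm_eq_abs, Real.norm_eq_abs c]
  gcongr
  calc |b * ρ - 1| ≤ |b * ρ| + |1| := abs_sub _ _
    _ = |b| * ρ + 1 := by rw [abs_mul, abs_of_pos hρ.1, abs_one]
    _ ≤ |b| + 1 := by nlinarith [abs_nonneg b, hρ.2]

/-- `(η, ω, z)` belongs to `D(A(t))`, where `η i`, `ω i`, `z i` stand for the `i`-th derivatives,
and `p = ηₓₓ(L)`, `q = z(1)`. -/
structure InDomain (P : Params) (η ω : Fin 6 → L2 P.L) (z : Fin 2 → L2 1) (p q : ℝ) : Prop where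
  η_deriv : ∀ i : Fin 5, HasWeakDeriv (η i.castSucc) (η i.succ)
  ω_deriv : ∀ i : Fin 5, HasWeakDeriv (ω i.castSucc) (ω i.succ)
  z_deriv : HasWeakDeriv (z 0) (z 1)
  η_zero : HasTrace (η 0) 0 0
  η_L : HasTrace (η 0) P.L 0
  ηx_zero : HasTrace (η 1) 0 0
  ηx_L : HasTrace (η 1) P.L 0
  ω_zero : HasTrace (ω 0) 0 0
  ω_L : HasTrace (ω 0) P.L 0
  ωx_zero : HasTrace (ω 1) 0 0
  ωx_L : HasTrace (ω 1) P.L 0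
  ηxx_zero : HasTrace (η 2) 0 0
  ηxx_L : HasTrace (η 2) P.L p
  z_zero : HasTrace (z 0) 0 p
  z_one : HasTrace (z 0) 1 q
  ωxx_L : HasTrace (ω 2) P.L (P.α * p + P.β * q)

/-- The operator `A(t)(η, ω, z) = (-ωₓ - a ωₓₓₓ - a₁ ωₓₓₓₓₓ, -ηₓ - a ηₓₓₓ - a₁ ηₓₓₓₓₓ,
(τ'(t) ρ - 1) / τ(t) z_ρ)`. -/
def A (P : Params) (t : ℝ) (η ω : Fin 6 → L2 P.L) (z : Fin 2 → L2 1) : State P.L :=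
  ((-ω 1 - P.a • ω 3 - P.a₁ • ω 5, -η 1 - P.a • η 3 - P.a₁ • η 5),
    (memLp_transport (P.τ' t) (P.τ t) (z 1)).toLp _)

/-- Classical solutions on `[0,T]`: `U ∈ C([0,T], D(A(0))) ∩ C¹([0,T], H)` with `U' = A(t) U`
(the norm of `D(A(0))` being that of `[H⁵(0,L)]² × H¹(0,1)`, continuity of `U'` is automatic),
with `p(t) = ηₓₓ(t,L)` and `q(t) = z(t,1)`. -/
def IsClassicalSolution (P : Params) (T : ℝ) (U : C(Icc (0 : ℝ) T, State P.L)) (p q : ℝ → ℝ) :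
    Prop :=
  ∃ (η ω : ℝ → Fin 6 → L2 P.L) (z : ℝ → Fin 2 → L2 1),
    ContinuousOn η (Icc 0 T) ∧ ContinuousOn ω (Icc 0 T) ∧ ContinuousOn z (Icc 0 T) ∧
    (∀ t ∈ Icc 0 T, P.InDomain (η t) (ω t) (z t) (p t) (q t)) ∧
    (∀ t ∈ Icc 0 T, HasDerivWithinAt (fun s => (((η s 0, ω s 0), z s 0) : State P.L))
      (P.A t (η t) (ω t) (z t)) (Icc 0 T) t) ∧
    ∀ t : Icc (0 : ℝ) T, U t = ((η t 0, ω t 0), z t 0)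

/-- Mild solutions on `[0,T]`: the limits in `C([0,T], H)` of classical solutions. -/
def IsMildSolution (P : Params) (T : ℝ) (U : C(Icc (0 : ℝ) T, State P.L)) : Prop :=
  ∃ V : ℕ → C(Icc (0 : ℝ) T, State P.L),
    (∀ n, ∃ p q : ℝ → ℝ, P.IsClassicalSolution T (V n) p q) ∧ Tendsto V atTop (𝓝 U)

/-- Mild solutions on `[0,T]` with initial value `U₀`. -/
def IsSolution (P : Params) (T : ℝ) (U₀ : State P.L) (U : C(Icc (0 : ℝ) T, State P.L)) : Prop :=
  P.IsMildSolution T U ∧ ∀ t : Icc (0 : ℝ) T, (t : ℝ) = 0 → U t = U₀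

/-- `p` and `q` are the traces `ηₓₓ(·,L)` and `z(·,1)` in `L²(0,T)` of the mild solution `U`:
the limits in `L²(0,T)` of these traces along classical solutions that converge to `U`. -/
def HasBoundaryTraces (P : Params) (T : ℝ) (U : C(Icc (0 : ℝ) T, State P.L)) (p q : L2 T) : Prop :=
  ∃ (V : ℕ → C(Icc (0 : ℝ) T, State P.L)) (r s : ℕ → ℝ → ℝ),
    (∀ n, P.IsClassicalSolution T (V n) (r n) (s n)) ∧ Tendsto V atTop (𝓝 U) ∧
    Tendsto (fun n => eLpNorm (fun t => r n t - p t) 2 (volume.restrict (Ioo 0 T))) atTop (𝓝 0) ∧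
    Tendsto (fun n => eLpNorm (fun t => s n t - q t) 2 (volume.restrict (Ioo 0 T))) atTop (𝓝 0)

end Params

end Boussinesq

end

/-! The estimates come from multipliers and hold first for classical solutions. Pairing the system
with `(η, ω)` leaves only the boundary term `-2 a₁ p (α p + β q)`, where `p = ηₓₓ(L)` and `q =
z(1)`. Pairing the transport equation with `z` gives `(τ‖z‖²)' = (τ' - 1) q² + p²`. The gain
condition says exactly that the first identity plus `|β|` times the second is at most `-gap · p²`
with `gap > 0` (`dissipation`). This yields the energy bound and `∫ p²`; the transport identity
alone then yields `∫ q²`, and, read backwards, the bound on `z₀`. The multiplier `T - t` gives the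
bound on `(η₀, ω₀)`. Differentiating `∫ x η ω dx` in time produces `5a₁/2 · ‖(ηₓₓ, ωₓₓ)‖²` minus
`3a/2 · ‖(ηₓ, ωₓ)‖²`. By Wirtinger's inequality for the first derivatives the difference is coercive
precisely when `L < π √(5a₁/(3a))`, which is Kato smoothing (`exists_smoothing`).

Existence of classical solutions is the harder half, because the operator depends on time. It does
so only through the delay line, and the delay is never below `σ = τ(0)`. During a time step of
length `σ/2` the value `z(t,1)` therefore reads only the history before the step and is a known
signal. The same `(η, ω)` is produced by an auxiliary system with the constant delay `σ`, whose
initial profile on `(1/2, 1)` is chosen so that it emits this signal (`exists_extension`,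
`characteristics`). That system is autonomous. It is dissipative for a weighted inner product
(`dissipative_frozen`). Its resolvent equation is a linear ODE in dimension ten with ten boundary
conditions, and a square linear system with trivial kernel is solvable (`surjective_resolvent`).
Hence the Lumer–Phillips theorem applies (`exists_solution`, by Yosida approximation). From the
inflow `p` so obtained the true `z` is written down along characteristics (`transport_aux`,
`exists_step`). All steps have the same length, so gluing them reaches any `T`.

For mild solutions, consider the space of classical solutions together with their traces. The
initial value controls the norm of its elements and has dense range, so evaluation at time `0` is an
isomorphism from the closure of this space onto `H` (`exists_inverse_on_closure`). Its inverse is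
the solution map, which gives existence, uniqueness and continuity at once, and every estimate
passes to the closure. The same argument with an `L²(0,T; H²₀)` component in place of the traces
gives the map into `ℬ`. -/

open MeasureTheory Set Filter Topology

noncomputable section

namespace Boussinesq

open scoped ENNReal

/-! ### Weak derivatives, traces and integration by parts on an interval. -/

/-- `F` is an absolutely continuous representative of `f ∈ H¹(0,ℓ)`, with derivative `g`. -/
structure IsRep {ℓ : ℝ} (f g : L2 ℓ) (F : ℝ → ℝ) : Prop where
  ac : AbsolutelyContinuousOnInterval F 0 ℓ
  ae_eq : f =ᵐ[volume.restrict (Ioo 0 ℓ)] F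
  hasDeriv : ∀ᵐ x ∂volume.restrict (Ioo 0 ℓ), HasDerivAt F (g x) x

theorem IsRep.continuousOn {ℓ : ℝ} {f g : L2 ℓ} {F : ℝ → ℝ} (h : IsRep f g F) :
    ContinuousOn F (Icc 0 ℓ) := h.ac.continuousOn.mono Icc_subset_uIcc

theorem integral_Ioo_eq {ℓ : ℝ} (hℓ : 0 ≤ ℓ) (f : ℝ → ℝ) :
    ∫ x in Ioo 0 ℓ, f x = ∫ x in (0 : ℝ)..ℓ, f x := by
  rw [intervalIntegral.integral_of_le hℓ, integral_Ioc_eq_integral_Ioo]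

theorem ae_uIoc_of_ae_Ioo {ℓ : ℝ} (hℓ : 0 ≤ ℓ) {p : ℝ → Prop}
    (h : ∀ᵐ x ∂volume.restrict (Ioo 0 ℓ), p x) : ∀ᵐ x, x ∈ uIoc 0 ℓ → p x := by
  rw [uIoc_of_le hℓ]
  rw [restrict_Ioo_eq_restrict_Ioc, ae_restrict_iff' measurableSet_Ioc] at h
  exact h

theorem L2.memLp_mul {ℓ : ℝ} (f g : L2 ℓ) :
    Integrable (fun x => f x * g x) (volume.restrict (Ioo 0 ℓ)) :=
  MemLp.integrable_mul (Lp.memLp f) (Lp.memLp g)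

theorem L2.integrable {ℓ : ℝ} (f : L2 ℓ) : Integrable f (volume.restrict (Ioo 0 ℓ)) :=
  (Lp.memLp f).integrable (by norm_num)

theorem L2.intervalIntegrable {ℓ : ℝ} (hℓ : 0 ≤ ℓ) (f : L2 ℓ) :
    IntervalIntegrable f volume 0 ℓ := by
  rw [intervalIntegrable_iff_integrableOn_Ioc_of_le hℓ, integrableOn_Ioc_iff_integrableOn_Ioo]
  exact L2.integrable f

theorem L2.inner_eq {ℓ : ℝ} (f g : L2 ℓ) : inner ℝ f g = ∫ x in Ioo 0 ℓ, f x * g x := by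
  rw [MeasureTheory.L2.inner_def]
  refine integral_congr_ae (Eventually.of_forall fun x => ?_)
  simp [mul_comm]

/-- Product rule for an absolutely continuous pair, integrated. -/
theorem IsRep.integral_mul {ℓ : ℝ} (hℓ : 0 ≤ ℓ) {f f' : L2 ℓ} {F G G' : ℝ → ℝ} (h : IsRep f f' F)
    (hG : AbsolutelyContinuousOnInterval G 0 ℓ)
    (hG' : ∀ᵐ x ∂volume.restrict (Ioo 0 ℓ), HasDerivAt G (G' x) x) :
    ∫ x in Ioo 0 ℓ, (f' x * G x + f x * G' x) = F ℓ * G ℓ - F 0 * G 0 := by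
  rw [← h.ac.integral_deriv_mul_eq_sub hG, integral_Ioo_eq hℓ]
  refine intervalIntegral.integral_congr_ae ?_
  filter_upwards [ae_uIoc_of_ae_Ioo hℓ h.ae_eq, ae_uIoc_of_ae_Ioo hℓ h.hasDeriv,
    ae_uIoc_of_ae_Ioo hℓ hG'] with x h1 h2 h3 hx
  rw [h1 hx, (h2 hx).deriv, (h3 hx).deriv]

theorem eq_zero_of_tsupport {ℓ x : ℝ} {φ : ℝ → ℝ} (h : tsupport φ ⊆ Ioo 0 ℓ) (hx : x ∉ Ioo 0 ℓ) :
    φ x = 0 := image_eq_zero_of_notMem_tsupport fun hh => hx (h hh)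

theorem IsRep.hasWeakDeriv {ℓ : ℝ} (hℓ : 0 ≤ ℓ) {f g : L2 ℓ} {F : ℝ → ℝ} (h : IsRep f g F) :
    HasWeakDeriv f g := by
  intro φ h1 h2 h3
  have hd : ∀ x, HasDerivAt φ (deriv φ x) x := fun x =>
    (h1.differentiable (by simp)).differentiableAt.hasDerivAt
  have := h.integral_mul hℓ (G := φ) (G' := deriv φ)
    (h1.of_le (by exact_mod_cast le_top)).contDiffOn.absolutelyContinuousOnInterval
    (Eventually.of_forall hd)
  rw [eq_zero_of_tsupport h3 (by simp), eq_zero_of_tsupport h3 (by simp), integral_add] at this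
  · linarith
  · exact integrable_mul_of_test g h1.continuous h2
  · exact integrable_mul_of_test f (h1.continuous_deriv (by simp)) h2.deriv

/-- A primitive of an `L²` function is an absolutely continuous representative. -/
theorem isRep_of_prim {ℓ : ℝ} (hℓ : 0 ≤ ℓ) {f g : L2 ℓ} {F : ℝ → ℝ} {c : ℝ}
    (hF : ∀ x, F x = c + ∫ t in (0 : ℝ)..x, g t) (hf : f =ᵐ[volume.restrict (Ioo 0 ℓ)] F) :
    IsRep f g F := by
  have hg := L2.intervalIntegrable hℓ g
  obtain rfl : F = fun x => c + ∫ t in (0 : ℝ)..x, g t := funext hF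
  refine ⟨?_, hf, ?_⟩
  · have h1 : AbsolutelyContinuousOnInterval (fun _ : ℝ => c) 0 ℓ :=
      (contDiff_const.contDiffOn (𝕜 := ℝ)).absolutelyContinuousOnInterval
    exact h1.add (hg.absolutelyContinuousOnInterval_intervalIntegral (c := 0) (by simp))
  · rw [ae_restrict_iff' measurableSet_Ioo]
    filter_upwards [hg.ae_hasDerivAt_integral] with x hx hxm
    exact (hx (by rw [uIcc_of_le hℓ]; exact Ioo_subset_Icc_self hxm) 0 (by simp)).const_add c

theorem memLp_of_continuousOn {ℓ : ℝ} {F : ℝ → ℝ} (hF : ContinuousOn F (Icc 0 ℓ)) :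
    MemLp F 2 (volume.restrict (Ioo 0 ℓ)) := by
  obtain ⟨C, hC⟩ := isCompact_Icc.exists_bound_of_continuousOn hF
  refine MemLp.of_bound ((hF.mono Ioo_subset_Icc_self).aestronglyMeasurable measurableSet_Ioo) C ?_
  filter_upwards [ae_restrict_mem measurableSet_Ioo] with x hx using hC x (Ioo_subset_Icc_self hx)

theorem memLp_prim {ℓ : ℝ} (hℓ : 0 ≤ ℓ) (g : L2 ℓ) (c : ℝ) :
    MemLp (fun x => c + ∫ t in (0 : ℝ)..x, g t) 2 (volume.restrict (Ioo 0 ℓ)) := by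
  have hg := L2.intervalIntegrable hℓ g
  have hc : ContinuousOn (fun x => c + ∫ t in (0 : ℝ)..x, g t) (Icc 0 ℓ) :=
    continuousOn_const.add
      ((hg.absolutelyContinuousOnInterval_intervalIntegral (c := 0) (by simp)).continuousOn.mono
        Icc_subset_uIcc)
  exact memLp_of_continuousOn hc

/-- A class on `(0,ℓ)` whose weak derivative vanishes is constant. -/
theorem HasWeakDeriv.ae_const {ℓ : ℝ} (hℓ : 0 < ℓ) {f : L2 ℓ} (h : HasWeakDeriv f 0) :
    ∃ c : ℝ, ∀ᵐ x ∂volume.restrict (Ioo 0 ℓ), f x = c := by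
  let b : ContDiffBump (ℓ / 2) := ⟨ℓ / 8, ℓ / 4, by positivity, by linarith⟩
  set χ : ℝ → ℝ := b.normed volume with hχ
  have χs : ContDiff ℝ ((⊤ : ℕ∞) : WithTop ℕ∞) χ := b.contDiff_normed
  have χc : HasCompactSupport χ := b.hasCompactSupport_normed
  have χi : ∫ x, χ x = 1 := b.integral_normed
  have χt : tsupport χ ⊆ Ioo 0 ℓ := by
    rw [hχ, b.tsupport_normed_eq, Real.closedBall_eq_Icc]
    exact fun x hx => ⟨by have := hx.1; simp [b] at this; linarith,
      by have := hx.2; simp [b] at this; linarith⟩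
  refine ⟨∫ x in Ioo 0 ℓ, f x * χ x, ?_⟩
  set c := ∫ x in Ioo 0 ℓ, f x * χ x
  have hfi : IntegrableOn f (Ioo 0 ℓ) := L2.integrable f
  have key := isOpen_Ioo.ae_eq_zero_of_integral_contDiff_smul_eq_zero (U := Ioo 0 ℓ)
    (f := fun x => f x - c) (μ := volume)
    ((hfi.sub (integrable_const c)).locallyIntegrableOn) ?_
  · rw [ae_restrict_iff' measurableSet_Ioo]
    filter_upwards [key] with x hx hxm using sub_eq_zero.mp (hx hxm)
  intro ψ ψs ψc ψt
  have hψi : Integrable ψ := ψs.continuous.integrable_of_hasCompactSupport ψc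
  have hχi : Integrable χ := χs.continuous.integrable_of_hasCompactSupport χc
  have h0 : ∀ u : ℝ → ℝ, tsupport u ⊆ Ioo 0 ℓ → ∀ v : ℝ → ℝ,
      ∫ x, u x * v x = ∫ x in Ioo 0 ℓ, u x * v x := by
    intro u hu v
    refine (setIntegral_eq_integral_of_forall_compl_eq_zero fun x hx => ?_).symm
    rw [eq_zero_of_tsupport hu hx, zero_mul]
  set m := ∫ x, ψ x with hm
  -- Removing `m χ` makes the integral vanish, so the primitive `φ` of `θ` has compact support in
  -- `(0,ℓ)` and may be used as a test function. The weak derivative being `0` then gives `∫ f ψ = m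
  -- c`.
  set θ : ℝ → ℝ := fun x => ψ x - m * χ x with hθ
  have θs : ContDiff ℝ ((⊤ : ℕ∞) : WithTop ℕ∞) θ := ψs.sub (contDiff_const.mul χs)
  have θi : ∫ x, θ x = 0 := by
    rw [hθ, integral_sub hψi (hχi.const_mul m), integral_const_mul, χi]; simp [hm]
  have θI : Integrable θ := hψi.sub (hχi.const_mul m)
  set φ : ℝ → ℝ := fun x => ∫ t in (0 : ℝ)..x, θ t with hφ
  have φd : ∀ x, HasDerivAt φ (θ x) x := fun x =>
    (θs.continuous.integral_hasStrictDerivAt 0 x).hasDerivAt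
  have φd' : deriv φ = θ := funext fun x => (φd x).deriv
  have φs : ContDiff ℝ ((⊤ : ℕ∞) : WithTop ℕ∞) φ := by
    rw [contDiff_infty_iff_deriv]
    exact ⟨fun x => (φd x).differentiableAt, φd' ▸ θs⟩
  have hK : IsCompact (tsupport ψ ∪ tsupport χ) := ψc.isCompact.union χc.isCompact
  have hKs : tsupport ψ ∪ tsupport χ ⊆ Ioo 0 ℓ := union_subset ψt χt
  have hKn : (tsupport ψ ∪ tsupport χ).Nonempty := by
    by_contra hne
    rw [not_nonempty_iff_eq_empty] at hne
    have : ∀ x, χ x = 0 := fun x => image_eq_zero_of_notMem_tsupport fun hx => by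
      have : x ∈ (∅ : Set ℝ) := hne ▸ Or.inr hx
      exact this
    simp [this] at χi
  obtain ⟨lo, hlo, hlo'⟩ := hK.exists_isLeast hKn
  obtain ⟨hi, hhi, hhi'⟩ := hK.exists_isGreatest hKn
  have θ0 : ∀ x, x ∉ tsupport ψ ∪ tsupport χ → θ x = 0 := fun x hx => by
    rw [hθ]
    simp only
    rw [image_eq_zero_of_notMem_tsupport fun h => hx (Or.inl h),
      image_eq_zero_of_notMem_tsupport fun h => hx (Or.inr h)]; simp
  have φ0 : ∀ x, x ∉ Icc lo hi → φ x = 0 := by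
    intro x hx
    rcases lt_or_ge x lo with hxl | hxl
    · refine (intervalIntegral.integral_congr fun t ht => ?_).trans (intervalIntegral.integral_zero)
      refine θ0 t fun htK => ?_
      have h1 := hlo' htK
      have h2 : t ≤ max 0 x := ht.2
      have h3 := (hKs hlo).1
      have : max 0 x < lo := max_lt h3 hxl
      linarith
    · have hxh : hi < x := by by_contra hh; exact hx ⟨hxl, not_lt.mp hh⟩
      have e : ∫ t, θ t = ∫ t in (0 : ℝ)..x, θ t := by
        rw [intervalIntegral.integral_of_le ((hKs hhi).1.le.trans hxh.le)]
        refine (setIntegral_eq_integral_of_forall_compl_eq_zero fun t ht => ?_).symm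
        refine θ0 t fun htK => ht ⟨(hKs htK).1, (hhi' htK).trans hxh.le⟩
      rw [hφ]; simp only; rw [← e, θi]
  have φt : tsupport φ ⊆ Icc lo hi := closure_minimal (fun x hx => by
    by_contra hh; exact hx (φ0 x hh)) isClosed_Icc
  have φt' : tsupport φ ⊆ Ioo 0 ℓ := φt.trans fun x hx =>
    ⟨(hKs hlo).1.trans_le hx.1, hx.2.trans_lt (hKs hhi).2⟩
  have φc : HasCompactSupport φ := HasCompactSupport.of_support_subset_isCompact isCompact_Icc
    ((subset_tsupport φ).trans φt)
  have hw := h φ φs φc φt'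
  have hz : ∫ x in Ioo 0 ℓ, (0 : L2 ℓ) x * φ x = 0 := by
    rw [integral_congr_ae (g := fun _ => (0 : ℝ))]
    · simp
    · filter_upwards [Lp.coeFn_zero ℝ 2 (volume.restrict (Ioo (0 : ℝ) ℓ))] with x hx
      rw [hx]; simp
  rw [hz, neg_zero, φd'] at hw
  have h1 := integrable_mul_of_test f ψs.continuous ψc
  have h2 := integrable_mul_of_test f χs.continuous χc
  have h3 : ∫ x in Ioo 0 ℓ, f x * θ x = (∫ x in Ioo 0 ℓ, f x * ψ x) - m * c := by
    rw [← integral_const_mul, ← integral_sub h1 (h2.const_mul m)]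
    exact integral_congr_ae (Eventually.of_forall fun x => by simp only [hθ]; ring)
  have h4 : m = ∫ x in Ioo 0 ℓ, ψ x := by
    have := h0 ψ ψt (fun _ => 1)
    simpa using this
  simp only [smul_eq_mul]
  rw [h0 ψ ψt]
  have h5 : ∫ x in Ioo 0 ℓ, ψ x * (f x - c)
      = (∫ x in Ioo 0 ℓ, f x * ψ x) - c * ∫ x in Ioo 0 ℓ, ψ x := by
    rw [← integral_const_mul, ← integral_sub h1 (hψi.restrict.const_mul c)]
    exact integral_congr_ae (Eventually.of_forall fun x => by ring)
  rw [h5, ← h4]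
  linarith

theorem HasWeakDeriv.neg {ℓ : ℝ} {f g : L2 ℓ} (h : HasWeakDeriv f g) : HasWeakDeriv (-f) (-g) := by
  simpa using h.smul (-1)

theorem HasWeakDeriv.sub {ℓ : ℝ} {f g f' g' : L2 ℓ} (h : HasWeakDeriv f g)
    (h' : HasWeakDeriv f' g') : HasWeakDeriv (f - f') (g - g') := by
  simpa [sub_eq_add_neg] using h.add h'.neg

/-- The difference between `f` and a primitive of `g` has weak derivative `0`, hence is constant.
This is the bridge from the distributional definition to absolutely continuous functions, on which
integration by parts and traces rest. -/
theorem HasWeakDeriv.exists_isRep {ℓ : ℝ} (hℓ : 0 < ℓ) {f g : L2 ℓ} (h : HasWeakDeriv f g) :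
    ∃ c, IsRep f g (fun x => c + ∫ t in (0 : ℝ)..x, g t) := by
  have h1 := isRep_of_prim hℓ.le (fun x => rfl) (memLp_prim hℓ.le g 0).coeFn_toLp
  have h2 := h.sub (h1.hasWeakDeriv hℓ.le)
  rw [sub_self] at h2
  obtain ⟨c, hc⟩ := h2.ae_const hℓ
  refine ⟨c, isRep_of_prim hℓ.le (fun x => rfl) ?_⟩
  filter_upwards [hc, Lp.coeFn_sub f ((memLp_prim hℓ.le g 0).toLp _),
    (memLp_prim hℓ.le g 0).coeFn_toLp] with x h3 h4 h5
  rw [h4, Pi.sub_apply, h5] at h3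
  linarith

theorem eqOn_of_ae_eq {ℓ : ℝ} (hℓ : 0 < ℓ) {F G : ℝ → ℝ} (hF : ContinuousOn F (Icc 0 ℓ))
    (hG : ContinuousOn G (Icc 0 ℓ)) (h : F =ᵐ[volume.restrict (Ioo 0 ℓ)] G) :
    EqOn F G (Icc 0 ℓ) := by
  have h1 : EqOn F G (Ioo 0 ℓ) := Measure.eqOn_open_of_ae_eq h isOpen_Ioo
    (hF.mono Ioo_subset_Icc_self) (hG.mono Ioo_subset_Icc_self)
  exact h1.of_subset_closure hF hG Ioo_subset_Icc_self (closure_Ioo hℓ.ne).ge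

theorem HasTrace.eq_of_rep {ℓ x c : ℝ} (hℓ : 0 < ℓ) {f : L2 ℓ} {F : ℝ → ℝ} (h : HasTrace f x c)
    (hF : ContinuousOn F (Icc 0 ℓ)) (hf : f =ᵐ[volume.restrict (Ioo 0 ℓ)] F) (hx : x ∈ Icc 0 ℓ) :
    F x = c := by
  obtain ⟨G, h1, h2, rfl⟩ := h
  exact eqOn_of_ae_eq hℓ hF h1 (hf.symm.trans h2) hx

theorem HasTrace.unique {ℓ x c c' : ℝ} (hℓ : 0 < ℓ) {f : L2 ℓ} (h : HasTrace f x c)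
    (h' : HasTrace f x c') (hx : x ∈ Icc 0 ℓ) : c = c' := by
  obtain ⟨G, h1, h2, rfl⟩ := h
  exact h'.eq_of_rep hℓ h1 h2 hx

theorem HasWeakDeriv.exists_trace {ℓ : ℝ} (hℓ : 0 < ℓ) {f g : L2 ℓ} (h : HasWeakDeriv f g)
    (x : ℝ) : ∃ c, HasTrace f x c := by
  obtain ⟨c, hc⟩ := h.exists_isRep hℓ
  exact ⟨_, _, hc.continuousOn, hc.ae_eq, rfl⟩

theorem HasTrace.neg {ℓ x c : ℝ} {f : L2 ℓ} (h : HasTrace f x c) : HasTrace (-f) x (-c) := by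
  simpa using h.smul (-1)

theorem HasTrace.sub {ℓ x c c' : ℝ} {f f' : L2 ℓ} (h : HasTrace f x c) (h' : HasTrace f' x c') :
    HasTrace (f - f') x (c - c') := by
  simpa [sub_eq_add_neg] using h.add h'.neg

theorem HasWeakDeriv.unique {ℓ : ℝ} {f g g' : L2 ℓ} (h : HasWeakDeriv f g)
    (h' : HasWeakDeriv f g') : g = g' := by
  have key := isOpen_Ioo.ae_eq_zero_of_integral_contDiff_smul_eq_zero (U := Ioo 0 ℓ)
    (f := fun x => (g - g') x) (μ := volume)
    (IntegrableOn.locallyIntegrableOn (L2.integrable (g - g'))) ?_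
  · rw [← sub_eq_zero]
    refine Lp.ext ?_
    have := (ae_restrict_iff' (μ := volume) measurableSet_Ioo).mpr key
    filter_upwards [this, Lp.coeFn_zero ℝ 2 (volume.restrict (Ioo (0 : ℝ) ℓ))] with x h1 h2
    rw [h1, h2]; rfl
  intro ψ ψs ψc ψt
  have h1 := (h.sub h') ψ ψs ψc ψt
  have hz : ∫ x in Ioo 0 ℓ, (f - f) x * deriv ψ x = 0 := by
    rw [sub_self, integral_congr_ae (g := fun _ => (0 : ℝ))]
    · simp
    · filter_upwards [Lp.coeFn_zero ℝ 2 (volume.restrict (Ioo (0 : ℝ) ℓ))] with x hx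
      rw [hx]; simp
  rw [hz] at h1
  rw [← setIntegral_eq_integral_of_forall_compl_eq_zero (s := Ioo 0 ℓ)]
  · rw [integral_congr_ae (g := fun x => (g - g') x * ψ x)]
    · linarith
    · exact Eventually.of_forall fun x => by simp [mul_comm]
  · intro x hx
    rw [eq_zero_of_tsupport ψt hx, zero_smul]

/-- Integration by parts with a `C¹` weight. -/
theorem integral_by_parts {ℓ : ℝ} (hℓ : 0 < ℓ) {f f' g g' : L2 ℓ} (hf : HasWeakDeriv f f')
    (hg : HasWeakDeriv g g') {f0 fl g0 gl : ℝ} (hf0 : HasTrace f 0 f0) (hfl : HasTrace f ℓ fl)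
    (hg0 : HasTrace g 0 g0) (hgl : HasTrace g ℓ gl) {w w' : ℝ → ℝ}
    (hw : ContDiffOn ℝ 1 w (Icc 0 ℓ)) (hw' : ∀ x ∈ Ioo 0 ℓ, HasDerivAt w (w' x) x) :
    ∫ x in Ioo 0 ℓ, (w x * (f x * g' x + f' x * g x) + w' x * (f x * g x))
      = w ℓ * (fl * gl) - w 0 * (f0 * g0) := by
  obtain ⟨c, hc⟩ := hf.exists_isRep hℓ
  obtain ⟨d, hd⟩ := hg.exists_isRep hℓ
  set F := fun x => c + ∫ t in (0 : ℝ)..x, f' t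
  set G := fun x => d + ∫ t in (0 : ℝ)..x, g' t
  have e0 := hf0.eq_of_rep hℓ hc.continuousOn hc.ae_eq ⟨le_rfl, hℓ.le⟩
  have e1 := hfl.eq_of_rep hℓ hc.continuousOn hc.ae_eq ⟨hℓ.le, le_rfl⟩
  have e2 := hg0.eq_of_rep hℓ hd.continuousOn hd.ae_eq ⟨le_rfl, hℓ.le⟩
  have e3 := hgl.eq_of_rep hℓ hd.continuousOn hd.ae_eq ⟨hℓ.le, le_rfl⟩
  have hwac : AbsolutelyContinuousOnInterval w 0 ℓ := by
    refine ContDiffOn.absolutelyContinuousOnInterval ?_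
    rwa [uIcc_of_le hℓ.le]
  have := hc.integral_mul hℓ.le (G := w * G) (G' := fun x => w' x * G x + w x * g' x)
    (hwac.mul hd.ac) (by
      filter_upwards [hd.hasDeriv, ae_restrict_mem measurableSet_Ioo] with x h1 hx
      exact (hw' x hx).mul h1)
  simp only [Pi.mul_apply] at this
  rw [← e0, ← e1, ← e2, ← e3]
  rw [integral_congr_ae (g := fun x => f' x * (w x * G x) + f x * (w' x * G x + w x * g' x)), this]
  · ring
  · filter_upwards [hd.ae_eq] with x hx
    rw [hx]; ring

theorem memLp_id_mul {ℓ : ℝ} (g : L2 ℓ) :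
    MemLp (fun x : ℝ => x * g x) 2 (volume.restrict (Ioo (0 : ℝ) ℓ)) := by
  refine MemLp.of_le_mul (c := |ℓ|) (Lp.memLp g)
    (AEStronglyMeasurable.mul (by fun_prop) (Lp.aestronglyMeasurable g)) ?_
  filter_upwards [ae_restrict_mem measurableSet_Ioo] with x hx
  rw [norm_mul, Real.norm_eq_abs]
  gcongr
  exact hx.1.le
  exact hx.2.le

/-- Multiplication by the variable. -/
def mulX (ℓ : ℝ) : L2 ℓ →L[ℝ] L2 ℓ :=
  LinearMap.mkContinuous
    { toFun := fun g => (memLp_id_mul g).toLp _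
      map_add' := fun f g => by
        refine Lp.ext ?_
        filter_upwards [(memLp_id_mul (f + g)).coeFn_toLp, (memLp_id_mul f).coeFn_toLp,
          (memLp_id_mul g).coeFn_toLp, Lp.coeFn_add f g,
          Lp.coeFn_add ((memLp_id_mul f).toLp _) ((memLp_id_mul g).toLp _)] with x h1 h2 h3 h4 h5
        rw [h1, h5, Pi.add_apply, h2, h3, h4, Pi.add_apply, mul_add]
      map_smul' := fun c g => by
        refine Lp.ext ?_
        filter_upwards [(memLp_id_mul (c • g)).coeFn_toLp, (memLp_id_mul g).coeFn_toLp,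
          Lp.coeFn_smul c g, Lp.coeFn_smul c ((memLp_id_mul g).toLp _)] with x h1 h2 h3 h4
        simp only [RingHom.id_apply]
        rw [h1, h4, Pi.smul_apply, h2, h3, Pi.smul_apply, smul_eq_mul, smul_eq_mul]; ring }
    |ℓ| (fun g => by
      refine Lp.norm_le_mul_norm_of_ae_le_mul ?_
      filter_upwards [(memLp_id_mul g).coeFn_toLp, ae_restrict_mem measurableSet_Ioo] with x h1 hx
      simp only [LinearMap.coe_mk, AddHom.coe_mk]
      rw [h1, norm_mul, Real.norm_eq_abs]
      gcongr
      exact hx.1.le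
      exact hx.2.le)

theorem coeFn_mulX {ℓ : ℝ} (g : L2 ℓ) :
    mulX ℓ g =ᵐ[volume.restrict (Ioo 0 ℓ)] fun x => x * g x := (memLp_id_mul g).coeFn_toLp

theorem norm_mulX_le {ℓ : ℝ} (g : L2 ℓ) : ‖mulX ℓ g‖ ≤ |ℓ| * ‖g‖ :=
  (mulX ℓ).le_of_opNorm_le (LinearMap.mkContinuous_norm_le _ (abs_nonneg _) _) g

theorem inner_mulX {ℓ : ℝ} (f g : L2 ℓ) :
    inner ℝ (mulX ℓ f) g = ∫ x in Ioo 0 ℓ, x * (f x * g x) := by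
  rw [L2.inner_eq]
  refine integral_congr_ae ?_
  filter_upwards [coeFn_mulX f] with x hx
  rw [hx, mul_assoc]

theorem inner_mulX_comm {ℓ : ℝ} (f g : L2 ℓ) :
    inner ℝ (mulX ℓ f) g = inner ℝ f (mulX ℓ g) := by
  rw [inner_mulX, real_inner_comm, inner_mulX]
  simp only [mul_comm]

theorem integrable_mulX {ℓ : ℝ} (f g : L2 ℓ) :
    Integrable (fun x => x * (f x * g x)) (volume.restrict (Ioo 0 ℓ)) := by
  refine (L2.memLp_mul (mulX ℓ f) g).congr ?_
  filter_upwards [coeFn_mulX f] with x hx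
  rw [hx, mul_assoc]

theorem toLp_transport (b c : ℝ) (g : L2 1) :
    (Params.memLp_transport b c g).toLp _ = (b / c) • mulX 1 g - (1 / c) • g := by
  refine Lp.ext ?_
  filter_upwards [(Params.memLp_transport b c g).coeFn_toLp, coeFn_mulX g,
    Lp.coeFn_sub ((b / c) • mulX 1 g) ((1 / c) • g), Lp.coeFn_smul (b / c) (mulX 1 g),
    Lp.coeFn_smul (1 / c) g] with x h1 h2 h3 h4 h5
  rw [h1, h3, Pi.sub_apply, h4, h5, Pi.smul_apply, Pi.smul_apply, h2, smul_eq_mul, smul_eq_mul]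
  ring

theorem inner_by_parts {ℓ : ℝ} (hℓ : 0 < ℓ) {f f' g g' : L2 ℓ} (hf : HasWeakDeriv f f')
    (hg : HasWeakDeriv g g') {f0 fl g0 gl : ℝ} (hf0 : HasTrace f 0 f0) (hfl : HasTrace f ℓ fl)
    (hg0 : HasTrace g 0 g0) (hgl : HasTrace g ℓ gl) :
    inner ℝ f g' + inner ℝ f' g = fl * gl - f0 * g0 := by
  have := integral_by_parts hℓ hf hg hf0 hfl hg0 hgl (w := fun _ => 1) (w' := fun _ => 0)
    contDiffOn_const (fun x _ => hasDerivAt_const x 1)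
  simp only [one_mul, zero_mul, add_zero] at this
  rw [← this, L2.inner_eq, L2.inner_eq, integral_add (L2.memLp_mul f g') (L2.memLp_mul f' g)]

theorem inner_mulX_by_parts {ℓ : ℝ} (hℓ : 0 < ℓ) {f f' g g' : L2 ℓ} (hf : HasWeakDeriv f f')
    (hg : HasWeakDeriv g g') {f0 fl g0 gl : ℝ} (hf0 : HasTrace f 0 f0) (hfl : HasTrace f ℓ fl)
    (hg0 : HasTrace g 0 g0) (hgl : HasTrace g ℓ gl) :
    inner ℝ (mulX ℓ f) g' + inner ℝ (mulX ℓ f') g + inner ℝ f g = ℓ * (fl * gl) := by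
  have := integral_by_parts hℓ hf hg hf0 hfl hg0 hgl (w := fun x => x) (w' := fun _ => 1)
    contDiffOn_id (fun x _ => hasDerivAt_id x)
  simp only [one_mul, zero_mul, sub_zero] at this
  rw [← this, inner_mulX, inner_mulX, L2.inner_eq,
    ← integral_add (integrable_mulX f g') (integrable_mulX f' g), ← integral_add _ (L2.memLp_mul f g)]
  · simp only [mul_add]
  · exact (integrable_mulX f g').add (integrable_mulX f' g)

/-- The weight `x` in the integration by parts of `f · f` removes the end point `0`, so the trace at
`ℓ` is bounded by norms alone. -/
theorem trace_sq_le_right {ℓ c : ℝ} (hℓ : 0 < ℓ) {f f' : L2 ℓ} (hf : HasWeakDeriv f f')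
    (h : HasTrace f ℓ c) : ℓ * c ^ 2 ≤ 2 * ℓ * (‖f‖ * ‖f'‖) + ‖f‖ ^ 2 := by
  obtain ⟨d, hd⟩ := hf.exists_trace hℓ 0
  have h1 := inner_mulX_by_parts hℓ hf hf hd h hd h
  rw [inner_mulX_comm f' f, real_inner_comm f' (mulX ℓ f), real_inner_self_eq_norm_sq] at h1
  have h2 := (real_inner_le_norm f' (mulX ℓ f))
  have h3 := norm_mulX_le f
  rw [abs_of_pos hℓ] at h3
  have h4 : ‖f'‖ * ‖mulX ℓ f‖ ≤ ‖f'‖ * (ℓ * ‖f‖) := by gcongr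
  nlinarith

/-- The unweighted identity compares the squares of the two end point values, which reduces the
claim to the right end point. -/
theorem trace_sq_le_left {ℓ c : ℝ} (hℓ : 0 < ℓ) {f f' : L2 ℓ} (hf : HasWeakDeriv f f')
    (h : HasTrace f 0 c) : ℓ * c ^ 2 ≤ 4 * ℓ * (‖f‖ * ‖f'‖) + ‖f‖ ^ 2 := by
  obtain ⟨d, hd⟩ := hf.exists_trace hℓ ℓ
  have h1 := trace_sq_le_right hℓ hf hd
  have h2 := inner_by_parts hℓ hf hf h hd h hd
  have h3 := neg_le_of_abs_le (abs_real_inner_le_norm f f')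
  rw [real_inner_comm f f'] at h2
  nlinarith

theorem trace_sq_le {ℓ x c : ℝ} (hℓ : 0 < ℓ) (hx : x = 0 ∨ x = ℓ) {f f' : L2 ℓ}
    (hf : HasWeakDeriv f f') (h : HasTrace f x c) :
    c ^ 2 ≤ (4 + 1 / ℓ) * (‖f‖ + ‖f'‖) ^ 2 := by
  have h1 : ℓ * c ^ 2 ≤ 4 * ℓ * (‖f‖ * ‖f'‖) + ‖f‖ ^ 2 := by
    rcases hx with rfl | rfl
    · exact trace_sq_le_left hℓ hf h
    · have := trace_sq_le_right hℓ hf h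
      have : 0 ≤ x * (‖f‖ * ‖f'‖) := by positivity
      linarith
  have h2 : c ^ 2 ≤ 4 * (‖f‖ * ‖f'‖) + 1 / ℓ * ‖f‖ ^ 2 := by
    rw [← mul_le_mul_iff_right₀ hℓ]
    calc ℓ * c ^ 2 ≤ _ := h1
      _ = _ := by field_simp
  have h3 : 0 ≤ 1 / ℓ * (2 * ‖f‖ * ‖f'‖ + ‖f'‖ ^ 2) := by positivity
  nlinarith [sq_nonneg ‖f‖, sq_nonneg ‖f'‖, mul_nonneg (norm_nonneg f) (norm_nonneg f')]

/-- Each test function imposes the equality of two continuous functionals of the pair. -/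
theorem isClosed_hasWeakDeriv (ℓ : ℝ) : IsClosed {p : L2 ℓ × L2 ℓ | HasWeakDeriv p.1 p.2} := by
  simp only [HasWeakDeriv, ofPred_forall]
  refine isClosed_iInter fun φ => isClosed_iInter fun h1 => isClosed_iInter fun h2 =>
    isClosed_iInter fun h3 => ?_
  have m1 : MemLp φ 2 (volume.restrict (Ioo (0 : ℝ) ℓ)) :=
    (h1.continuous.memLp_of_hasCompactSupport h2).restrict _
  have m2 : MemLp (deriv φ) 2 (volume.restrict (Ioo (0 : ℝ) ℓ)) :=
    ((h1.continuous_deriv (by simp)).memLp_of_hasCompactSupport h2.deriv).restrict _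
  have e : ∀ (f : L2 ℓ) {u : ℝ → ℝ} (hu : MemLp u 2 (volume.restrict (Ioo (0 : ℝ) ℓ))),
      ∫ x in Ioo 0 ℓ, f x * u x = inner ℝ f (hu.toLp u) := by
    intro f u hu
    rw [L2.inner_eq]
    refine integral_congr_ae ?_
    filter_upwards [hu.coeFn_toLp] with x hx
    rw [hx]
  simp only [e _ m1, e _ m2]
  exact isClosed_eq (by fun_prop) (by fun_prop)

theorem HasWeakDeriv.of_tendsto {ℓ : ℝ} {ι : Type*} {l : Filter ι} [l.NeBot] {f g : ι → L2 ℓ}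
    {f₀ g₀ : L2 ℓ} (h : ∀ i, HasWeakDeriv (f i) (g i)) (hf : Tendsto f l (𝓝 f₀))
    (hg : Tendsto g l (𝓝 g₀)) : HasWeakDeriv f₀ g₀ :=
  (isClosed_hasWeakDeriv ℓ).mem_of_tendsto (hf.prodMk_nhds hg) (Eventually.of_forall h)

/-- Traces at the end points depend continuously on the function in `H¹`. -/
theorem tendsto_trace {ℓ x : ℝ} (hℓ : 0 < ℓ) (hx : x = 0 ∨ x = ℓ) {ι : Type*} {l : Filter ι}
    {f g : ι → L2 ℓ} {c : ι → ℝ} {f₀ g₀ : L2 ℓ} {c₀ : ℝ}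
    (h : ∀ᶠ i in l, HasWeakDeriv (f i) (g i) ∧ HasTrace (f i) x (c i))
    (h₀ : HasWeakDeriv f₀ g₀) (hc₀ : HasTrace f₀ x c₀)
    (hf : Tendsto f l (𝓝 f₀)) (hg : Tendsto g l (𝓝 g₀)) : Tendsto c l (𝓝 c₀) := by
  have h1 : Tendsto (fun i => (4 + 1 / ℓ) * (‖f i - f₀‖ + ‖g i - g₀‖) ^ 2) l (𝓝 0) := by
    have := (((tendsto_iff_norm_sub_tendsto_zero.mp hf).add
      (tendsto_iff_norm_sub_tendsto_zero.mp hg)).pow 2).const_mul (4 + 1 / ℓ)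
    simpa using this
  have h2 : Tendsto (fun i => (c i - c₀) ^ 2) l (𝓝 0) := by
    refine tendsto_of_tendsto_of_tendsto_of_le_of_le' tendsto_const_nhds h1
      (Eventually.of_forall fun i => sq_nonneg _) ?_
    filter_upwards [h] with i hi
    exact trace_sq_le hℓ hx (hi.1.sub h₀) (hi.2.sub hc₀)
  rw [tendsto_iff_norm_sub_tendsto_zero]
  have := h2.sqrt
  simpa [Real.sqrt_sq_eq_abs] using this

theorem HasTrace.of_tendsto {ℓ x : ℝ} (hℓ : 0 < ℓ) (hx : x = 0 ∨ x = ℓ) {ι : Type*} {l : Filter ι}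
    [l.NeBot] {f g : ι → L2 ℓ} {c : ι → ℝ} {f₀ g₀ : L2 ℓ} {c₀ : ℝ}
    (h : ∀ i, HasWeakDeriv (f i) (g i)) (h' : ∀ i, HasTrace (f i) x (c i))
    (hf : Tendsto f l (𝓝 f₀)) (hg : Tendsto g l (𝓝 g₀)) (hc : Tendsto c l (𝓝 c₀)) :
    HasTrace f₀ x c₀ := by
  have h₀ := HasWeakDeriv.of_tendsto h hf hg
  obtain ⟨d, hd⟩ := h₀.exists_trace hℓ x
  have := tendsto_trace hℓ hx (Eventually.of_forall fun i => ⟨h i, h' i⟩) h₀ hd hf hg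
  rwa [tendsto_nhds_unique hc this]

/-- Smooth functions with compact support in `(0,ℓ)` are dense in `L²(0,ℓ)`. -/
theorem dense_test (ℓ : ℝ) : Dense {f : L2 ℓ | ∃ φ : ℝ → ℝ,
    ContDiff ℝ ((⊤ : ℕ∞) : WithTop ℕ∞) φ ∧ HasCompactSupport φ ∧ tsupport φ ⊆ Ioo 0 ℓ ∧
      f =ᵐ[volume.restrict (Ioo 0 ℓ)] φ} := by
  let S : Submodule ℝ (L2 ℓ) :=
    { carrier := {f : L2 ℓ | ∃ φ : ℝ → ℝ,
        ContDiff ℝ ((⊤ : ℕ∞) : WithTop ℕ∞) φ ∧ HasCompactSupport φ ∧ tsupport φ ⊆ Ioo 0 ℓ ∧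
          f =ᵐ[volume.restrict (Ioo 0 ℓ)] φ}
      zero_mem' := ⟨0, contDiff_const, HasCompactSupport.zero,
        by rw [tsupport_zero]; exact empty_subset _, Lp.coeFn_zero ℝ 2 _⟩
      add_mem' := by
        rintro f g ⟨φ, a1, a2, a3, a4⟩ ⟨ψ, b1, b2, b3, b4⟩
        exact ⟨φ + ψ, a1.add b1, a2.add b2, (tsupport_add φ ψ).trans (union_subset a3 b3),
          (Lp.coeFn_add f g).trans (a4.add b4)⟩
      smul_mem' := by
        rintro c f ⟨φ, a1, a2, a3, a4⟩
        refine ⟨c • φ, a1.const_smul c, a2.smul_left (f := fun _ => c), ?_,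
          (Lp.coeFn_smul c f).trans (a4.const_smul c)⟩
        exact (closure_mono (Function.support_const_smul_subset c φ)).trans a3 }
  have : S.topologicalClosure = ⊤ := by
    rw [Submodule.topologicalClosure_eq_top_iff, Submodule.eq_bot_iff]
    intro f hf
    rw [Submodule.mem_orthogonal] at hf
    have key := isOpen_Ioo.ae_eq_zero_of_integral_contDiff_smul_eq_zero (U := Ioo 0 ℓ)
      (f := f) (μ := volume) (IntegrableOn.locallyIntegrableOn (L2.integrable f)) ?_
    · refine Lp.ext ?_
      have := (ae_restrict_iff' (μ := volume) measurableSet_Ioo).mpr key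
      filter_upwards [this, Lp.coeFn_zero ℝ 2 (volume.restrict (Ioo (0 : ℝ) ℓ))] with x h1 h2
      rw [h1, h2]; rfl
    intro φ h1 h2 h3
    have m1 : MemLp φ 2 (volume.restrict (Ioo (0 : ℝ) ℓ)) :=
      (h1.continuous.memLp_of_hasCompactSupport h2).restrict _
    have := hf (m1.toLp φ) ⟨φ, h1, h2, h3, m1.coeFn_toLp⟩
    rw [L2.inner_eq] at this
    rw [← setIntegral_eq_integral_of_forall_compl_eq_zero (s := Ioo 0 ℓ)]
    · refine Eq.trans (integral_congr_ae ?_) this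
      filter_upwards [m1.coeFn_toLp] with x hx
      rw [hx, smul_eq_mul]
    · intro x hx
      rw [eq_zero_of_tsupport h3 hx, zero_smul]
  have h := (Submodule.dense_iff_topologicalClosure_eq_top).mpr this
  exact h

/-- Wirtinger's inequality. -/
theorem wirtinger {ℓ k : ℝ} (hℓ : 0 < ℓ) (hk : 0 < k) (hkl : k * ℓ < Real.pi) {f f' : L2 ℓ}
    (hf : HasWeakDeriv f f') (h0 : HasTrace f 0 0) (h1 : HasTrace f ℓ 0) :
    k ^ 2 * ‖f‖ ^ 2 ≤ ‖f'‖ ^ 2 := by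
  -- The weight solves the Riccati equation `w' = k² + w²` and is finite on `[0,ℓ]` because `kℓ <
  -- π`. Consequently `f'² - k² f² + (w f²)' = (f' + w f)² ≥ 0`, and the exact derivative integrates
  -- to `0`.
  set w : ℝ → ℝ := fun x => k * Real.tan (k * (x - ℓ / 2)) with hw
  set w' : ℝ → ℝ := fun x => k * (1 / Real.cos (k * (x - ℓ / 2)) ^ 2 * k) with hw'
  have hcos : ∀ x ∈ Icc 0 ℓ, Real.cos (k * (x - ℓ / 2)) ≠ 0 := fun x hx => by
    refine (Real.cos_pos_of_mem_Ioo ⟨?_, ?_⟩).ne' <;> nlinarith [hx.1, hx.2]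
  have hwd : ∀ x ∈ Icc 0 ℓ, HasDerivAt w (w' x) x := fun x hx => by
    have h2 : HasDerivAt (fun y : ℝ => k * (y - ℓ / 2)) k x := by
      simpa using ((hasDerivAt_id x).sub_const (ℓ / 2)).const_mul k
    exact ((Real.hasDerivAt_tan (hcos x hx)).comp x h2).const_mul k
  have hw'c : ContinuousOn w' (Icc 0 ℓ) := by
    refine continuousOn_const.mul ((ContinuousOn.div continuousOn_const (by fun_prop) ?_).mul
      continuousOn_const)
    exact fun x hx => pow_ne_zero 2 (hcos x hx)
  have hwc : ContDiffOn ℝ 1 w (Icc 0 ℓ) := by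
    intro x hx
    refine ContDiffAt.contDiffWithinAt ?_
    exact contDiffAt_const.mul (ContDiffAt.comp x (g := Real.tan)
      (f := fun y : ℝ => k * (y - ℓ / 2)) (Real.contDiffAt_tan.mpr (hcos x hx))
      (contDiffAt_const.mul (contDiffAt_id.sub contDiffAt_const)))
  have key := integral_by_parts hℓ hf hf h0 h1 h0 h1 hwc
    (fun x hx => hwd x (Ioo_subset_Icc_self hx))
  simp only [mul_zero, sub_zero] at key
  have hbd : ∀ (u : ℝ → ℝ), ContinuousOn u (Icc 0 ℓ) → ∀ v : ℝ → ℝ,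
      Integrable v (volume.restrict (Ioo 0 ℓ)) →
      Integrable (fun x => u x * v x) (volume.restrict (Ioo 0 ℓ)) := by
    intro u hu v hv
    obtain ⟨C, hC⟩ := isCompact_Icc.exists_bound_of_continuousOn hu
    refine hv.bdd_mul (c := C) ((hu.mono Ioo_subset_Icc_self).aestronglyMeasurable measurableSet_Ioo) ?_
    filter_upwards [ae_restrict_mem measurableSet_Ioo] with x hx using hC x (Ioo_subset_Icc_self hx)
  have i1 := (hbd w hwc.continuousOn _ ((L2.memLp_mul f f').add (L2.memLp_mul f' f))).add
    (hbd w' hw'c _ (L2.memLp_mul f f))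
  have i2 := (L2.memLp_mul f' f').sub ((L2.memLp_mul f f).const_mul (k ^ 2))
  have h3 : 0 ≤ ∫ x in Ioo 0 ℓ, ((f' x * f' x - k ^ 2 * (f x * f x))
      + (w x * (f x * f' x + f' x * f x) + w' x * (f x * f x))) := by
    refine integral_nonneg_of_ae ?_
    filter_upwards [ae_restrict_mem measurableSet_Ioo] with x hx
    have h4 : w' x = k ^ 2 + w x ^ 2 := by
      have := hcos x (Ioo_subset_Icc_self hx)
      simp only [hw, hw']
      generalize k * (x - ℓ / 2) = θ at this
      rw [Real.tan_eq_sin_div_cos, mul_pow, div_pow, Real.sin_sq]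
      field_simp
      ring
    rw [h4]
    have : 0 ≤ (f' x + w x * f x) ^ 2 := sq_nonneg _
    simp only [Pi.zero_apply]
    nlinarith
  have h5 := integral_add i2 i1
  simp only [Pi.add_apply, Pi.sub_apply] at h5
  have h6 := integral_sub (L2.memLp_mul f' f') ((L2.memLp_mul f f).const_mul (k ^ 2))
  rw [integral_const_mul] at h6
  rw [← real_inner_self_eq_norm_sq, ← real_inner_self_eq_norm_sq, L2.inner_eq, L2.inner_eq]
  have h7 := h5.symm.trans_ge h3
  rw [key] at h7
  linarith

/-! ### The domain of the operator. -/

namespace Params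

theorem InDomain.add {P : Params} {η ω η' ω' : Fin 6 → L2 P.L} {z z' : Fin 2 → L2 1}
    {p q p' q' : ℝ} (h : P.InDomain η ω z p q) (h' : P.InDomain η' ω' z' p' q') :
    P.InDomain (η + η') (ω + ω') (z + z') (p + p') (q + q') where
  η_deriv i := (h.η_deriv i).add (h'.η_deriv i)
  ω_deriv i := (h.ω_deriv i).add (h'.ω_deriv i)
  z_deriv := h.z_deriv.add h'.z_deriv
  η_zero := by simpa using h.η_zero.add h'.η_zero
  η_L := by simpa using h.η_L.add h'.η_L
  ηx_zero := by simpa using h.ηx_zero.add h'.ηx_zero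
  ηx_L := by simpa using h.ηx_L.add h'.ηx_L
  ω_zero := by simpa using h.ω_zero.add h'.ω_zero
  ω_L := by simpa using h.ω_L.add h'.ω_L
  ωx_zero := by simpa using h.ωx_zero.add h'.ωx_zero
  ωx_L := by simpa using h.ωx_L.add h'.ωx_L
  ηxx_zero := by simpa using h.ηxx_zero.add h'.ηxx_zero
  ηxx_L := h.ηxx_L.add h'.ηxx_L
  z_zero := h.z_zero.add h'.z_zero
  z_one := h.z_one.add h'.z_one
  ωxx_L := by
    have := h.ωxx_L.add h'.ωxx_L
    rwa [show P.α * p + P.β * q + (P.α * p' + P.β * q')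
      = P.α * (p + p') + P.β * (q + q') by ring] at this

theorem InDomain.smul {P : Params} {η ω : Fin 6 → L2 P.L} {z : Fin 2 → L2 1}
    {p q : ℝ} (c : ℝ) (h : P.InDomain η ω z p q) :
    P.InDomain (c • η) (c • ω) (c • z) (c * p) (c * q) where
  η_deriv i := (h.η_deriv i).smul c
  ω_deriv i := (h.ω_deriv i).smul c
  z_deriv := h.z_deriv.smul c
  η_zero := by simpa using h.η_zero.smul c
  η_L := by simpa using h.η_L.smul c
  ηx_zero := by simpa using h.ηx_zero.smul c
  ηx_L := by simpa using h.ηx_L.smul c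
  ω_zero := by simpa using h.ω_zero.smul c
  ω_L := by simpa using h.ω_L.smul c
  ωx_zero := by simpa using h.ωx_zero.smul c
  ωx_L := by simpa using h.ωx_L.smul c
  ηxx_zero := by simpa using h.ηxx_zero.smul c
  ηxx_L := h.ηxx_L.smul c
  z_zero := h.z_zero.smul c
  z_one := h.z_one.smul c
  ωxx_L := by
    have := h.ωxx_L.smul c
    rwa [show c * (P.α * p + P.β * q) = P.α * (c * p) + P.β * (c * q) by ring] at this

theorem InDomain.zero (P : Params) : P.InDomain 0 0 0 0 0 where
  η_deriv _ := .zero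
  ω_deriv _ := .zero
  z_deriv := .zero
  η_zero := .zero
  η_L := .zero
  ηx_zero := .zero
  ηx_L := .zero
  ω_zero := .zero
  ω_L := .zero
  ωx_zero := .zero
  ωx_L := .zero
  ηxx_zero := .zero
  ηxx_L := .zero
  z_zero := .zero
  z_one := .zero
  ωxx_L := by simpa using HasTrace.zero

/-- The domain `D`, an element being recorded together with its derivatives. -/
def dom (P : Params) : Submodule ℝ ((Fin 6 → L2 P.L) × (Fin 6 → L2 P.L) × (Fin 2 → L2 1)) where
  carrier := {k | ∃ p q, P.InDomain k.1 k.2.1 k.2.2 p q}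
  zero_mem' := ⟨0, 0, .zero P⟩
  add_mem' := by
    rintro k k' ⟨p, q, h⟩ ⟨p', q', h'⟩
    exact ⟨_, _, h.add h'⟩
  smul_mem' := by
    rintro c k ⟨p, q, h⟩
    exact ⟨_, _, h.smul c⟩

/-- Weak derivatives survive `L²` limits, and the traces `p`, `q` converge along with the tuples.
Closedness makes the domain a Banach space in its graph-type norm, which the inverse mapping theorem
needs for the resolvent. -/
theorem isClosed_dom (P : Params) (hL : 0 < P.L) :
    IsClosed (P.dom : Set ((Fin 6 → L2 P.L) × (Fin 6 → L2 P.L) × (Fin 2 → L2 1))) := by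
  refine isClosed_of_closure_subset fun k hk => ?_
  obtain ⟨u, hu, hlim⟩ := mem_closure_iff_seq_limit.mp hk
  choose p q h using hu
  have hη : ∀ i, Tendsto (fun n => (u n).1 i) atTop (𝓝 (k.1 i)) := fun i =>
    ((continuous_apply i).comp continuous_fst).continuousAt.tendsto.comp hlim
  have hω : ∀ i, Tendsto (fun n => (u n).2.1 i) atTop (𝓝 (k.2.1 i)) := fun i =>
    ((continuous_apply i).comp (continuous_fst.comp continuous_snd)).continuousAt.tendsto.comp hlim
  have hz : ∀ i, Tendsto (fun n => (u n).2.2 i) atTop (𝓝 (k.2.2 i)) := fun i =>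
    ((continuous_apply i).comp (continuous_snd.comp continuous_snd)).continuousAt.tendsto.comp hlim
  have dη : ∀ i : Fin 5, HasWeakDeriv (k.1 i.castSucc) (k.1 i.succ) := fun i =>
    .of_tendsto (fun n => (h n).η_deriv i) (hη _) (hη _)
  have dω : ∀ i : Fin 5, HasWeakDeriv (k.2.1 i.castSucc) (k.2.1 i.succ) := fun i =>
    .of_tendsto (fun n => (h n).ω_deriv i) (hω _) (hω _)
  have dz : HasWeakDeriv (k.2.2 0) (k.2.2 1) := .of_tendsto (fun n => (h n).z_deriv) (hz _) (hz _)
  obtain ⟨p₀, hp₀⟩ := (dη 2).exists_trace hL P.L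
  obtain ⟨q₀, hq₀⟩ := dz.exists_trace one_pos 1
  have lp : Tendsto p atTop (𝓝 p₀) := tendsto_trace hL (Or.inr rfl)
    (Eventually.of_forall fun n => ⟨(h n).η_deriv 2, (h n).ηxx_L⟩) (dη 2) hp₀ (hη _) (hη _)
  have lq : Tendsto q atTop (𝓝 q₀) := tendsto_trace one_pos (Or.inr rfl)
    (Eventually.of_forall fun n => ⟨(h n).z_deriv, (h n).z_one⟩) dz hq₀ (hz _) (hz _)
  have tη : ∀ (i : Fin 5) (x : ℝ), (x = 0 ∨ x = P.L) →
      (∀ n, HasTrace ((u n).1 i.castSucc) x 0) → HasTrace (k.1 i.castSucc) x 0 := fun i x hx hn =>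
    .of_tendsto hL hx (fun n => (h n).η_deriv i) hn (hη _) (hη _) tendsto_const_nhds
  have tω : ∀ (i : Fin 5) (x : ℝ), (x = 0 ∨ x = P.L) →
      (∀ n, HasTrace ((u n).2.1 i.castSucc) x 0) → HasTrace (k.2.1 i.castSucc) x 0 :=
    fun i x hx hn =>
    .of_tendsto hL hx (fun n => (h n).ω_deriv i) hn (hω _) (hω _) tendsto_const_nhds
  exact ⟨p₀, q₀,
    { η_deriv := dη
      ω_deriv := dω
      z_deriv := dz
      η_zero := tη 0 0 (Or.inl rfl) fun n => (h n).η_zero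
      η_L := tη 0 _ (Or.inr rfl) fun n => (h n).η_L
      ηx_zero := tη 1 0 (Or.inl rfl) fun n => (h n).ηx_zero
      ηx_L := tη 1 _ (Or.inr rfl) fun n => (h n).ηx_L
      ω_zero := tω 0 0 (Or.inl rfl) fun n => (h n).ω_zero
      ω_L := tω 0 _ (Or.inr rfl) fun n => (h n).ω_L
      ωx_zero := tω 1 0 (Or.inl rfl) fun n => (h n).ωx_zero
      ωx_L := tω 1 _ (Or.inr rfl) fun n => (h n).ωx_L
      ηxx_zero := tη 2 0 (Or.inl rfl) fun n => (h n).ηxx_zero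
      ηxx_L := hp₀
      z_zero := .of_tendsto one_pos (Or.inl rfl) (fun n => (h n).z_deriv) (fun n => (h n).z_zero)
        (hz _) (hz _) lp
      z_one := hq₀
      ωxx_L := .of_tendsto hL (Or.inr rfl) (fun n => (h n).ω_deriv 2) (fun n => (h n).ωxx_L)
        (hω _) (hω _) ((lp.const_mul _).add (lq.const_mul _)) }⟩

/-! ### Multiplier identities -/

/-- The multiplier `(η, ω)`. -/
theorem InDomain.energy {P : Params} (hL : 0 < P.L) {η ω : Fin 6 → L2 P.L} {z : Fin 2 → L2 1}
    {p q : ℝ} (h : P.InDomain η ω z p q) (t : ℝ) :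
    inner ℝ (η 0) (P.A t η ω z).1.1 + inner ℝ (ω 0) (P.A t η ω z).1.2
      = -(P.a₁ * (p * (P.α * p + P.β * q))) := by
  obtain ⟨c2, hc2⟩ := (h.ω_deriv 2).exists_trace hL 0
  obtain ⟨c3, hc3⟩ := (h.η_deriv 3).exists_trace hL 0
  obtain ⟨c3', hc3'⟩ := (h.η_deriv 3).exists_trace hL P.L
  obtain ⟨d3, hd3⟩ := (h.ω_deriv 3).exists_trace hL 0
  obtain ⟨d3', hd3'⟩ := (h.ω_deriv 3).exists_trace hL P.L
  obtain ⟨c4, hc4⟩ := (h.η_deriv 4).exists_trace hL 0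
  obtain ⟨c4', hc4'⟩ := (h.η_deriv 4).exists_trace hL P.L
  obtain ⟨d4, hd4⟩ := (h.ω_deriv 4).exists_trace hL 0
  obtain ⟨d4', hd4'⟩ := (h.ω_deriv 4).exists_trace hL P.L
  have e1 := inner_by_parts hL (h.η_deriv 0) (h.ω_deriv 0) h.η_zero h.η_L h.ω_zero h.ω_L
  have e2 := inner_by_parts hL (h.η_deriv 0) (h.ω_deriv 2) h.η_zero h.η_L hc2 h.ωxx_L
  have e3 := inner_by_parts hL (h.ω_deriv 0) (h.η_deriv 2) h.ω_zero h.ω_L h.ηxx_zero h.ηxx_L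
  have e4 := inner_by_parts hL (h.η_deriv 1) (h.ω_deriv 1) h.ηx_zero h.ηx_L h.ωx_zero h.ωx_L
  have e5 := inner_by_parts hL (h.η_deriv 0) (h.ω_deriv 4) h.η_zero h.η_L hd4 hd4'
  have e6 := inner_by_parts hL (h.η_deriv 1) (h.ω_deriv 3) h.ηx_zero h.ηx_L hd3 hd3'
  have e7 := inner_by_parts hL (h.ω_deriv 0) (h.η_deriv 4) h.ω_zero h.ω_L hc4 hc4'
  have e8 := inner_by_parts hL (h.ω_deriv 1) (h.η_deriv 3) h.ωx_zero h.ωx_L hc3 hc3'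
  have e9 := inner_by_parts hL (h.η_deriv 2) (h.ω_deriv 2) h.ηxx_zero h.ηxx_L hc2 h.ωxx_L
  simp only [Fin.reduceSucc, Fin.reduceCastSucc, zero_mul, mul_zero, sub_zero] at e1 e2 e3 e4 e5 e6 e7 e8 e9
  simp only [A, inner_sub_right, inner_neg_right, inner_smul_right]
  rw [real_inner_comm (ω 0) (η 1)] at e1
  rw [real_inner_comm (ω 1) (η 2)] at e4
  rw [real_inner_comm (ω 2) (η 3)] at e9
  -- All boundary products contain a vanishing trace, except that of the second derivatives at `L`
  -- in `e9`; its counterpart at `0` is killed by `ηₓₓ(0) = 0`.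
  linear_combination (-1) * e1 - P.a * (e2 + e3 - e4) - P.a₁ * (e5 - e6 + e7 - e8 + e9)

/-- The multiplier `z` for the transport equation. -/
theorem InDomain.transport {P : Params} {η ω : Fin 6 → L2 P.L} {z : Fin 2 → L2 1}
    {p q : ℝ} (h : P.InDomain η ω z p q) {t : ℝ} (ht : P.τ t ≠ 0) :
    2 * P.τ t * inner ℝ (z 0) (P.A t η ω z).2
      = (P.τ' t - 1) * q ^ 2 + p ^ 2 - P.τ' t * ‖z 0‖ ^ 2 := by
  have e1 := inner_mulX_by_parts one_pos h.z_deriv h.z_deriv h.z_zero h.z_one h.z_zero h.z_one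
  have e2 := inner_by_parts one_pos h.z_deriv h.z_deriv h.z_zero h.z_one h.z_zero h.z_one
  simp only [A, toLp_transport, inner_sub_right, inner_smul_right]
  rw [inner_mulX_comm (z 1) (z 0), real_inner_comm (mulX 1 (z 0)) (z 1)] at e1
  rw [real_inner_comm (z 0) (z 1)] at e2
  rw [inner_mulX_comm] at e1
  rw [real_inner_self_eq_norm_sq] at e1
  field_simp
  linear_combination P.τ' t * e1 - e2

/-- The multiplier `x u` for a single component. -/
theorem kato_component {ℓ a a₁ r : ℝ} (hℓ : 0 < ℓ) {u : Fin 6 → L2 ℓ}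
    (hu : ∀ i : Fin 5, HasWeakDeriv (u i.castSucc) (u i.succ)) (h0 : HasTrace (u 0) 0 0)
    (h0' : HasTrace (u 0) ℓ 0) (h1 : HasTrace (u 1) 0 0) (h1' : HasTrace (u 1) ℓ 0)
    (h2 : HasTrace (u 2) ℓ r) :
    inner ℝ (mulX ℓ (u 0)) (-u 1 - a • u 3 - a₁ • u 5)
      = 1 / 2 * ‖u 0‖ ^ 2 - 3 * a / 2 * ‖u 1‖ ^ 2 + 5 * a₁ / 2 * ‖u 2‖ ^ 2
        - a₁ * ℓ / 2 * r ^ 2 := by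
  obtain ⟨c2, h2'⟩ := (hu 2).exists_trace hℓ 0
  obtain ⟨c3, h3⟩ := (hu 3).exists_trace hℓ 0
  obtain ⟨c3', h3'⟩ := (hu 3).exists_trace hℓ ℓ
  obtain ⟨c4, h4⟩ := (hu 4).exists_trace hℓ 0
  obtain ⟨c4', h4'⟩ := (hu 4).exists_trace hℓ ℓ
  have e1 := inner_mulX_by_parts hℓ (hu 0) (hu 0) h0 h0' h0 h0'
  have e2 := inner_mulX_by_parts hℓ (hu 0) (hu 2) h0 h0' h2' h2
  have e3 := inner_by_parts hℓ (hu 0) (hu 1) h0 h0' h1 h1'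
  have e4 := inner_mulX_by_parts hℓ (hu 1) (hu 1) h1 h1' h1 h1'
  have e5 := inner_mulX_by_parts hℓ (hu 0) (hu 4) h0 h0' h4 h4'
  have e6 := inner_by_parts hℓ (hu 0) (hu 3) h0 h0' h3 h3'
  have e7 := inner_by_parts hℓ (hu 1) (hu 2) h1 h1' h2' h2
  have e8 := inner_mulX_by_parts hℓ (hu 1) (hu 3) h1 h1' h3 h3'
  have e9 := inner_mulX_by_parts hℓ (hu 2) (hu 2) h2' h2 h2' h2
  simp only [Fin.reduceSucc, Fin.reduceCastSucc, zero_mul, mul_zero, sub_zero] at e1 e2 e3 e4 e5 e6 e7 e8 e9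
  simp only [inner_sub_right, inner_neg_right, inner_smul_right]
  rw [inner_mulX_comm (u 1) (u 0), real_inner_comm (mulX ℓ (u 0)) (u 1),
    real_inner_self_eq_norm_sq] at e1
  rw [real_inner_self_eq_norm_sq] at e3 e4 e7 e9
  rw [inner_mulX_comm (u 2) (u 1), real_inner_comm (mulX ℓ (u 1)) (u 2)] at e4
  rw [inner_mulX_comm (u 3) (u 2), real_inner_comm (mulX ℓ (u 2)) (u 3)] at e9
  -- The unweighted identities `e3`, `e6`, `e7` account for the derivative falling on the weight
  -- `x`. Each raises the plain factor `1/2` by one, giving `3/2` for the third-order term and `5/2`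
  -- for the fifth-order one.
  linear_combination (-1 / 2) * e1 - a * (e2 - e3 - 1 / 2 * e4)
    - a₁ * (e5 - e6 + e7 - e8 + e7 + 1 / 2 * e9)

end Params

/-! ### Calculus on a closed time interval, the delay and the gain condition. -/

theorem integral_eq_sub_of_hasDerivWithinAt {E : Type*} [NormedAddCommGroup E] [NormedSpace ℝ E]
    [CompleteSpace E] {T : ℝ} {f f' : ℝ → E}
    (hf : ∀ t ∈ Icc 0 T, HasDerivWithinAt f (f' t) (Icc 0 T) t) (hf' : ContinuousOn f' (Icc 0 T))
    {t : ℝ} (ht : t ∈ Icc 0 T) : ∫ s in (0 : ℝ)..t, f' s = f t - f 0 := by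
  have hsub : Icc 0 t ⊆ Icc 0 T := Icc_subset_Icc_right ht.2
  refine intervalIntegral.integral_eq_sub_of_hasDerivAt_of_le ht.1
    (fun s hs => ((hf s (hsub hs)).continuousWithinAt.mono hsub)) (fun s hs => ?_) ?_
  · exact (hf s (hsub (Ioo_subset_Icc_self hs))).hasDerivAt
      (Icc_mem_nhds hs.1 (hs.2.trans_le ht.2))
  · refine ContinuousOn.intervalIntegrable ?_
    rw [uIcc_of_le ht.1]
    exact hf'.mono hsub

theorem memLp_of_continuousOn' {E : Type*} [NormedAddCommGroup E] {T : ℝ} {F : ℝ → E}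
    (hF : ContinuousOn F (Icc 0 T)) : MemLp F 2 (volume.restrict (Ioo 0 T)) := by
  obtain ⟨C, hC⟩ := isCompact_Icc.exists_bound_of_continuousOn hF
  refine MemLp.of_bound ((hF.mono Ioo_subset_Icc_self).aestronglyMeasurable measurableSet_Ioo) C ?_
  filter_upwards [ae_restrict_mem measurableSet_Ioo] with x hx using hC x (Ioo_subset_Icc_self hx)

namespace Params

variable {P : Params} {T : ℝ}

/-- The slack in the condition on the gains. -/
def gap (P : Params) : ℝ := 2 * P.a₁ * P.α - |P.β| - |P.β| * P.a₁ ^ 2 / (1 - P.d)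

/-- The condition on the gains, multiplied by `2 a₁`, is this inequality. -/
theorem Admissible.gap_pos (hP : P.Admissible) : 0 < P.gap := by
  have h1 := hP.gain
  have h2 : 0 < 1 - P.d := by linarith [hP.d_lt_one]
  have h3 := hP.a₁_pos
  have h4 := mul_lt_mul_of_pos_left h1 (by positivity : 0 < 2 * P.a₁)
  have h5 : 2 * P.a₁ * (|P.β| / (2 * P.a₁) * ((P.a₁ ^ 2 + 1 - P.d) / (1 - P.d)))
      = |P.β| + |P.β| * P.a₁ ^ 2 / (1 - P.d) := by
    field_simp
    ring
  rw [h5] at h4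
  unfold gap
  linarith

theorem Admissible.hasDerivWithinAt_τ (hP : P.Admissible) {t : ℝ} (ht : 0 ≤ t) :
    HasDerivWithinAt P.τ (P.τ' t) (Ici 0) t :=
  (hP.τ_diff t ht).hasDerivWithinAt

theorem Admissible.continuousOn_τ' (hP : P.Admissible) : ContinuousOn P.τ' (Ici 0) := by
  intro t ht
  obtain ⟨K, hK⟩ := hP.τ_lip (t + 1) (by linarith [mem_Ici.mp ht])
  have h1 := hK.continuousOn t ⟨ht, by linarith⟩
  refine h1.mono_of_mem_nhdsWithin ?_
  rw [← Ici_inter_Iic]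
  exact inter_mem_nhdsWithin _ (Iic_mem_nhds (by linarith))

theorem Admissible.τ_pos (hP : P.Admissible) {t : ℝ} (ht : 0 ≤ t) : 0 < P.τ t :=
  hP.τ_zero_pos.trans_le (hP.τ_ge t ht)

/-- The dissipation inequality for the boundary terms. -/
theorem Admissible.dissipation (hP : P.Admissible) {κ : ℝ} (hκ : |P.β| ≤ κ) {θ : ℝ} (h3 : θ ≤ P.d)
    (p q : ℝ) : -(2 * P.a₁ * (p * (P.α * p + P.β * q))) + κ * ((θ - 1) * q ^ 2 + p ^ 2)
      ≤ -((P.gap + |P.β| - κ) * p ^ 2) := by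
  have h2 : 0 < 1 - P.d := by linarith [hP.d_lt_one]
  have h4 : κ * (θ - 1) * q ^ 2 ≤ -(|P.β| * (1 - P.d) * q ^ 2) := by
    have : |P.β| * (1 - P.d) ≤ κ * (1 - θ) := by
      have := abs_nonneg P.β
      gcongr
      linarith
    nlinarith [sq_nonneg q]
  -- Young's inequality with the weight `1 - d`, so that the `q²` term is exactly what `h4` absorbs.
  have h5 : -(2 * P.a₁ * (P.β * (p * q)))
      ≤ |P.β| * (P.a₁ ^ 2 / (1 - P.d) * p ^ 2 + (1 - P.d) * q ^ 2) := by
    have h6 : 2 * (|P.a₁ * p| * |q|) ≤ P.a₁ ^ 2 / (1 - P.d) * p ^ 2 + (1 - P.d) * q ^ 2 := by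
      have := sq_nonneg (|P.a₁ * p| - (1 - P.d) * |q|)
      rw [sub_sq, mul_pow, sq_abs, sq_abs] at this
      rw [← sub_nonneg]
      have e : P.a₁ ^ 2 / (1 - P.d) * p ^ 2 + (1 - P.d) * q ^ 2 - 2 * (|P.a₁ * p| * |q|)
        = ((P.a₁ * p) ^ 2 - 2 * |P.a₁ * p| * ((1 - P.d) * |q|) + (1 - P.d) ^ 2 * q ^ 2)
          / (1 - P.d) := by
        field_simp
        ring
      rw [e]
      positivity
    calc -(2 * P.a₁ * (P.β * (p * q))) ≤ |2 * P.a₁ * (P.β * (p * q))| := neg_le_abs _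
      _ = |P.β| * (2 * (|P.a₁ * p| * |q|)) := by
        rw [show 2 * P.a₁ * (P.β * (p * q)) = P.β * (2 * ((P.a₁ * p) * q)) by ring,
          abs_mul, abs_mul, abs_mul, abs_two]
      _ ≤ _ := by gcongr
  unfold gap
  have e : |P.β| * (P.a₁ ^ 2 / (1 - P.d) * p ^ 2 + (1 - P.d) * q ^ 2)
    = |P.β| * P.a₁ ^ 2 / (1 - P.d) * p ^ 2 + |P.β| * (1 - P.d) * q ^ 2 := by ring
  rw [e] at h5
  nlinarith

/-! ### Classical solutions -/

theorem A_add (P : Params) (t : ℝ) (η ω η' ω' : Fin 6 → L2 P.L) (z z' : Fin 2 → L2 1) :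
    P.A t (η + η') (ω + ω') (z + z') = P.A t η ω z + P.A t η' ω' z' := by
  simp only [A, toLp_transport, Pi.add_apply, map_add, smul_add, Prod.mk_add_mk]
  congr 2 <;> abel_nf

theorem A_smul (P : Params) (t c : ℝ) (η ω : Fin 6 → L2 P.L) (z : Fin 2 → L2 1) :
    P.A t (c • η) (c • ω) (c • z) = c • P.A t η ω z := by
  simp only [A, toLp_transport, Pi.smul_apply, map_smul, Prod.smul_mk, smul_sub, smul_neg,
    smul_comm c]

theorem IsClassicalSolution.add {V V' : C(Icc (0 : ℝ) T, State P.L)} {p q p' q' : ℝ → ℝ}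
    (h : P.IsClassicalSolution T V p q) (h' : P.IsClassicalSolution T V' p' q') :
    P.IsClassicalSolution T (V + V') (p + p') (q + q') := by
  obtain ⟨η, ω, z, a1, a2, a3, a4, a5, a6⟩ := h
  obtain ⟨η', ω', z', b1, b2, b3, b4, b5, b6⟩ := h'
  refine ⟨η + η', ω + ω', z + z', a1.add b1, a2.add b2, a3.add b3,
    fun t ht => (a4 t ht).add (b4 t ht), fun t ht => ?_, fun t => ?_⟩
  · simp only [Pi.add_apply]
    rw [A_add]
    exact (a5 t ht).add (b5 t ht)
  · simp [a6, b6]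

theorem IsClassicalSolution.smul {V : C(Icc (0 : ℝ) T, State P.L)} {p q : ℝ → ℝ} (c : ℝ)
    (h : P.IsClassicalSolution T V p q) :
    P.IsClassicalSolution T (c • V) (c • p) (c • q) := by
  obtain ⟨η, ω, z, a1, a2, a3, a4, a5, a6⟩ := h
  refine ⟨c • η, c • ω, c • z, a1.const_smul c, a2.const_smul c, a3.const_smul c,
    fun t ht => (a4 t ht).smul c, fun t ht => ?_, fun t => ?_⟩
  · simp only [Pi.smul_apply]
    rw [A_smul]
    exact (a5 t ht).const_smul c
  · simp [a6]

theorem IsClassicalSolution.zero : P.IsClassicalSolution T 0 0 0 := by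
  refine ⟨0, 0, 0, continuousOn_const, continuousOn_const, continuousOn_const,
    fun t _ => .zero P, fun t _ => ?_, fun t => rfl⟩
  have : P.A t 0 0 0 = 0 := by simpa using P.A_smul t 0 0 0 0
  simp only [Pi.zero_apply]
  rw [this]
  exact hasDerivWithinAt_const _ _ _

theorem IsClassicalSolution.continuousOn_traces (hP : P.Admissible)
    {V : C(Icc (0 : ℝ) T, State P.L)} {p q : ℝ → ℝ} (h : P.IsClassicalSolution T V p q) :
    ContinuousOn p (Icc 0 T) ∧ ContinuousOn q (Icc 0 T) := by
  obtain ⟨η, ω, z, a1, a2, a3, a4, a5, a6⟩ := h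
  have c1 : ∀ i, ContinuousOn (fun t => η t i) (Icc 0 T) := fun i =>
    (continuous_apply i).comp_continuousOn a1
  have c3 : ∀ i, ContinuousOn (fun t => z t i) (Icc 0 T) := fun i =>
    (continuous_apply i).comp_continuousOn a3
  refine ⟨fun t ht => ?_, fun t ht => ?_⟩
  · exact tendsto_trace hP.L_pos (Or.inr rfl) (by
      filter_upwards [self_mem_nhdsWithin] with s hs
      exact ⟨(a4 s hs).η_deriv 2, (a4 s hs).ηxx_L⟩) ((a4 t ht).η_deriv 2) (a4 t ht).ηxx_L
      (c1 _ t ht) (c1 _ t ht)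
  · exact tendsto_trace one_pos (Or.inr rfl) (by
      filter_upwards [self_mem_nhdsWithin] with s hs
      exact ⟨(a4 s hs).z_deriv, (a4 s hs).z_one⟩) (a4 t ht).z_deriv (a4 t ht).z_one
      (c3 _ t ht) (c3 _ t ht)

theorem hasDerivWithinAt_fst {E F : Type*} [NormedAddCommGroup E] [NormedSpace ℝ E]
    [NormedAddCommGroup F] [NormedSpace ℝ F] {f : ℝ → E × F} {f' : E × F} {s : Set ℝ} {t : ℝ}
    (h : HasDerivWithinAt f f' s t) : HasDerivWithinAt (fun x => (f x).1) f'.1 s t :=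
  (ContinuousLinearMap.fst ℝ E F).hasFDerivAt.comp_hasDerivWithinAt t h

theorem hasDerivWithinAt_snd {E F : Type*} [NormedAddCommGroup E] [NormedSpace ℝ E]
    [NormedAddCommGroup F] [NormedSpace ℝ F] {f : ℝ → E × F} {f' : E × F} {s : Set ℝ} {t : ℝ}
    (h : HasDerivWithinAt f f' s t) : HasDerivWithinAt (fun x => (f x).2) f'.2 s t :=
  (ContinuousLinearMap.snd ℝ E F).hasFDerivAt.comp_hasDerivWithinAt t h

theorem IsClassicalSolution.hasDeriv_normSq (hP : P.Admissible) (hT : 0 ≤ T)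
    {V : C(Icc (0 : ℝ) T, State P.L)} {p q : ℝ → ℝ} (h : P.IsClassicalSolution T V p q)
    {t : ℝ} (ht : t ∈ Icc 0 T) :
    HasDerivWithinAt (fun s => (V (projIcc 0 T hT s)).1.normSq)
      (-(2 * P.a₁ * (p t * (P.α * p t + P.β * q t)))) (Icc 0 T) t := by
  obtain ⟨η, ω, z, a1, a2, a3, a4, a5, a6⟩ := h
  have h1 := (hasDerivWithinAt_fst (hasDerivWithinAt_fst (a5 t ht))).norm_sq
  have h2 := (hasDerivWithinAt_snd (hasDerivWithinAt_fst (a5 t ht))).norm_sq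
  have h3 := (a4 t ht).energy hP.L_pos t
  have h4 := (h1.add h2).congr_of_mem (f₁ := fun s => (V (projIcc 0 T hT s)).1.normSq)
    (fun s hs => by simp [projIcc_of_mem hT hs, a6, X0.normSq]) ht
  refine h4.congr_deriv ?_
  linear_combination 2 * h3

theorem IsClassicalSolution.hasDeriv_transport (hP : P.Admissible) (hT : 0 ≤ T)
    {V : C(Icc (0 : ℝ) T, State P.L)} {p q : ℝ → ℝ} (h : P.IsClassicalSolution T V p q)
    {t : ℝ} (ht : t ∈ Icc 0 T) :
    HasDerivWithinAt (fun s => P.τ s * ‖(V (projIcc 0 T hT s)).2‖ ^ 2)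
      ((P.τ' t - 1) * q t ^ 2 + p t ^ 2) (Icc 0 T) t := by
  obtain ⟨η, ω, z, a1, a2, a3, a4, a5, a6⟩ := h
  have h1 := (hasDerivWithinAt_snd (a5 t ht)).norm_sq
  have h3 := (a4 t ht).transport (hP.τ_pos ht.1).ne'
  have h4 := (((hP.hasDerivWithinAt_τ ht.1).mono Icc_subset_Ici_self).mul h1).congr_of_mem
    (f₁ := fun s => P.τ s * ‖(V (projIcc 0 T hT s)).2‖ ^ 2)
    (fun s hs => by simp [projIcc_of_mem hT hs, a6]) ht
  refine h4.congr_deriv ?_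
  linear_combination h3

theorem IsClassicalSolution.continuous_dissipation (hP : P.Admissible)
    {V : C(Icc (0 : ℝ) T, State P.L)} {p q : ℝ → ℝ} (h : P.IsClassicalSolution T V p q) :
    ContinuousOn (fun t => -(2 * P.a₁ * (p t * (P.α * p t + P.β * q t)))) (Icc 0 T) ∧
    ContinuousOn (fun t => (P.τ' t - 1) * q t ^ 2 + p t ^ 2) (Icc 0 T) := by
  obtain ⟨h1, h2⟩ := h.continuousOn_traces hP
  have h3 := hP.continuousOn_τ'.mono (Icc_subset_Ici_self : Icc 0 T ⊆ Ici 0)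
  exact ⟨by fun_prop, by fun_prop⟩

/-- Two values of `κ` matter. With `κ = |β|` the term `gap · ∫ p²` remains and bounds the trace.
With `κ = |β| + gap` that term disappears, but the weight of `z` is positive even when `β = 0`. -/
theorem IsClassicalSolution.energy_ineq (hP : P.Admissible) (hT : 0 ≤ T)
    {V : C(Icc (0 : ℝ) T, State P.L)} {p q : ℝ → ℝ} (h : P.IsClassicalSolution T V p q)
    {κ : ℝ} (hκ : |P.β| ≤ κ) (t : Icc (0 : ℝ) T) :
    (V t).1.normSq + κ * (P.τ t * ‖(V t).2‖ ^ 2) + (P.gap + |P.β| - κ) * ∫ s in (0 : ℝ)..t, p s ^ 2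
      ≤ (V ⟨0, le_rfl, hT⟩).1.normSq + κ * (P.τ 0 * ‖(V ⟨0, le_rfl, hT⟩).2‖ ^ 2) := by
  obtain ⟨c1, c2⟩ := h.continuous_dissipation hP
  obtain ⟨cp, cq⟩ := h.continuousOn_traces hP
  have hsub : uIcc 0 (t : ℝ) ⊆ Icc 0 T := by
    rw [uIcc_of_le t.2.1]; exact Icc_subset_Icc_right t.2.2
  have h1 := integral_eq_sub_of_hasDerivWithinAt
    (fun s hs => (h.hasDeriv_normSq hP hT hs).add ((h.hasDeriv_transport hP hT hs).const_mul κ))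
    (c1.add (continuousOn_const.mul c2)) t.2
  simp only [Pi.add_apply] at h1
  have h2 : ∫ s in (0 : ℝ)..t, (-(2 * P.a₁ * (p s * (P.α * p s + P.β * q s)))
      + κ * ((P.τ' s - 1) * q s ^ 2 + p s ^ 2))
      ≤ ∫ s in (0 : ℝ)..t, -((P.gap + |P.β| - κ) * p s ^ 2) := by
    refine intervalIntegral.integral_mono_on t.2.1 ?_ ?_ fun s hs =>
      hP.dissipation hκ (hP.τ'_le s hs.1) _ _
    · exact ((c1.add (continuousOn_const.mul c2)).mono hsub).intervalIntegrable
    · exact ContinuousOn.intervalIntegrable (by have := cp.mono hsub; fun_prop)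
  rw [intervalIntegral.integral_neg, intervalIntegral.integral_const_mul, h1,
    projIcc_of_mem hT t.2, projIcc_of_mem hT ⟨le_rfl, hT⟩] at h2
  linarith

/-- Integrate the transport identity, use `1 - τ' ≥ 1 - d` and drop the final value `τ(T)‖z(T)‖²`.
-/
theorem IsClassicalSolution.trace_ineq (hP : P.Admissible) (hT : 0 ≤ T)
    {V : C(Icc (0 : ℝ) T, State P.L)} {p q : ℝ → ℝ} (h : P.IsClassicalSolution T V p q) :
    (1 - P.d) * ∫ s in (0 : ℝ)..T, q s ^ 2
      ≤ P.τ 0 * ‖(V ⟨0, le_rfl, hT⟩).2‖ ^ 2 + ∫ s in (0 : ℝ)..T, p s ^ 2 := by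
  obtain ⟨c1, c2⟩ := h.continuous_dissipation hP
  obtain ⟨cp, cq⟩ := h.continuousOn_traces hP
  rw [← uIcc_of_le hT] at c2 cp cq
  have h1 := integral_eq_sub_of_hasDerivWithinAt (fun s hs => h.hasDeriv_transport hP hT hs)
    ((uIcc_of_le hT) ▸ c2) (right_mem_Icc.mpr hT)
  have h2 : ∫ s in (0 : ℝ)..T, ((1 - P.d) * q s ^ 2 - p s ^ 2)
      ≤ ∫ s in (0 : ℝ)..T, -((P.τ' s - 1) * q s ^ 2 + p s ^ 2) := by
    refine intervalIntegral.integral_mono_on hT ?_ ?_ fun s hs => ?_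
    · exact ContinuousOn.intervalIntegrable (by fun_prop)
    · exact ContinuousOn.intervalIntegrable c2.neg
    · nlinarith [hP.τ'_le s hs.1, sq_nonneg (q s)]
  rw [intervalIntegral.integral_neg, h1, intervalIntegral.integral_sub
    (ContinuousOn.intervalIntegrable (by fun_prop)) (ContinuousOn.intervalIntegrable (by fun_prop)),
    intervalIntegral.integral_const_mul, projIcc_of_mem hT ⟨le_rfl, hT⟩] at h2
  have := hP.τ_pos hT
  have : 0 ≤ P.τ T * ‖(V (projIcc 0 T hT T)).2‖ ^ 2 := by positivity
  linarith

/-- The function `(T - t) ‖(η,ω)(t)‖²` vanishes at `T`, and its derivative is `-‖(η,ω)‖²` plus `T -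
t` times the boundary term. Integration isolates `T ‖(η₀,ω₀)‖²`; the boundary term is split by
Young's inequality and `T - t ≤ T`. -/
theorem IsClassicalSolution.observability (hP : P.Admissible) (hT : 0 < T)
    {V : C(Icc (0 : ℝ) T, State P.L)} {p q : ℝ → ℝ} (h : P.IsClassicalSolution T V p q) :
    (V ⟨0, le_rfl, hT.le⟩).1.normSq
      ≤ 1 / T * (∫ t in (0 : ℝ)..T, (V (projIcc 0 T hT.le t)).1.normSq)
        + P.a₁ * (2 * P.α + |P.β|) * (∫ s in (0 : ℝ)..T, p s ^ 2)
        + P.a₁ * |P.β| * ∫ s in (0 : ℝ)..T, q s ^ 2 := by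
  obtain ⟨c1, c2⟩ := h.continuous_dissipation hP
  obtain ⟨cp, cq⟩ := h.continuousOn_traces hP
  have cE : ContinuousOn (fun s => (V (projIcc 0 T hT.le s)).1.normSq) (Icc 0 T) := fun s hs =>
    (h.hasDeriv_normSq hP hT.le hs).continuousWithinAt
  have h1 := integral_eq_sub_of_hasDerivWithinAt (fun s hs =>
    (((hasDerivWithinAt_id s (Icc 0 T)).const_sub T).mul (h.hasDeriv_normSq hP hT.le hs)))
    (by fun_prop) (right_mem_Icc.mpr hT.le)
  rw [← uIcc_of_le hT.le] at c1 c2 cp cq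
  replace cE := cE.mono (uIcc_of_le hT.le).le
  simp only [Pi.mul_apply, sub_self, zero_mul, sub_zero, zero_sub, id] at h1
  rw [projIcc_of_mem hT.le ⟨le_rfl, hT.le⟩] at h1
  have h2 : ∫ s in (0 : ℝ)..T, -(T * (P.a₁ * (2 * P.α + |P.β|) * p s ^ 2
        + P.a₁ * |P.β| * q s ^ 2) + (V (projIcc 0 T hT.le s)).1.normSq)
      ≤ ∫ s in (0 : ℝ)..T, (-1 * (V (projIcc 0 T hT.le s)).1.normSq
        + (T - s) * -(2 * P.a₁ * (p s * (P.α * p s + P.β * q s)))) := by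
    refine intervalIntegral.integral_mono_on hT.le ?_ ?_ fun s hs => ?_
    · exact ContinuousOn.intervalIntegrable (by fun_prop)
    · exact ContinuousOn.intervalIntegrable (by fun_prop)
    · have hα : 0 ≤ P.α := by
        have := hP.gap_pos
        have h5 := hP.gain
        refine le_trans ?_ h5.le
        have := hP.a₁_pos
        have : 0 ≤ 1 - P.d := by linarith [hP.d_lt_one]
        have : 0 ≤ P.a₁ ^ 2 + 1 - P.d := by nlinarith
        positivity
      have h6 : 2 * (p s * (P.α * p s + P.β * q s))
          ≤ (2 * P.α + |P.β|) * p s ^ 2 + |P.β| * q s ^ 2 := by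
        have h7 : 2 * (P.β * (p s * q s)) ≤ |P.β| * (p s ^ 2 + q s ^ 2) := by
          calc 2 * (P.β * (p s * q s)) ≤ |2 * (P.β * (p s * q s))| := le_abs_self _
            _ = |P.β| * (2 * |p s| * |q s|) := by rw [abs_mul, abs_mul, abs_mul, abs_two]; ring
            _ ≤ |P.β| * (|p s| ^ 2 + |q s| ^ 2) := by gcongr; exact two_mul_le_add_sq _ _
            _ = _ := by rw [sq_abs, sq_abs]
        nlinarith
      have h8 : (T - s) * (2 * (p s * (P.α * p s + P.β * q s)))
          ≤ T * ((2 * P.α + |P.β|) * p s ^ 2 + |P.β| * q s ^ 2) := by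
        have h9 : 0 ≤ (2 * P.α + |P.β|) * p s ^ 2 + |P.β| * q s ^ 2 := by positivity
        have h10 : 0 ≤ T - s := by linarith [hs.2]
        calc _ ≤ (T - s) * ((2 * P.α + |P.β|) * p s ^ 2 + |P.β| * q s ^ 2) := by gcongr
          _ ≤ _ := by gcongr; linarith [hs.1]
      have := mul_le_mul_of_nonneg_left h8 hP.a₁_pos.le
      linarith
  rw [h1] at h2
  have i1 : IntervalIntegrable (fun s => (V (projIcc 0 T hT.le s)).1.normSq) volume 0 T :=
    cE.intervalIntegrable
  have i2 : IntervalIntegrable (fun s => p s ^ 2) volume 0 T := (cp.pow 2).intervalIntegrable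
  have i3 : IntervalIntegrable (fun s => q s ^ 2) volume 0 T := (cq.pow 2).intervalIntegrable
  rw [intervalIntegral.integral_neg, intervalIntegral.integral_add
    (((i2.const_mul _).add (i3.const_mul _)).const_mul _) i1, intervalIntegral.integral_const_mul,
    intervalIntegral.integral_add (i2.const_mul _) (i3.const_mul _),
    intervalIntegral.integral_const_mul, intervalIntegral.integral_const_mul] at h2
  rw [← mul_le_mul_iff_right₀ hT]
  have e : T * (1 / T * (∫ t in (0 : ℝ)..T, (V (projIcc 0 T hT.le t)).1.normSq)
        + P.a₁ * (2 * P.α + |P.β|) * (∫ s in (0 : ℝ)..T, p s ^ 2)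
        + P.a₁ * |P.β| * ∫ s in (0 : ℝ)..T, q s ^ 2)
      = (∫ t in (0 : ℝ)..T, (V (projIcc 0 T hT.le t)).1.normSq)
        + T * (P.a₁ * (2 * P.α + |P.β|) * (∫ s in (0 : ℝ)..T, p s ^ 2)
        + P.a₁ * |P.β| * ∫ s in (0 : ℝ)..T, q s ^ 2) := by
    field_simp
    ring
  rw [e]
  linarith

/-- The transport identity read backwards in time: the inflow `p²` has the favourable sign and is
dropped, while `1 - τ' ≤ 1 + K` bounds the loss through `q`. -/
theorem IsClassicalSolution.transport_observability (hP : P.Admissible) (hT : 0 ≤ T) {K : ℝ}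
    (hK : ∀ t ∈ Icc 0 T, -K ≤ P.τ' t)
    {V : C(Icc (0 : ℝ) T, State P.L)} {p q : ℝ → ℝ} (h : P.IsClassicalSolution T V p q) :
    P.τ 0 * ‖(V ⟨0, le_rfl, hT⟩).2‖ ^ 2
      ≤ P.M * ‖(V ⟨T, hT, le_rfl⟩).2‖ ^ 2 + (1 + K) * ∫ s in (0 : ℝ)..T, q s ^ 2 := by
  obtain ⟨c1, c2⟩ := h.continuous_dissipation hP
  obtain ⟨cp, cq⟩ := h.continuousOn_traces hP
  rw [← uIcc_of_le hT] at c2 cp cq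
  have h1 := integral_eq_sub_of_hasDerivWithinAt (fun s hs => h.hasDeriv_transport hP hT hs)
    ((uIcc_of_le hT) ▸ c2) (right_mem_Icc.mpr hT)
  have h2 : ∫ s in (0 : ℝ)..T, -((1 + K) * q s ^ 2)
      ≤ ∫ s in (0 : ℝ)..T, ((P.τ' s - 1) * q s ^ 2 + p s ^ 2) := by
    refine intervalIntegral.integral_mono_on hT ?_ ?_ fun s hs => ?_
    · exact ContinuousOn.intervalIntegrable (by fun_prop)
    · exact ContinuousOn.intervalIntegrable c2
    · nlinarith [hK s hs, sq_nonneg (q s), sq_nonneg (p s)]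
  rw [intervalIntegral.integral_neg, h1, intervalIntegral.integral_const_mul,
    projIcc_of_mem hT ⟨le_rfl, hT⟩, projIcc_of_mem hT ⟨hT, le_rfl⟩] at h2
  have : P.τ T * ‖(V ⟨T, hT, le_rfl⟩).2‖ ^ 2 ≤ P.M * ‖(V ⟨T, hT, le_rfl⟩).2‖ ^ 2 := by
    gcongr
    exact hP.τ_le T hT
  linarith

end Params

/-! ### Kato smoothing for classical solutions. -/

theorem isClosed_H20 {ℓ : ℝ} (hℓ : 0 < ℓ) : IsClosed (H20 ℓ : Set (L2 ℓ × L2 ℓ × L2 ℓ)) := by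
  refine isClosed_of_closure_subset fun k hk => ?_
  obtain ⟨u, hu, hlim⟩ := mem_closure_iff_seq_limit.mp hk
  have h0 : Tendsto (fun n => (u n).1) atTop (𝓝 k.1) := (continuous_fst.tendsto k).comp hlim
  have h1 : Tendsto (fun n => (u n).2.1) atTop (𝓝 k.2.1) :=
    ((continuous_fst.comp continuous_snd).tendsto k).comp hlim
  have h2 : Tendsto (fun n => (u n).2.2) atTop (𝓝 k.2.2) :=
    ((continuous_snd.comp continuous_snd).tendsto k).comp hlim
  have d0 := fun n => (hu n).1
  have d1 := fun n => (hu n).2.1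
  exact ⟨.of_tendsto d0 h0 h1, .of_tendsto d1 h1 h2,
    .of_tendsto hℓ (Or.inl rfl) d0 (fun n => (hu n).2.2.1) h0 h1 tendsto_const_nhds,
    .of_tendsto hℓ (Or.inr rfl) d0 (fun n => (hu n).2.2.2.1) h0 h1 tendsto_const_nhds,
    .of_tendsto hℓ (Or.inl rfl) d1 (fun n => (hu n).2.2.2.2.1) h1 h2 tendsto_const_nhds,
    .of_tendsto hℓ (Or.inr rfl) d1 (fun n => (hu n).2.2.2.2.2) h1 h2 tendsto_const_nhds⟩

/-- Wirtinger's inequality for the function and for its derivative: on `H²₀` the second derivative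
alone controls the norm. -/
theorem norm_H20_sq_le {ℓ k : ℝ} (hℓ : 0 < ℓ) (hk : 0 < k) (hkl : k * ℓ < Real.pi) (w : H20 ℓ) :
    ‖w‖ ^ 2 ≤ (1 + 1 / k ^ 2) ^ 2 * ‖(w : L2 ℓ × L2 ℓ × L2 ℓ).2.2‖ ^ 2 := by
  obtain ⟨⟨f, f', f''⟩, h1, h2, h3, h4, h5, h6⟩ := w
  simp only at h1 h2 h3 h4 h5 h6
  have e1 := wirtinger hℓ hk hkl h1 h3 h4
  have e2 := wirtinger hℓ hk hkl h2 h5 h6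
  have e3 : ‖f'‖ ^ 2 ≤ 1 / k ^ 2 * ‖f''‖ ^ 2 := by
    rw [one_div, ← div_eq_inv_mul, le_div_iff₀ (by positivity)]; linarith
  have e4 : ‖f‖ ^ 2 ≤ 1 / k ^ 2 * ‖f'‖ ^ 2 := by
    rw [one_div, ← div_eq_inv_mul, le_div_iff₀ (by positivity)]; linarith
  set b := 1 / k ^ 2
  have hb : 0 < b := by positivity
  have e5 : ‖f‖ ^ 2 ≤ b * (b * ‖f''‖ ^ 2) := e4.trans (by gcongr)
  have hn : 0 ≤ ‖f''‖ ^ 2 := by positivity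
  have e6 : 0 ≤ b * ‖f''‖ ^ 2 := by positivity
  have e7 : 0 ≤ b * (b * ‖f''‖ ^ 2) := by positivity
  change ‖(f, f', f'')‖ ^ 2 ≤ _
  rw [Prod.norm_mk, Prod.norm_mk]
  rcases max_choice ‖f‖ (max ‖f'‖ ‖f''‖) with h | h
  · rw [h]; nlinarith
  · rw [h]
    rcases max_choice ‖f'‖ ‖f''‖ with h | h
    · rw [h]; nlinarith
    · rw [h]; nlinarith

theorem integral_lincomb {f g h : ℝ → ℝ} {b : ℝ} (hf : IntervalIntegrable f volume 0 b)
    (hg : IntervalIntegrable g volume 0 b) (hh : IntervalIntegrable h volume 0 b)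
    (c e c₁ c₂ : ℝ) : ∫ t in (0 : ℝ)..b, (c * f t - e * (c₁ * g t + c₂ * h t))
      = c * (∫ t in (0 : ℝ)..b, f t)
        - e * (c₁ * (∫ t in (0 : ℝ)..b, g t) + c₂ * ∫ t in (0 : ℝ)..b, h t) := by
  rw [intervalIntegral.integral_sub (hf.const_mul _)
    (((hg.const_mul _).add (hh.const_mul _)).const_mul _), intervalIntegral.integral_const_mul,
    intervalIntegral.integral_const_mul, intervalIntegral.integral_add (hg.const_mul _)
    (hh.const_mul _), intervalIntegral.integral_const_mul, intervalIntegral.integral_const_mul]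

namespace Params

variable {P : Params} {T : ℝ}

theorem abs_inner_mulX_le {ℓ : ℝ} (hℓ : 0 < ℓ) (u : X0 ℓ) :
    |inner ℝ (mulX ℓ u.1) u.2| ≤ ℓ / 2 * u.normSq := by
  have h1 := abs_real_inner_le_norm (mulX ℓ u.1) u.2
  have h2 := norm_mulX_le u.1
  rw [abs_of_pos hℓ] at h2
  have h3 : ‖mulX ℓ u.1‖ * ‖u.2‖ ≤ ℓ * ‖u.1‖ * ‖u.2‖ := by gcongr
  unfold X0.normSq
  nlinarith [mul_nonneg hℓ.le (sq_nonneg (‖u.1‖ - ‖u.2‖))]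

/-- The smoothing estimate for classical solutions. -/
theorem IsClassicalSolution.exists_smoothing (hP : P.Admissible) (hT : 0 ≤ T)
    {V : C(Icc (0 : ℝ) T, State P.L)} {p q : ℝ → ℝ} (h : P.IsClassicalSolution T V p q) {k : ℝ}
    (hk : 0 < k) (hkl : k * P.L < Real.pi) :
    ∃ W : ℝ → H20 P.L × H20 P.L, ContinuousOn W (Icc 0 T) ∧
      (∀ t : Icc (0 : ℝ) T, (((W t).1 : L2 P.L × L2 P.L × L2 P.L).1,
        ((W t).2 : L2 P.L × L2 P.L × L2 P.L).1) = (V t).1) ∧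
      (5 * P.a₁ / 2 - 3 * P.a / (2 * k ^ 2)) * (∫ t in (0 : ℝ)..T,
          (‖((W t).1 : L2 P.L × L2 P.L × L2 P.L).2.2‖ ^ 2
            + ‖((W t).2 : L2 P.L × L2 P.L × L2 P.L).2.2‖ ^ 2))
        ≤ P.L / 2 * ((V ⟨T, hT, le_rfl⟩).1.normSq + (V ⟨0, le_rfl, hT⟩).1.normSq)
          + P.a₁ * P.L / 2 * ((1 + 2 * P.α ^ 2) * (∫ t in (0 : ℝ)..T, p t ^ 2)
            + 2 * P.β ^ 2 * ∫ t in (0 : ℝ)..T, q t ^ 2) := by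
  obtain ⟨cp, cq⟩ := h.continuousOn_traces hP
  obtain ⟨η, ω, z, a1, a2, a3, a4, a5, a6⟩ := h
  have cη : ∀ i, ContinuousOn (fun t => η t i) (Icc 0 T) := fun i =>
    (continuous_apply i).comp_continuousOn a1
  have cω : ∀ i, ContinuousOn (fun t => ω t i) (Icc 0 T) := fun i =>
    (continuous_apply i).comp_continuousOn a2
  have mη : ∀ t ∈ Icc 0 T, (η t 0, η t 1, η t 2) ∈ H20 P.L := fun t ht =>
    ⟨(a4 t ht).η_deriv 0, (a4 t ht).η_deriv 1, (a4 t ht).η_zero, (a4 t ht).η_L,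
      (a4 t ht).ηx_zero, (a4 t ht).ηx_L⟩
  have mω : ∀ t ∈ Icc 0 T, (ω t 0, ω t 1, ω t 2) ∈ H20 P.L := fun t ht =>
    ⟨(a4 t ht).ω_deriv 0, (a4 t ht).ω_deriv 1, (a4 t ht).ω_zero, (a4 t ht).ω_L,
      (a4 t ht).ωx_zero, (a4 t ht).ωx_L⟩
  classical
  let W : ℝ → H20 P.L × H20 P.L := fun t =>
    if ht : t ∈ Icc 0 T then (⟨_, mη t ht⟩, ⟨_, mω t ht⟩) else 0
  have hW : ∀ t (ht : t ∈ Icc 0 T), W t = (⟨_, mη t ht⟩, ⟨_, mω t ht⟩) := fun t ht => dif_pos ht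
  refine ⟨W, ?_, fun t => by rw [hW t t.2, a6], ?_⟩
  · rw [continuousOn_iff_continuous_domRestrict]
    have : (Icc 0 T).domRestrict W = fun t => (⟨_, mη t t.2⟩, ⟨_, mω t t.2⟩) :=
      funext fun t => hW t t.2
    rw [this]
    have r1 := fun i => continuousOn_iff_continuous_domRestrict.mp (cη i)
    have r2 := fun i => continuousOn_iff_continuous_domRestrict.mp (cω i)
    exact (((r1 0).prodMk ((r1 1).prodMk (r1 2))).subtype_mk _).prodMk
      (((r2 0).prodMk ((r2 1).prodMk (r2 2))).subtype_mk _)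
  -- The mixed quantity `∫ x η ω` is the right one: `ηₜ` is the operator applied to `ω` and
  -- conversely, so its derivative separates into one quadratic expression in `η` and the same one
  -- in `ω`.
  have hd : ∀ t ∈ Icc 0 T, HasDerivWithinAt (fun s => inner ℝ (mulX P.L (η s 0)) (ω s 0))
      (1 / 2 * ‖η t 0‖ ^ 2 - 3 * P.a / 2 * ‖η t 1‖ ^ 2 + 5 * P.a₁ / 2 * ‖η t 2‖ ^ 2
        - P.a₁ * P.L / 2 * p t ^ 2 + (1 / 2 * ‖ω t 0‖ ^ 2 - 3 * P.a / 2 * ‖ω t 1‖ ^ 2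
        + 5 * P.a₁ / 2 * ‖ω t 2‖ ^ 2 - P.a₁ * P.L / 2 * (P.α * p t + P.β * q t) ^ 2))
      (Icc 0 T) t := by
    intro t ht
    have d1 := hasDerivWithinAt_fst (hasDerivWithinAt_fst (a5 t ht))
    have d2 := hasDerivWithinAt_snd (hasDerivWithinAt_fst (a5 t ht))
    have d3 := (mulX P.L).hasFDerivAt.comp_hasDerivWithinAt t d1
    have d4 := d3.inner ℝ d2
    refine d4.congr_deriv ?_
    have e := a4 t ht
    have k1 := kato_component (a := P.a) (a₁ := P.a₁) hP.L_pos e.η_deriv e.η_zero e.η_L e.ηx_zero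
      e.ηx_L e.ηxx_L
    have k2 := kato_component (a := P.a) (a₁ := P.a₁) hP.L_pos e.ω_deriv e.ω_zero e.ω_L e.ωx_zero
      e.ωx_L e.ωxx_L
    rw [← k1, ← k2]
    simp only [Function.comp_apply, A]
    rw [inner_mulX_comm (-ω t 1 - P.a • ω t 3 - P.a₁ • ω t 5), real_inner_comm (mulX P.L (ω t 0))]
  have c0 : ∀ i, ContinuousOn (fun t => ‖η t i‖) (Icc 0 T) := fun i => (cη i).norm
  have c1 : ∀ i, ContinuousOn (fun t => ‖ω t i‖) (Icc 0 T) := fun i => (cω i).norm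
  have c00 := c0 0
  have c01 := c0 1
  have c02 := c0 2
  have c10 := c1 0
  have c11 := c1 1
  have c12 := c1 2
  have h1 := integral_eq_sub_of_hasDerivWithinAt hd (by fun_prop) (right_mem_Icc.mpr hT)
  have hWN : ∫ t in (0 : ℝ)..T, (‖((W t).1 : L2 P.L × L2 P.L × L2 P.L).2.2‖ ^ 2
      + ‖((W t).2 : L2 P.L × L2 P.L × L2 P.L).2.2‖ ^ 2)
      = ∫ t in (0 : ℝ)..T, (‖η t 2‖ ^ 2 + ‖ω t 2‖ ^ 2) := by
    refine intervalIntegral.integral_congr fun t ht => ?_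
    rw [uIcc_of_le hT] at ht
    simp only [hW t ht]
  rw [hWN]
  have cD : ContinuousOn (fun t => 1 / 2 * ‖η t 0‖ ^ 2 - 3 * P.a / 2 * ‖η t 1‖ ^ 2
        + 5 * P.a₁ / 2 * ‖η t 2‖ ^ 2
        - P.a₁ * P.L / 2 * p t ^ 2 + (1 / 2 * ‖ω t 0‖ ^ 2 - 3 * P.a / 2 * ‖ω t 1‖ ^ 2
        + 5 * P.a₁ / 2 * ‖ω t 2‖ ^ 2 - P.a₁ * P.L / 2 * (P.α * p t + P.β * q t) ^ 2))
        (Icc 0 T) := by fun_prop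
  rw [← uIcc_of_le hT] at cD cp cq c02 c12
  have i1 : IntervalIntegrable (fun s => ‖η s 2‖ ^ 2 + ‖ω s 2‖ ^ 2) volume 0 T :=
    ((c02.pow 2).add (c12.pow 2)).intervalIntegrable
  have i2 : IntervalIntegrable (fun s => p s ^ 2) volume 0 T := (cp.pow 2).intervalIntegrable
  have i3 : IntervalIntegrable (fun s => q s ^ 2) volume 0 T := (cq.pow 2).intervalIntegrable
  -- The zeroth-order terms are nonnegative and dropped, the first-order ones are absorbed by
  -- Wirtinger's inequality, and `(α p + β q)² ≤ 2 α² p² + 2 β² q²` handles the feedback.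
  have h2 : ∫ t in (0 : ℝ)..T, ((5 * P.a₁ / 2 - 3 * P.a / (2 * k ^ 2))
        * (‖η t 2‖ ^ 2 + ‖ω t 2‖ ^ 2)
        - P.a₁ * P.L / 2 * ((1 + 2 * P.α ^ 2) * p t ^ 2 + 2 * P.β ^ 2 * q t ^ 2))
      ≤ ∫ t in (0 : ℝ)..T, (1 / 2 * ‖η t 0‖ ^ 2 - 3 * P.a / 2 * ‖η t 1‖ ^ 2
        + 5 * P.a₁ / 2 * ‖η t 2‖ ^ 2
        - P.a₁ * P.L / 2 * p t ^ 2 + (1 / 2 * ‖ω t 0‖ ^ 2 - 3 * P.a / 2 * ‖ω t 1‖ ^ 2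
        + 5 * P.a₁ / 2 * ‖ω t 2‖ ^ 2 - P.a₁ * P.L / 2 * (P.α * p t + P.β * q t) ^ 2)) := by
    refine intervalIntegral.integral_mono_on hT ?_ cD.intervalIntegrable fun t ht => ?_
    · exact (i1.const_mul _).sub (((i2.const_mul _).add (i3.const_mul _)).const_mul _)
    have e := a4 t ht
    have w1 : k ^ 2 * ‖η t 1‖ ^ 2 ≤ ‖η t 2‖ ^ 2 :=
      wirtinger hP.L_pos hk hkl (e.η_deriv 1) e.ηx_zero e.ηx_L
    have w2 : k ^ 2 * ‖ω t 1‖ ^ 2 ≤ ‖ω t 2‖ ^ 2 :=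
      wirtinger hP.L_pos hk hkl (e.ω_deriv 1) e.ωx_zero e.ωx_L
    have ha := hP.a_pos
    have w3 : 3 * P.a / 2 * ‖η t 1‖ ^ 2 ≤ 3 * P.a / (2 * k ^ 2) * ‖η t 2‖ ^ 2 := by
      calc 3 * P.a / 2 * ‖η t 1‖ ^ 2 = 3 * P.a / (2 * k ^ 2) * (k ^ 2 * ‖η t 1‖ ^ 2) := by
            field_simp
        _ ≤ _ := by gcongr
    have w4 : 3 * P.a / 2 * ‖ω t 1‖ ^ 2 ≤ 3 * P.a / (2 * k ^ 2) * ‖ω t 2‖ ^ 2 := by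
      calc 3 * P.a / 2 * ‖ω t 1‖ ^ 2 = 3 * P.a / (2 * k ^ 2) * (k ^ 2 * ‖ω t 1‖ ^ 2) := by
            field_simp
        _ ≤ _ := by gcongr
    have haL : 0 ≤ P.a₁ * P.L / 2 := by have := hP.a₁_pos; have := hP.L_pos; positivity
    have w5 : (P.α * p t + P.β * q t) ^ 2 ≤ 2 * P.α ^ 2 * p t ^ 2 + 2 * P.β ^ 2 * q t ^ 2 := by
      nlinarith [sq_nonneg (P.α * p t - P.β * q t)]
    have w6 := mul_le_mul_of_nonneg_left w5 haL
    nlinarith [sq_nonneg ‖η t 0‖, sq_nonneg ‖ω t 0‖]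
  rw [h1, integral_lincomb i1 i2 i3] at h2
  have b1 := abs_inner_mulX_le hP.L_pos (V ⟨T, hT, le_rfl⟩).1
  have b2 := abs_inner_mulX_le hP.L_pos (V ⟨0, le_rfl, hT⟩).1
  have b3 := le_abs_self (inner ℝ (mulX P.L (V ⟨T, hT, le_rfl⟩).1.1) (V ⟨T, hT, le_rfl⟩).1.2)
  have b4 := neg_le_abs (inner ℝ (mulX P.L (V ⟨0, le_rfl, hT⟩).1.1) (V ⟨0, le_rfl, hT⟩).1.2)
  simp only [a6] at b1 b2 b3 b4 ⊢
  linarith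

end Params

/-! ### Yosida approximation and the Lumer–Phillips theorem. -/

section Semigroup

theorem hasDerivWithinAt_integral {E : Type*} [NormedAddCommGroup E] [NormedSpace ℝ E]
    [CompleteSpace E] {T : ℝ} {v : ℝ → E} (hv : ContinuousOn v (Icc 0 T)) {t : ℝ}
    (ht : t ∈ Icc 0 T) :
    HasDerivWithinAt (fun s => ∫ r in (0 : ℝ)..s, v r) (v t) (Icc 0 T) t := by
  have hT : (0 : ℝ) ≤ T := ht.1.trans ht.2
  have hc : Continuous (IccExtend hT ((Icc 0 T).domRestrict v)) :=
    (continuousOn_iff_continuous_domRestrict.mp hv).Icc_extend'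
  have h1 := (hc.integral_hasStrictDerivAt 0 t).hasDerivAt.hasDerivWithinAt (s := Icc 0 T)
  have he : ∀ s ∈ Icc 0 T, IccExtend hT ((Icc 0 T).domRestrict v) s = v s := fun s hs => by
    rw [IccExtend_of_mem hT _ hs]; rfl
  rw [he t ht] at h1
  refine h1.congr_of_mem (fun s hs => ?_) ht
  refine intervalIntegral.integral_congr fun r hr => ?_
  rw [uIcc_of_le hs.1] at hr
  exact (he r ⟨hr.1, hr.2.trans hs.2⟩).symm

/-- The limit is taken in the integrated form `u(s) = u(0) + ∫ v`, so the one-sided derivatives at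
the end points are included. -/
theorem hasDerivWithinAt_of_tendstoUniformlyOn {E : Type*} [NormedAddCommGroup E] [NormedSpace ℝ E]
    [CompleteSpace E] {T : ℝ} {u v : ℕ → ℝ → E} {u₀ v₀ : ℝ → E}
    (h : ∀ n, ∀ t ∈ Icc 0 T, HasDerivWithinAt (u n) (v n t) (Icc 0 T) t)
    (hv : ∀ n, ContinuousOn (v n) (Icc 0 T))
    (hu : ∀ t ∈ Icc 0 T, Tendsto (fun n => u n t) atTop (𝓝 (u₀ t)))
    (hv₀ : TendstoUniformlyOn v v₀ atTop (Icc 0 T)) {t : ℝ} (ht : t ∈ Icc 0 T) :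
    HasDerivWithinAt u₀ (v₀ t) (Icc 0 T) t := by
  have hc : ContinuousOn v₀ (Icc 0 T) := hv₀.continuousOn (Frequently.of_forall hv)
  have hT : (0 : ℝ) ≤ T := ht.1.trans ht.2
  have key : ∀ s ∈ Icc 0 T, u₀ s = u₀ 0 + ∫ r in (0 : ℝ)..s, v₀ r := by
    intro s hs
    have hsub : uIcc 0 s ⊆ Icc 0 T := by rw [uIcc_of_le hs.1]; exact Icc_subset_Icc_right hs.2
    have h1 : Tendsto (fun n => ∫ r in (0 : ℝ)..s, v n r) atTop (𝓝 (∫ r in (0 : ℝ)..s, v₀ r)) := by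
      rw [Metric.tendsto_atTop]
      intro ε hε
      obtain ⟨N, hN⟩ := eventually_atTop.mp
        (Metric.tendstoUniformlyOn_iff.mp hv₀ (ε / (s + 1)) (by have := hs.1; positivity))
      refine ⟨N, fun n hn => ?_⟩
      rw [dist_eq_norm, ← intervalIntegral.integral_sub ((hv n).mono hsub).intervalIntegrable
        (hc.mono hsub).intervalIntegrable]
      have := intervalIntegral.norm_integral_le_of_norm_le_const (a := 0) (b := s)
        (f := fun r => v n r - v₀ r) (C := ε / (s + 1)) (fun r hr => by
          rw [← dist_eq_norm, dist_comm]
          exact (hN n hn r (hsub (uIoc_subset_uIcc hr))).le)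
      refine this.trans_lt ?_
      rw [sub_zero, abs_of_nonneg hs.1, div_mul_eq_mul_div, div_lt_iff₀ (by linarith [hs.1])]
      nlinarith
    have h2 := tendsto_nhds_unique ((hu s hs).sub (hu 0 ⟨le_rfl, hT⟩))
      (h1.congr fun n => integral_eq_sub_of_hasDerivWithinAt (h n) (hv n) hs)
    rw [← h2]; abel
  have := (hasDerivWithinAt_integral hc ht).const_add (u₀ 0)
  exact this.congr_of_mem key ht

variable {K E : Type*} [NormedAddCommGroup K] [NormedSpace ℝ K] [NormedAddCommGroup E]
  [NormedSpace ℝ E]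

/-- `A`, with domain `K ⊆ E` embedded by `J`, is dissipative with respect to the coercive
symmetric form `B`. -/
structure Dissipative (J A : K →L[ℝ] E) (B : E →L[ℝ] E →L[ℝ] ℝ) (c : ℝ) : Prop where
  inj : Function.Injective J
  symm : ∀ x y, B x y = B y x
  c_pos : 0 < c
  coercive : ∀ x, c * ‖x‖ ^ 2 ≤ B x x
  dissipative : ∀ k, B (A k) (J k) ≤ 0

/-- `A`, with domain `K ⊆ E` embedded by `J`, is `m`-dissipative with respect to the coercive
symmetric form `B`, and densely defined. -/
structure MDissipative (J A : K →L[ℝ] E) (B : E →L[ℝ] E →L[ℝ] ℝ) (c : ℝ) : Prop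
    extends Dissipative J A B c where
  dense : DenseRange J
  surj : ∀ r : ℝ, 0 < r → Function.Surjective (J - r • A)

/-- If `J k = r A k`, then `B (J k) (J k) = r B (A k) (J k) ≤ 0`, and coercivity forces `J k = 0`.
-/
theorem Dissipative.injective_sub {J A : K →L[ℝ] E} {B : E →L[ℝ] E →L[ℝ] ℝ} {c : ℝ}
    (h : Dissipative J A B c) {r : ℝ} (hr : 0 < r) : Function.Injective (J - r • A) := by
  rw [injective_iff_map_eq_zero]
  intro k hk
  have h1 : J k = r • A k := by
    rw [← sub_eq_zero]; simpa using hk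
  have h2 : B (J k) (J k) ≤ 0 := by
    conv_lhs => rw [h1]
    rw [map_smul, ← h1, smul_eq_mul, h.symm]
    exact mul_nonpos_of_nonneg_of_nonpos hr.le (h.dissipative k)
  have h3 := (h.coercive (J k)).trans h2
  have h4 : ‖J k‖ ^ 2 ≤ 0 := by
    by_contra hh
    exact absurd h3 (not_le.mpr (mul_pos h.c_pos (not_le.mp hh)))
  have h5 : ‖J k‖ = 0 := by nlinarith [norm_nonneg (J k)]
  exact h.inj ((norm_eq_zero.mp h5).trans (map_zero J).symm)

namespace MDissipative

variable {J A : K →L[ℝ] E} {B : E →L[ℝ] E →L[ℝ] ℝ} {c : ℝ}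

theorem nonneg (h : MDissipative J A B c) (x : E) : 0 ≤ B x x :=
  le_trans (by have := h.c_pos; positivity) (h.coercive x)

theorem norm_le (h : MDissipative J A B c) {x y : E} (hxy : B x x ≤ B y y) :
    ‖x‖ ≤ √(‖B‖ / c) * ‖y‖ := by
  have h1 : B y y ≤ ‖B‖ * ‖y‖ * ‖y‖ := (le_abs_self _).trans (B.le_opNorm₂ y y)
  have h2 := h.coercive x
  have h3 := h.c_pos
  refine abs_le_of_sq_le_sq' ?_ (by positivity) |>.2
  rw [mul_pow, Real.sq_sqrt (by positivity), div_mul_eq_mul_div, le_div_iff₀ h3]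
  nlinarith

theorem hasDerivAt_form (h : MDissipative J A B c) {u : ℝ → E} {u' : E} {t : ℝ}
    (hu : HasDerivAt u u' t) : HasDerivAt (fun s => B (u s) (u s)) (2 * B u' (u t)) t := by
  have h1 := (B.hasFDerivAt.comp_hasDerivAt t hu).clm_apply hu
  refine h1.congr_deriv ?_
  simp only [Function.comp_apply]
  rw [h.symm (u t) u']
  ring

variable [CompleteSpace K] [CompleteSpace E]

/-- The resolvent `(J - r A)⁻¹`. -/
def res (h : MDissipative J A B c) {r : ℝ} (hr : 0 < r) : E →L[ℝ] K :=
  ((ContinuousLinearEquiv.ofBijective (J - r • A)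
    (LinearMap.ker_eq_bot.mpr (h.injective_sub hr))
    (LinearMap.range_eq_top.mpr (h.surj r hr))).symm : E →L[ℝ] K)

theorem sub_res (h : MDissipative J A B c) {r : ℝ} (hr : 0 < r) (x : E) :
    J (h.res hr x) - r • A (h.res hr x) = x :=
  ContinuousLinearEquiv.ofBijective_apply_symm_apply (J - r • A) _ _ x

theorem res_sub (h : MDissipative J A B c) {r : ℝ} (hr : 0 < r) (k : K) :
    h.res hr (J k - r • A k) = k :=
  ContinuousLinearEquiv.ofBijective_symm_apply_apply (J - r • A) _ _ k

/-- The Yosida approximation. -/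
def yos (h : MDissipative J A B c) {r : ℝ} (hr : 0 < r) : E →L[ℝ] E := A ∘L h.res hr

/-- The semigroup generated by the Yosida approximation. -/
def flow (h : MDissipative J A B c) {r : ℝ} (hr : 0 < r) (t : ℝ) : E →L[ℝ] E :=
  NormedSpace.exp (t • h.yos hr)

theorem flow_zero (h : MDissipative J A B c) {r : ℝ} (hr : 0 < r) (x : E) :
    h.flow hr 0 x = x := by
  simp [flow]

theorem hasDerivAt_flow (h : MDissipative J A B c) {r : ℝ} (hr : 0 < r) (x : E) (t : ℝ) :
    HasDerivAt (fun s => h.flow hr s x) (h.flow hr t (h.yos hr x)) t :=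
  ((hasDerivAt_exp_smul_const (𝕂 := ℝ) (h.yos hr) t).clm_apply (hasDerivAt_const t x)).congr_deriv
    (by simp [flow])

theorem yos_flow (h : MDissipative J A B c) {r : ℝ} (hr : 0 < r) (x : E) (t : ℝ) :
    h.yos hr (h.flow hr t x) = h.flow hr t (h.yos hr x) := by
  have h1 := ((hasDerivAt_exp_smul_const' (𝕂 := ℝ) (h.yos hr) t).clm_apply
    (hasDerivAt_const t x)).unique (h.hasDerivAt_flow hr x t)
  simpa [flow] using h1

/-- Write `x = J k - r A k` with `k` the resolvent of `x`. Then `B (A k) x = B (A k) (J k) - r B (A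
k) (A k)`, and both terms are nonpositive. -/
theorem yos_dissipative (h : MDissipative J A B c) {r : ℝ} (hr : 0 < r) (x : E) :
    B (h.yos hr x) x ≤ 0 := by
  have h1 := h.sub_res hr x
  have h2 := h.dissipative (h.res hr x)
  have h3 := h.nonneg (A (h.res hr x))
  have h4 := sub_eq_iff_eq_add.mp h1
  rw [h4, map_add, map_smul, smul_eq_mul] at h2
  change B (A (h.res hr x)) x ≤ 0
  nlinarith

theorem form_flow_le (h : MDissipative J A B c) {r : ℝ} (hr : 0 < r) (x : E) {t : ℝ}
    (ht : 0 ≤ t) : B (h.flow hr t x) (h.flow hr t x) ≤ B x x := by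
  have hd := fun s => h.hasDerivAt_form (h.hasDerivAt_flow hr x s)
  have := antitone_of_deriv_nonpos (fun s => (hd s).differentiableAt) (fun s => by
    rw [(hd s).deriv, ← h.yos_flow]
    linarith [h.yos_dissipative hr (h.flow hr s x)]) ht
  simpa only [h.flow_zero] using this

theorem norm_flow_le (h : MDissipative J A B c) {r : ℝ} (hr : 0 < r) (x : E) {t : ℝ}
    (ht : 0 ≤ t) : ‖h.flow hr t x‖ ≤ √(‖B‖ / c) * ‖x‖ := h.norm_le (h.form_flow_le hr x ht)

/-- On the shifted datum `J k - r A k` the approximation takes the exact value `A k`. Approximate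
flows started there therefore have the velocity `flow (A k)`, which is bounded independently of `r`;
this is why the shift is used below. -/
theorem yos_sub (h : MDissipative J A B c) {r : ℝ} (hr : 0 < r) (k : K) :
    h.yos hr (J k - r • A k) = A k := by
  simp only [yos, ContinuousLinearMap.comp_apply, h.res_sub]

/-- Kato's estimate for the difference of two Yosida approximations. -/
theorem form_flow_sub_le (h : MDissipative J A B c) {r s : ℝ} (hr : 0 < r) (hs : 0 < s) (k : K)
    {t : ℝ} (ht : 0 ≤ t) :
    B (h.flow hr t (J k - r • A k) - h.flow hs t (J k - s • A k))
        (h.flow hr t (J k - r • A k) - h.flow hs t (J k - s • A k))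
      ≤ (r - s) ^ 2 * B (A k) (A k) + 4 * ‖B‖ * (√(‖B‖ / c) * ‖A k‖) ^ 2 * (r + s) * t := by
  set m := √(‖B‖ / c) * ‖A k‖
  set w : ℝ → E := fun t => h.flow hr t (J k - r • A k) - h.flow hs t (J k - s • A k) with hw
  have hwd : ∀ x, HasDerivAt w (h.flow hr x (A k) - h.flow hs x (A k)) x := fun x => by
    have := (h.hasDerivAt_flow hr (J k - r • A k) x).sub (h.hasDerivAt_flow hs (J k - s • A k) x)
    rwa [h.yos_sub, h.yos_sub] at this
  have key : ∀ x, 0 ≤ x → 2 * B (h.flow hr x (A k) - h.flow hs x (A k)) (w x)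
      ≤ 4 * ‖B‖ * m ^ 2 * (r + s) := by
    intro x hx
    set v₁ := h.flow hr x (A k) with hv₁
    set v₂ := h.flow hs x (A k) with hv₂
    set k₁ := h.res hr (h.flow hr x (J k - r • A k))
    set k₂ := h.res hs (h.flow hs x (J k - s • A k))
    have e1 : A k₁ = v₁ := by
      rw [hv₁, ← h.yos_sub hr k, ← h.yos_flow]; rfl
    have e2 : A k₂ = v₂ := by
      rw [hv₂, ← h.yos_sub hs k, ← h.yos_flow]; rfl
    have f1 : J k₁ - r • v₁ = h.flow hr x (J k - r • A k) := by rw [← e1]; exact h.sub_res hr _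
    have f2 : J k₂ - s • v₂ = h.flow hs x (J k - s • A k) := by rw [← e2]; exact h.sub_res hs _
    -- Up to an error of order `r + s` the difference `w` lies in the domain and its velocity is `A
    -- (k₁ - k₂)`. Dissipativity disposes of the main part, and only the error contributes to the
    -- growth of `B w w`.
    have e3 : w x = J (k₁ - k₂) - (r • v₁ - s • v₂) := by
      rw [hw]; simp only [← f1, ← f2, map_sub]; abel
    have e4 : v₁ - v₂ = A (k₁ - k₂) := by rw [map_sub, e1, e2]
    have n1 : ‖v₁‖ ≤ m := h.norm_flow_le hr _ hx
    have n2 : ‖v₂‖ ≤ m := h.norm_flow_le hs _ hx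
    have d := h.dissipative (k₁ - k₂)
    have b1 : |B (v₁ - v₂) (r • v₁ - s • v₂)| ≤ ‖B‖ * ‖v₁ - v₂‖ * ‖r • v₁ - s • v₂‖ :=
      B.le_opNorm₂ _ _
    have n3 : ‖v₁ - v₂‖ ≤ 2 * m := (norm_sub_le _ _).trans (by linarith)
    have n4 : ‖r • v₁ - s • v₂‖ ≤ (r + s) * m := by
      refine (norm_sub_le _ _).trans ?_
      rw [norm_smul, norm_smul, Real.norm_of_nonneg hr.le, Real.norm_of_nonneg hs.le, add_mul]
      gcongr
    have b2 : ‖B‖ * ‖v₁ - v₂‖ * ‖r • v₁ - s • v₂‖ ≤ ‖B‖ * (2 * m) * ((r + s) * m) := by gcongr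
    rw [← e4] at d
    rw [e3, map_sub (B (v₁ - v₂)) (J (k₁ - k₂))]
    have b3 := neg_le_of_abs_le (b1.trans b2)
    nlinarith
  have hd := fun x => h.hasDerivAt_form (hwd x)
  have := image_le_of_deriv_right_le_deriv_boundary (f := fun x => B (w x) (w x))
    (f' := fun x => 2 * B (h.flow hr x (A k) - h.flow hs x (A k)) (w x)) (a := 0) (b := t)
    (fun x _ => (hd x).continuousAt.continuousWithinAt) (fun x _ => (hd x).hasDerivWithinAt)
    (B := fun x => (r - s) ^ 2 * B (A k) (A k) + 4 * ‖B‖ * m ^ 2 * (r + s) * x)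
    (B' := fun _ => 4 * ‖B‖ * m ^ 2 * (r + s)) ?_ (by fun_prop) (fun x _ => ?_)
    (fun x hx => key x hx.1) (right_mem_Icc.mpr ht)
  · exact this
  · simp only [hw, h.flow_zero, mul_zero, add_zero]
    have : J k - r • A k - (J k - s • A k) = (s - r) • A k := by rw [sub_smul]; abel
    rw [this]
    simp only [map_smul, smul_apply, smul_eq_mul]
    apply le_of_eq; ring
  · have := ((hasDerivAt_id x).const_mul (4 * ‖B‖ * m ^ 2 * (r + s))).const_add
      ((r - s) ^ 2 * B (A k) (A k))
    simpa using this.hasDerivWithinAt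

end MDissipative

end Semigroup

namespace MDissipative

variable {K E : Type*} [NormedAddCommGroup K] [NormedSpace ℝ K] [NormedAddCommGroup E]
  [NormedSpace ℝ E] [CompleteSpace K] [CompleteSpace E]
  {J A : K →L[ℝ] E} {B : E →L[ℝ] E →L[ℝ] ℝ} {c : ℝ}

/-- The Yosida parameters. -/
def par (n : ℕ) : ℝ := 1 / ((n : ℝ) + 1)

theorem par_pos (n : ℕ) : 0 < par n := by unfold par; positivity

theorem tendsto_par : Tendsto par atTop (𝓝 0) := tendsto_one_div_add_atTop_nhds_zero_nat

/-- Undoes the shift of the initial data, which costs `r ‖flow (A k)‖ + s ‖flow (A k)‖`. -/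
theorem norm_flow_sub_le (h : MDissipative J A B c) (T : ℝ) (k : K) :
    ∃ C : ℝ, 0 ≤ C ∧ ∀ r s : ℝ, ∀ (hr : 0 < r) (hs : 0 < s), r ≤ 1 → s ≤ 1 → ∀ t ∈ Icc 0 T,
      ‖h.flow hr t (J k) - h.flow hs t (J k)‖ ≤ C * √(r + s) + C * (r + s) := by
  set m := √(‖B‖ / c) * ‖A k‖ with hm
  have hm0 : 0 ≤ m := by positivity
  have hc := h.c_pos
  set D := (2 * B (A k) (A k) + 4 * ‖B‖ * m ^ 2 * |T|) / c with hD
  have hBA := h.nonneg (A k)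
  have hD0 : 0 ≤ D := by positivity
  refine ⟨√D + m, by positivity, fun r s hr hs hr1 hs1 t ht => ?_⟩
  have h1 := h.form_flow_sub_le hr hs k ht.1
  set w := h.flow hr t (J k - r • A k) - h.flow hs t (J k - s • A k) with hw
  have h2 : ‖w‖ ^ 2 ≤ D * (r + s) := by
    have h3 := (h.coercive w).trans h1
    have h4 : (r - s) ^ 2 ≤ 2 * (r + s) := by nlinarith
    have h5 : t ≤ |T| := ht.2.trans (le_abs_self T)
    have h6 : (r - s) ^ 2 * B (A k) (A k) + 4 * ‖B‖ * m ^ 2 * (r + s) * t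
        ≤ 2 * (r + s) * B (A k) (A k) + 4 * ‖B‖ * m ^ 2 * (r + s) * |T| := by gcongr
    rw [hD, div_mul_eq_mul_div, le_div_iff₀ hc]
    linarith
  have h3 : ‖w‖ ≤ √D * √(r + s) := by
    rw [← Real.sqrt_mul hD0]; exact Real.le_sqrt_of_sq_le h2
  have h4 : h.flow hr t (J k) - h.flow hs t (J k)
      = w + (r • h.flow hr t (A k) - s • h.flow hs t (A k)) := by
    rw [hw]; simp only [map_sub, map_smul]; abel
  have h5 : ‖r • h.flow hr t (A k) - s • h.flow hs t (A k)‖ ≤ m * (r + s) := by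
    refine (norm_sub_le _ _).trans ?_
    rw [norm_smul, norm_smul, Real.norm_of_nonneg hr.le, Real.norm_of_nonneg hs.le]
    have h6 := h.norm_flow_le hr (A k) ht.1
    have h7 := h.norm_flow_le hs (A k) ht.1
    rw [← hm] at h6 h7
    nlinarith
  rw [h4]
  refine (norm_add_le _ _).trans ?_
  have : 0 ≤ m * √(r + s) := by positivity
  have : 0 ≤ √D * (r + s) := by positivity
  linarith

/-- Data in the dense domain have a rate of convergence; the flows are bounded independently of the
Yosida parameter, so an `ε/3` argument reaches all data. -/
theorem uniformCauchySeqOn_flow (h : MDissipative J A B c) (T : ℝ) (x : E) :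
    UniformCauchySeqOn (fun n t => h.flow (par_pos n) t x) atTop (Icc 0 T) := by
  rw [Metric.uniformCauchySeqOn_iff]
  intro ε hε
  set M := √(‖B‖ / c)
  have hM : 0 ≤ M := Real.sqrt_nonneg _
  obtain ⟨_, ⟨k, rfl⟩, hk⟩ := Metric.mem_closure_iff.mp (h.dense x) (ε / (3 * (M + 1)))
    (by positivity)
  obtain ⟨C, hC, hest⟩ := h.norm_flow_sub_le T k
  have hlim : Tendsto (fun n => C * √(2 * par n) + C * (2 * par n)) atTop (𝓝 0) := by
    have h1 := tendsto_par.const_mul 2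
    have := (h1.sqrt.const_mul C).add (h1.const_mul C)
    simpa using this
  obtain ⟨N, hN⟩ := eventually_atTop.mp (hlim.eventually (gt_mem_nhds (by positivity : 0 < ε / 3)))
  refine ⟨N, fun n hn l hl t ht => ?_⟩
  have hpar : ∀ n, N ≤ n → par n ≤ par N := fun n hn => by
    unfold par; gcongr
  have hpar1 : ∀ n, par n ≤ 1 := fun n => by
    unfold par; rw [div_le_one (by positivity)]; linarith [Nat.cast_nonneg (α := ℝ) n]
  have e1 := hest (par n) (par l) (par_pos n) (par_pos l) (hpar1 n) (hpar1 l) t ht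
  have e2 : C * √(par n + par l) + C * (par n + par l) ≤ C * √(2 * par N) + C * (2 * par N) := by
    have : par n + par l ≤ 2 * par N := by linarith [hpar n hn, hpar l hl]
    gcongr
  have e3 := hN N le_rfl
  have e4 : ∀ n, ‖h.flow (par_pos n) t x - h.flow (par_pos n) t (J k)‖ < ε / 3 := fun n => by
    rw [← map_sub]
    refine (h.norm_flow_le (par_pos n) _ ht.1).trans_lt ?_
    rw [dist_eq_norm] at hk
    calc M * ‖x - J k‖ ≤ (M + 1) * ‖x - J k‖ := by gcongr; linarith
      _ < (M + 1) * (ε / (3 * (M + 1))) := by gcongr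
      _ = ε / 3 := by field_simp
  rw [dist_eq_norm]
  have e5 : h.flow (par_pos n) t x - h.flow (par_pos l) t x
      = (h.flow (par_pos n) t x - h.flow (par_pos n) t (J k))
        + (h.flow (par_pos n) t (J k) - h.flow (par_pos l) t (J k))
        - (h.flow (par_pos l) t x - h.flow (par_pos l) t (J k)) := by abel
  rw [e5]
  refine ((norm_sub_le _ _).trans (add_le_add_left (norm_add_le _ _) _)).trans_lt ?_
  linarith [e4 n, e4 l]

theorem exists_tendstoUniformlyOn_flow (h : MDissipative J A B c) (T : ℝ) (x : E) :
    ∃ u : ℝ → E, TendstoUniformlyOn (fun n t => h.flow (par_pos n) t x) u atTop (Icc 0 T) := by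
  have hc := h.uniformCauchySeqOn_flow T x
  have : ∀ t ∈ Icc 0 T, ∃ y, Tendsto (fun n => h.flow (par_pos n) t x) atTop (𝓝 y) := fun t ht =>
    cauchySeq_tendsto_of_complete (hc.cauchySeq ht)
  choose! u hu using this
  exact ⟨u, hc.tendstoUniformlyOn_of_tendsto hu⟩

/-- **Lumer–Phillips**: the abstract Cauchy problem has a classical solution. -/
theorem exists_solution (h : MDissipative J A B c) {T : ℝ} (hT : 0 ≤ T) (k₀ : K) :
    ∃ k : ℝ → K, ContinuousOn k (Icc 0 T) ∧ k 0 = k₀ ∧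
      ∀ t ∈ Icc 0 T, HasDerivWithinAt (fun s => J (k s)) (A (k t)) (Icc 0 T) t := by
  obtain ⟨u, hu⟩ := h.exists_tendstoUniformlyOn_flow T (J k₀)
  obtain ⟨v, hv⟩ := h.exists_tendstoUniformlyOn_flow T (A k₀)
  have hcont : ∀ (x : E) n, ContinuousOn (fun t => h.flow (par_pos n) t x) (Icc 0 T) :=
    fun x n t _ => (h.hasDerivAt_flow (par_pos n) x t).continuousAt.continuousWithinAt
  have cu : ContinuousOn u (Icc 0 T) := hu.continuousOn (Frequently.of_forall (hcont _))
  have cv : ContinuousOn v (Icc 0 T) := hv.continuousOn (Frequently.of_forall (hcont _))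
  have hw : ∀ t ∈ Icc 0 T, Tendsto
      (fun n => h.flow (par_pos n) t (J k₀ - par n • A k₀)) atTop (𝓝 (u t)) := by
    intro t ht
    have := (hu.tendsto_at ht).sub (tendsto_par.smul (hv.tendsto_at ht))
    simpa only [zero_smul, sub_zero, map_sub, map_smul] using this
  have hd : ∀ t ∈ Icc 0 T, HasDerivWithinAt u (v t) (Icc 0 T) t := fun t ht =>
    hasDerivWithinAt_of_tendstoUniformlyOn
      (u := fun n t => h.flow (par_pos n) t (J k₀ - par n • A k₀))
      (v := fun n t => h.flow (par_pos n) t (A k₀))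
      (fun n t _ => by
        have := (h.hasDerivAt_flow (par_pos n) (J k₀ - par n • A k₀) t).hasDerivWithinAt
          (s := Icc 0 T)
        rwa [h.yos_sub] at this) (hcont _) hw hv ht
  -- No closedness of `A` has to be invoked: the approximants `kn` are recovered from `J kn - A kn`
  -- by the continuous resolvent at `r = 1`, hence converge in `K`, and `J`, `A` are continuous on
  -- `K`. The same formula makes the solution continuous with values in `K`.
  have key : ∀ t ∈ Icc 0 T, J (h.res one_pos (u t - v t)) = u t ∧
      A (h.res one_pos (u t - v t)) = v t := by
    intro t ht
    set kn : ℕ → K := fun n => h.res (par_pos n) (h.flow (par_pos n) t (J k₀ - par n • A k₀))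
    have hA : ∀ n, A (kn n) = h.flow (par_pos n) t (A k₀) := fun n => by
      rw [← h.yos_sub (par_pos n) k₀, ← h.yos_flow]; rfl
    have hJ : ∀ n, J (kn n) = h.flow (par_pos n) t (J k₀ - par n • A k₀)
        + par n • h.flow (par_pos n) t (A k₀) := fun n => by
      rw [← hA, ← sub_eq_iff_eq_add]; exact h.sub_res (par_pos n) _
    have lA : Tendsto (fun n => A (kn n)) atTop (𝓝 (v t)) := by
      simp only [hA]; exact hv.tendsto_at ht
    have lJ : Tendsto (fun n => J (kn n)) atTop (𝓝 (u t)) := by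
      have := (hw t ht).add (tendsto_par.smul (hv.tendsto_at ht))
      simpa only [hJ, zero_smul, add_zero] using this
    have lk : Tendsto kn atTop (𝓝 (h.res one_pos (u t - v t))) := by
      have := ((h.res one_pos).continuous.tendsto _).comp (lJ.sub lA)
      refine this.congr fun n => ?_
      have := h.res_sub one_pos (kn n)
      rwa [one_smul] at this
    exact ⟨tendsto_nhds_unique ((J.continuous.tendsto _).comp lk) lJ,
      tendsto_nhds_unique ((A.continuous.tendsto _).comp lk) lA⟩
  refine ⟨fun t => h.res one_pos (u t - v t),
    (h.res one_pos).continuous.comp_continuousOn (cu.sub cv), ?_, fun t ht => ?_⟩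
  · have h0 : (0 : ℝ) ∈ Icc 0 T := ⟨le_rfl, hT⟩
    have e1 : u 0 = J k₀ := tendsto_nhds_unique (hu.tendsto_at h0)
      (by simp only [h.flow_zero]; exact tendsto_const_nhds)
    have e2 : v 0 = A k₀ := tendsto_nhds_unique (hv.tendsto_at h0)
      (by simp only [h.flow_zero]; exact tendsto_const_nhds)
    have := h.res_sub one_pos k₀
    rw [one_smul] at this
    simp only [e1, e2, this]
  · rw [(key t ht).2]
    exact (hd t ht).congr_of_mem (fun s hs => (key s hs).1) ht

end MDissipative

/-! ### Linear differential equations with `L²` forcing -/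

section ODE

variable {V : Type*} [NormedAddCommGroup V] [NormedSpace ℝ V]

/-- The solution of `W' = B (W + g)`, `W(0) = c`. -/
def duhamel (B : V →L[ℝ] V) (g : ℝ → V) (c : V) (x : ℝ) : V :=
  NormedSpace.exp (x • B) (c + ∫ s in (0 : ℝ)..x, NormedSpace.exp ((-s) • B) (B (g s)))

theorem exp_smul_mul_neg [CompleteSpace V] (B : V →L[ℝ] V) (x : ℝ) (v : V) :
    NormedSpace.exp (x • B) (NormedSpace.exp ((-x) • B) v) = v := by
  have h : Commute (x • B) ((-x) • B) := ((Commute.refl B).smul_left x).smul_right (-x)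
  let _ : NormedAlgebra ℚ (V →L[ℝ] V) := NormedAlgebra.restrictScalars ℚ ℝ (V →L[ℝ] V)
  have h2 := NormedSpace.exp_add_of_commute h
  rw [← add_smul, add_neg_cancel, zero_smul, NormedSpace.exp_zero] at h2
  have h3 := congrArg (fun (f : V →L[ℝ] V) => f v) h2
  exact h3.symm

theorem hasDerivAt_duhamel [CompleteSpace V] (B : V →L[ℝ] V) {g : ℝ → V} (hg : Continuous g) (c : V) (x : ℝ) :
    HasDerivAt (duhamel B g c) (B (duhamel B g c x + g x)) x := by
  have hexp : Continuous (fun s : ℝ => NormedSpace.exp ((-s) • B)) := by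
    have : Continuous (fun s : ℝ => NormedSpace.exp (s • B)) :=
      continuous_iff_continuousAt.mpr fun s => (hasDerivAt_exp_smul_const (𝕂 := ℝ) B s).continuousAt
    exact this.comp continuous_neg
  have hc : Continuous (fun s : ℝ => NormedSpace.exp ((-s) • B) (B (g s))) :=
    hexp.clm_apply (B.continuous.comp hg)
  have h1 := (hc.integral_hasStrictDerivAt 0 x).hasDerivAt.const_add c
  have h2 := (hasDerivAt_exp_smul_const' (𝕂 := ℝ) B x).clm_apply h1
  refine h2.congr_deriv ?_
  rw [exp_smul_mul_neg, map_add B]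
  rfl

theorem duhamel_zero (B : V →L[ℝ] V) (g : ℝ → V) (c : V) : duhamel B g c 0 = c := by
  simp [duhamel]

theorem duhamel_eq (B : V →L[ℝ] V) (g : ℝ → V) (c : V) (x : ℝ) :
    duhamel B g c x = NormedSpace.exp (x • B) c + duhamel B g 0 x := by
  simp only [duhamel, zero_add, map_add]

theorem duhamel_zero_forcing (B : V →L[ℝ] V) (c : V) (x : ℝ) :
    duhamel B 0 c x = NormedSpace.exp (x • B) c := by
  simp [duhamel]

end ODE

/-- The primitive of an `L²(0,ℓ)` function, extended to the real line. -/
def prim {ℓ : ℝ} (g : L2 ℓ) (x : ℝ) : ℝ := ∫ t in (0 : ℝ)..x, (Ioo 0 ℓ).indicator g t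

theorem integrable_indicator {ℓ : ℝ} (g : L2 ℓ) : Integrable ((Ioo 0 ℓ).indicator g) volume :=
  (integrable_indicator_iff measurableSet_Ioo).mpr (L2.integrable g)

theorem continuous_prim {ℓ : ℝ} (g : L2 ℓ) : Continuous (prim g) :=
  (integrable_indicator g).continuous_primitive 0

theorem ac_prim {ℓ : ℝ} (g : L2 ℓ) : AbsolutelyContinuousOnInterval (prim g) 0 ℓ :=
  (integrable_indicator g).intervalIntegrable.absolutelyContinuousOnInterval_intervalIntegral
    (by simp)

theorem hasDerivAt_prim {ℓ : ℝ} (hℓ : 0 ≤ ℓ) (g : L2 ℓ) :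
    ∀ᵐ x ∂volume.restrict (Ioo 0 ℓ), HasDerivAt (prim g) (g x) x := by
  rw [ae_restrict_iff' measurableSet_Ioo]
  filter_upwards [((integrable_indicator g).intervalIntegrable (a := 0)
    (b := ℓ)).ae_hasDerivAt_integral] with x hx hxm
  have := hx (by rw [uIcc_of_le hℓ]; exact Ioo_subset_Icc_self hxm) 0 (by simp)
  rwa [indicator_of_mem hxm] at this

theorem prim_zero_right {ℓ : ℝ} (x : ℝ) : prim (0 : L2 ℓ) x = 0 := by
  have : (Ioo 0 ℓ).indicator (0 : L2 ℓ) =ᵐ[volume] (fun _ => (0 : ℝ)) := by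
    have := (ae_restrict_iff' (μ := volume) measurableSet_Ioo).mp
      (Lp.coeFn_zero ℝ 2 (volume.restrict (Ioo (0 : ℝ) ℓ)))
    filter_upwards [this] with y hy
    by_cases h : y ∈ Ioo 0 ℓ
    · rw [indicator_of_mem h, hy h]; rfl
    · rw [indicator_of_notMem h]
  unfold prim
  rw [intervalIntegral.integral_congr_ae (g := fun _ => (0 : ℝ))
    (by filter_upwards [this] with y hy _ using hy)]
  simp

theorem ac_of_hasDerivAt {ℓ : ℝ} {F G : ℝ → ℝ} (hF : ∀ x, HasDerivAt F (G x) x)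
    (hG : Continuous G) : AbsolutelyContinuousOnInterval F 0 ℓ := by
  have : deriv F = G := funext fun x => (hF x).deriv
  exact ((contDiff_one_iff_deriv.mpr
    ⟨fun x => (hF x).differentiableAt, this ▸ hG⟩).contDiffOn).absolutelyContinuousOnInterval

/-- Five functions, each the derivative of the preceding one, define a chain of weak derivatives. -/
theorem exists_chain {ℓ : ℝ} (hℓ : 0 ≤ ℓ) {u : ℝ → Fin 5 → ℝ} {u5 : L2 ℓ}
    (hc : Continuous u)
    (hu : ∀ i : Fin 4, ∀ x, HasDerivAt (fun y => u y i.castSucc) (u x i.succ) x)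
    (hac : AbsolutelyContinuousOnInterval (fun y => u y 4) 0 ℓ)
    (h4 : ∀ᵐ x ∂volume.restrict (Ioo 0 ℓ), HasDerivAt (fun y => u y 4) (u5 x) x) :
    ∃ U : Fin 6 → L2 ℓ, (∀ i : Fin 5, U i.castSucc =ᵐ[volume.restrict (Ioo 0 ℓ)] fun x => u x i) ∧
      U 5 = u5 ∧ (∀ i : Fin 5, HasWeakDeriv (U i.castSucc) (U i.succ)) ∧
      ∀ (i : Fin 5) x, HasTrace (U i.castSucc) x (u x i) := by
  have hci : ∀ i, Continuous fun x => u x i := fun i => (continuous_apply i).comp hc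
  have m : ∀ i, MemLp (fun x => u x i) 2 (volume.restrict (Ioo 0 ℓ)) := fun i =>
    memLp_of_continuousOn (hci i).continuousOn
  refine ⟨Fin.snoc (fun i => (m i).toLp _) u5, fun i => ?_, ?_, fun i => ?_, fun i x => ?_⟩
  · rw [Fin.snoc_castSucc]; exact (m i).coeFn_toLp
  · exact Fin.snoc_last _ _
  · rw [Fin.snoc_castSucc]
    induction i using Fin.lastCases with
    | last =>
      rw [Fin.succ_last, Fin.snoc_last]
      exact IsRep.hasWeakDeriv hℓ ⟨hac, (m 4).coeFn_toLp, h4⟩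
    | cast j =>
      rw [Fin.succ_castSucc, Fin.snoc_castSucc]
      refine IsRep.hasWeakDeriv (F := fun x => u x j.castSucc) hℓ
        ⟨ac_of_hasDerivAt (hu j) (hci _), (m _).coeFn_toLp, ?_⟩
      filter_upwards [(m j.succ).coeFn_toLp] with x hx
      rw [hx]; exact hu j x
  · rw [Fin.snoc_castSucc]
    exact ⟨_, (hci i).continuousOn, (m i).coeFn_toLp, rfl⟩

/-! ### The operator with a constant delay: dissipativity and density of its domain. -/

namespace Params

/-- The tuples of derivatives. -/
abbrev Tuple (P : Params) : Type := (Fin 6 → L2 P.L) × (Fin 6 → L2 P.L) × (Fin 2 → L2 1)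

/-- The `i`-th derivative of `η`. -/
def coη (P : Params) (i : Fin 6) : P.Tuple →L[ℝ] L2 P.L :=
  (ContinuousLinearMap.proj i).comp (ContinuousLinearMap.fst ℝ _ _)

/-- The `i`-th derivative of `ω`. -/
def coω (P : Params) (i : Fin 6) : P.Tuple →L[ℝ] L2 P.L :=
  (ContinuousLinearMap.proj i).comp
    ((ContinuousLinearMap.fst ℝ _ _).comp (ContinuousLinearMap.snd ℝ _ _))

/-- The `i`-th derivative of `z`. -/
def coz (P : Params) (i : Fin 2) : P.Tuple →L[ℝ] L2 1 :=
  (ContinuousLinearMap.proj i).comp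
    ((ContinuousLinearMap.snd ℝ _ _).comp (ContinuousLinearMap.snd ℝ _ _))

/-- The embedding of the domain into the state space. -/
def emb (P : Params) : P.dom →L[ℝ] State P.L :=
  (((P.coη 0).prod (P.coω 0)).prod (P.coz 0)).comp P.dom.subtypeL

/-- The operator of the system with the constant delay `σ`. -/
def frozen (P : Params) (σ : ℝ) : P.dom →L[ℝ] State P.L :=
  (((-P.coω 1 - P.a • P.coω 3 - P.a₁ • P.coω 5).prod
    (-P.coη 1 - P.a • P.coη 3 - P.a₁ • P.coη 5)).prod (-(1 / σ) • P.coz 1)).comp P.dom.subtypeL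

/-- The weighted inner product of the state space. -/
def form (P : Params) (κ : ℝ) : State P.L →L[ℝ] State P.L →L[ℝ] ℝ :=
  (innerSL ℝ).bilinearComp
      ((ContinuousLinearMap.fst ℝ (L2 P.L) (L2 P.L)).comp (ContinuousLinearMap.fst ℝ (X0 P.L) (L2 1)))
      ((ContinuousLinearMap.fst ℝ (L2 P.L) (L2 P.L)).comp (ContinuousLinearMap.fst ℝ (X0 P.L) (L2 1)))
    + (innerSL ℝ).bilinearComp
      ((ContinuousLinearMap.snd ℝ (L2 P.L) (L2 P.L)).comp (ContinuousLinearMap.fst ℝ (X0 P.L) (L2 1)))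
      ((ContinuousLinearMap.snd ℝ (L2 P.L) (L2 P.L)).comp (ContinuousLinearMap.fst ℝ (X0 P.L) (L2 1)))
    + κ • (innerSL ℝ).bilinearComp (ContinuousLinearMap.snd ℝ (X0 P.L) (L2 1))
      (ContinuousLinearMap.snd ℝ (X0 P.L) (L2 1))

theorem form_apply (P : Params) (κ : ℝ) (x y : State P.L) :
    P.form κ x y = inner ℝ x.1.1 y.1.1 + inner ℝ x.1.2 y.1.2 + κ * inner ℝ x.2 y.2 := rfl

theorem emb_apply (P : Params) (k : P.dom) :
    P.emb k = (((k : P.Tuple).1 0, (k : P.Tuple).2.1 0), (k : P.Tuple).2.2 0) := rfl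

theorem frozen_apply (P : Params) (σ : ℝ) (k : P.dom) :
    P.frozen σ k = ((-(k : P.Tuple).2.1 1 - P.a • (k : P.Tuple).2.1 3 - P.a₁ • (k : P.Tuple).2.1 5,
      -(k : P.Tuple).1 1 - P.a • (k : P.Tuple).1 3 - P.a₁ • (k : P.Tuple).1 5),
      -(1 / σ) • (k : P.Tuple).2.2 1) := rfl

theorem eq_zero_of_chain {ℓ : ℝ} {u : Fin 6 → L2 ℓ}
    (h : ∀ i : Fin 5, HasWeakDeriv (u i.castSucc) (u i.succ)) (h0 : u 0 = 0) : u = 0 := by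
  funext i
  induction i using Fin.induction with
  | zero => exact h0
  | succ i ih =>
    have := h i
    rw [ih] at this
    exact this.unique .zero

theorem emb_injective (P : Params) : Function.Injective P.emb := by
  rw [injective_iff_map_eq_zero]
  rintro ⟨⟨η, ω, z⟩, p, q, h⟩ hk
  rw [emb_apply] at hk
  simp only [Prod.mk_eq_zero] at hk
  obtain ⟨⟨h1, h2⟩, h3⟩ := hk
  have e1 : η = 0 := eq_zero_of_chain h.η_deriv h1
  have e2 : ω = 0 := eq_zero_of_chain h.ω_deriv h2
  have e3 : z = 0 := by
    funext i
    fin_cases i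
    · exact h3
    · have h4 : HasWeakDeriv (z 0) (z 1) := h.z_deriv
      rw [h3] at h4
      exact h4.unique .zero
  apply Subtype.ext
  simp [e1, e2, e3]

/-- The dissipation inequality is used with `θ = 0`, the delay being constant, and `κ = |β| + gap`,
for which the right-hand side is zero. The factor `σ` in the weight cancels the speed `1/σ` of the
transport, and the weight is positive even for `β = 0`, so the form is coercive. -/
theorem Admissible.dissipative_frozen {P : Params} (hP : P.Admissible) {σ : ℝ} (hσ : 0 < σ) :
    Dissipative P.emb (P.frozen σ) (P.form ((|P.β| + P.gap) * σ))
      (min 1 ((|P.β| + P.gap) * σ)) where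
  inj := P.emb_injective
  symm x y := by
    simp only [form_apply, real_inner_comm]
  c_pos := by
    have := hP.gap_pos
    have := abs_nonneg P.β
    exact lt_min one_pos (by positivity)
  coercive x := by
    obtain ⟨⟨x1, x2⟩, x3⟩ := x
    rw [form_apply]
    simp only [real_inner_self_eq_norm_sq]
    set κ := (|P.β| + P.gap) * σ with hκ
    have h0 : 0 < κ := by
      have := hP.gap_pos
      have := abs_nonneg P.β
      positivity
    have h1 := min_le_left 1 κ
    have h2 := min_le_right 1 κ
    have h3 : 0 < min 1 κ := lt_min one_pos h0
    rw [Prod.norm_mk, Prod.norm_mk]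
    rcases max_choice (max ‖x1‖ ‖x2‖) ‖x3‖ with h | h
    · rw [h]
      rcases max_choice ‖x1‖ ‖x2‖ with h | h
      · rw [h]; nlinarith [sq_nonneg ‖x1‖, sq_nonneg ‖x2‖, mul_nonneg h0.le (sq_nonneg ‖x3‖)]
      · rw [h]; nlinarith [sq_nonneg ‖x1‖, sq_nonneg ‖x2‖, mul_nonneg h0.le (sq_nonneg ‖x3‖)]
    · rw [h]; nlinarith [sq_nonneg ‖x1‖, sq_nonneg ‖x2‖, sq_nonneg ‖x3‖]
  dissipative k := by
    obtain ⟨⟨η, ω, z⟩, p, q, h⟩ := k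
    simp only at h
    rw [form_apply, frozen_apply, emb_apply]
    have e1 := h.energy hP.L_pos 0
    simp only [A] at e1
    have e2 := inner_by_parts one_pos h.z_deriv h.z_deriv h.z_zero h.z_one h.z_zero h.z_one
    have e3 := hP.dissipation (κ := |P.β| + P.gap) (by linarith [hP.gap_pos]) hP.d_nonneg p q
    simp only
    rw [real_inner_comm, real_inner_comm (ω 0), inner_smul_left, mul_assoc]
    rw [real_inner_comm (z 1)] at e2
    have e4 : σ * ((starRingEnd ℝ) (-(1 / σ)) * inner ℝ (z 1) (z 0)) = -inner ℝ (z 1) (z 0) := by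
      simp only [conj_trivial]; field_simp
    have e5 : -inner ℝ (z 1) (z 0) = (p ^ 2 - q ^ 2) / 2 := by linarith
    rw [e4, e1, e5]
    linarith

theorem trace_of_test {ℓ x : ℝ} {φ : ℝ → ℝ} (ht : tsupport φ ⊆ Ioo 0 ℓ) (hx : x = 0 ∨ x = ℓ)
    (i : ℕ) : iteratedDeriv i φ x = 0 := by
  have : x ∉ tsupport φ := fun h => by
    have := ht h
    rcases hx with rfl | rfl
    · exact lt_irrefl _ this.1
    · exact lt_irrefl _ this.2
  have h : tsupport (iteratedDeriv i φ) ⊆ tsupport φ := by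
    induction i with
    | zero => rw [iteratedDeriv_zero]
    | succ i ih =>
      rw [iteratedDeriv_succ]
      exact (closure_minimal support_deriv_subset (isClosed_tsupport _)).trans ih
  exact image_eq_zero_of_notMem_tsupport fun hh => this (h hh)

theorem exists_chain_of_test {ℓ : ℝ} (hℓ : 0 ≤ ℓ) {f : L2 ℓ} {φ : ℝ → ℝ}
    (hs : ContDiff ℝ ((⊤ : ℕ∞) : WithTop ℕ∞) φ) (ht : tsupport φ ⊆ Ioo 0 ℓ)
    (hf : f =ᵐ[volume.restrict (Ioo 0 ℓ)] φ) :
    ∃ U : Fin 6 → L2 ℓ, U 0 = f ∧ (∀ i : Fin 5, HasWeakDeriv (U i.castSucc) (U i.succ)) ∧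
      ∀ (i : Fin 5) x, (x = 0 ∨ x = ℓ) → HasTrace (U i.castSucc) x 0 := by
  have hc : ∀ i : ℕ, Continuous (iteratedDeriv i φ) := fun i =>
    hs.continuous_iteratedDeriv i (by exact_mod_cast le_top)
  have hd : ∀ (i : ℕ) x, HasDerivAt (iteratedDeriv i φ) (iteratedDeriv (i + 1) φ x) x := fun i x => by
    rw [iteratedDeriv_succ]
    exact (hs.differentiable_iteratedDeriv i (by exact_mod_cast ENat.natCast_lt_top i) x).hasDerivAt
  have m5 : MemLp (iteratedDeriv 5 φ) 2 (volume.restrict (Ioo 0 ℓ)) :=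
    memLp_of_continuousOn (hc 5).continuousOn
  obtain ⟨U, h1, h2, h3, h4⟩ := exists_chain (u := fun x (i : Fin 5) => iteratedDeriv i φ x)
    (u5 := m5.toLp _) hℓ (continuous_pi fun i => hc i) (fun i x => by simpa using hd i x)
    (ac_of_hasDerivAt (hd 4) (hc 5)) (by
      filter_upwards [m5.coeFn_toLp] with x hx
      rw [hx]; exact hd 4 x)
  refine ⟨U, Lp.ext ((h1 0).trans ?_), h3, fun i x hx => ?_⟩
  · simpa using hf.symm
  · have := h4 i x
    simpa only [trace_of_test ht hx] using this

/-- Smooth functions with compact support satisfy every boundary condition, with `p = q = 0`. -/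
theorem denseRange_emb (P : Params) (hL : 0 < P.L) : DenseRange P.emb := by
  have h := ((dense_test P.L).prod (dense_test P.L)).prod (dense_test 1)
  refine h.mono ?_
  rintro ⟨⟨f, g⟩, w⟩ ⟨⟨⟨φ, a1, a2, a3, a4⟩, ⟨ψ, b1, b2, b3, b4⟩⟩, ⟨θ, c1, c2, c3, c4⟩⟩
  obtain ⟨η, η0, ηd, ηt⟩ := exists_chain_of_test hL.le a1 a3 a4
  obtain ⟨ω, ω0, ωd, ωt⟩ := exists_chain_of_test hL.le b1 b3 b4
  obtain ⟨z, z0, zd, zt⟩ := exists_chain_of_test zero_le_one c1 c3 c4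
  refine ⟨⟨(η, ω, fun i => z (i.castLE (by norm_num))), 0, 0, ?_⟩, ?_⟩
  · exact
    { η_deriv := ηd
      ω_deriv := ωd
      z_deriv := zd 0
      η_zero := ηt 0 _ (Or.inl rfl)
      η_L := ηt 0 _ (Or.inr rfl)
      ηx_zero := ηt 1 _ (Or.inl rfl)
      ηx_L := ηt 1 _ (Or.inr rfl)
      ω_zero := ωt 0 _ (Or.inl rfl)
      ω_L := ωt 0 _ (Or.inr rfl)
      ωx_zero := ωt 1 _ (Or.inl rfl)
      ωx_L := ωt 1 _ (Or.inr rfl)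
      ηxx_zero := ηt 2 _ (Or.inl rfl)
      ηxx_L := ηt 2 _ (Or.inr rfl)
      z_zero := zt 0 _ (Or.inl rfl)
      z_one := zt 0 _ (Or.inr rfl)
      ωxx_L := by simpa using ωt 2 _ (Or.inr rfl) }
  · rw [emb_apply]
    simp [η0, ω0, z0]

end Params

section Trajectory

variable {V : Type*} [NormedAddCommGroup V] [NormedSpace ℝ V] [CompleteSpace V]

/-- The solution of `Y' = B Y + F'`, `Y(0) = c + F(0)`. -/
def traj (B : V →L[ℝ] V) (F : ℝ → V) (c : V) (x : ℝ) : V := duhamel B F c x + F x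

theorem continuous_traj (B : V →L[ℝ] V) {F : ℝ → V} (hF : Continuous F) (c : V) :
    Continuous (traj B F c) :=
  (continuous_iff_continuousAt.mpr fun x => (hasDerivAt_duhamel B hF c x).continuousAt).add hF

/-- The forcing of the fifth derivative is merely `L²`. Subtracting its primitive `F` leaves a `C¹`
solution of an ODE with continuous right-hand side, and `F` enters only the fourth-derivative slot.
All lower derivatives are thus classical, and the fourth one is absolutely continuous. -/
theorem exists_chain_of_traj {ℓ : ℝ} (hℓ : 0 ≤ ℓ) (B : V →L[ℝ] V) {F : ℝ → V} (hF : Continuous F)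
    (c : V) (π : V →L[ℝ] (Fin 5 → ℝ)) {g : L2 ℓ} {κ : ℝ}
    (hB : ∀ y (i : Fin 4), π (B y) i.castSucc = π y i.succ)
    (hπ : ∀ x, π (F x) = Pi.single 4 (κ * prim g x)) :
    ∃ U : Fin 6 → L2 ℓ,
      (∀ i : Fin 5, U i.castSucc =ᵐ[volume.restrict (Ioo 0 ℓ)] fun x => π (traj B F c x) i) ∧
      (U 5 =ᵐ[volume.restrict (Ioo 0 ℓ)] fun x => π (B (traj B F c x)) 4 + κ * g x) ∧
      (∀ i : Fin 5, HasWeakDeriv (U i.castSucc) (U i.succ)) ∧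
      ∀ (i : Fin 5) x, HasTrace (U i.castSucc) x (π (traj B F c x) i) := by
  have hcY := continuous_traj B hF c
  have hcB : ∀ i, Continuous fun x => π (B (traj B F c x)) i := fun i =>
    (continuous_apply i).comp (π.continuous.comp (B.continuous.comp hcY))
  have hd : ∀ i x, HasDerivAt (fun y => π (duhamel B F c y) i) (π (B (traj B F c x)) i) x := by
    intro i x
    exact hasDerivAt_pi.mp (π.hasFDerivAt.comp_hasDerivAt x (hasDerivAt_duhamel B hF c x)) i
  have m : MemLp (fun x => π (B (traj B F c x)) 4) 2 (volume.restrict (Ioo 0 ℓ)) :=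
    memLp_of_continuousOn (hcB 4).continuousOn
  have e5 : (m.toLp _ + κ • g : L2 ℓ) =ᵐ[volume.restrict (Ioo 0 ℓ)]
      fun x => π (B (traj B F c x)) 4 + κ * g x := by
    filter_upwards [Lp.coeFn_add (m.toLp _) (κ • g), m.coeFn_toLp, Lp.coeFn_smul κ g]
      with x h1 h2 h3
    rw [h1, Pi.add_apply, h2, h3]; rfl
  have es : ∀ i : Fin 5, (fun y => π (traj B F c y) i)
      = fun y => π (duhamel B F c y) i + (Pi.single 4 (κ * prim g y) : Fin 5 → ℝ) i := by
    intro i; funext y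
    rw [← hπ, traj, map_add]; rfl
  obtain ⟨U, h1, h2, h3, h4⟩ := exists_chain (u := fun x => π (traj B F c x))
    (u5 := m.toLp _ + κ • g) hℓ (π.continuous.comp hcY) (fun i x => by
      rw [es, ← hB]
      have : (fun y => π (duhamel B F c y) i.castSucc
          + (Pi.single 4 (κ * prim g y) : Fin 5 → ℝ) i.castSucc)
          = fun y => π (duhamel B F c y) i.castSucc := by
        funext y
        have hne : i.castSucc ≠ (4 : Fin 5) := (Fin.castSucc_lt_last i).ne
        rw [Pi.single_eq_of_ne hne, add_zero]
      rw [this]; exact hd _ x)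
    (by
      rw [es]
      simp only [Pi.single_eq_same]
      exact (ac_of_hasDerivAt (hd 4) (hcB 4)).add ((ac_prim g).const_mul κ))
    (by
      rw [es]
      simp only [Pi.single_eq_same]
      filter_upwards [hasDerivAt_prim hℓ g, e5] with x hx hx5
      rw [hx5]
      exact (hd 4 x).add (hx.const_mul κ))
  exact ⟨U, h1, h2 ▸ e5, h3, h4⟩

theorem exists_weakDeriv_of_traj {ℓ : ℝ} (hℓ : 0 ≤ ℓ) (θ : ℝ) (h : L2 ℓ) (p : ℝ) :
    ∃ z : L2 ℓ, HasWeakDeriv z (θ • (h - z)) ∧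
      ∀ x, HasTrace z x (traj (-θ • ContinuousLinearMap.id ℝ ℝ) (fun x => θ * prim h x) p x) := by
  set B : ℝ →L[ℝ] ℝ := -θ • ContinuousLinearMap.id ℝ ℝ with hB
  have hF : Continuous fun x => θ * prim h x := continuous_const.mul (continuous_prim h)
  have hcY := continuous_traj B hF p
  have m : MemLp (traj B (fun x => θ * prim h x) p) 2 (volume.restrict (Ioo 0 ℓ)) :=
    memLp_of_continuousOn hcY.continuousOn
  have hd := hasDerivAt_duhamel B hF p
  refine ⟨m.toLp _, IsRep.hasWeakDeriv (F := traj B (fun x => θ * prim h x) p) hℓ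
    ⟨(ac_of_hasDerivAt hd (B.continuous.comp hcY)).add ((ac_prim h).const_mul θ),
      m.coeFn_toLp, ?_⟩, fun x => ⟨_, hcY.continuousOn, m.coeFn_toLp, rfl⟩⟩
  filter_upwards [hasDerivAt_prim hℓ h, Lp.coeFn_smul θ (h - m.toLp _), Lp.coeFn_sub h (m.toLp _),
    m.coeFn_toLp] with x h1 h2 h3 h4
  rw [h2, Pi.smul_apply, h3, Pi.sub_apply, h4]
  refine ((hd x).add (h1.const_mul θ)).congr_deriv ?_
  simp only [hB, traj, smul_apply, ContinuousLinearMap.id_apply, smul_eq_mul]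
  ring

end Trajectory

/-! ### The resolvent equation as a boundary value problem for an ODE. -/

namespace Params

/-- The phase space of the resolvent equation. -/
abbrev Phase : Type := (Fin 5 → ℝ) × (Fin 5 → ℝ)

/-- One half of the first order system of the resolvent equation. -/
def row (P : Params) (r : ℝ) (u v : Fin 5 → ℝ) : Fin 5 → ℝ :=
  ![u 1, u 2, u 3, u 4, -(v 0 / r + u 1 + P.a * u 3) / P.a₁]

/-- The first order system of the resolvent equation. -/
def sysOp (P : Params) (r : ℝ) : Phase →L[ℝ] Phase :=
  LinearMap.toContinuousLinearMap
    { toFun := fun y => (P.row r y.1 y.2, P.row r y.2 y.1)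
      map_add' := fun y y' => by
        ext i <;> fin_cases i <;> simp [row] <;> ring
      map_smul' := fun c y => by
        ext i <;> fin_cases i <;> simp [row] <;> ring }

/-- The forcing term of the resolvent equation. -/
def force (P : Params) (r : ℝ) (f g : L2 P.L) (x : ℝ) : Phase :=
  (Pi.single 4 (1 / (r * P.a₁) * prim g x), Pi.single 4 (1 / (r * P.a₁) * prim f x))

theorem continuous_force (P : Params) (r : ℝ) (f g : L2 P.L) : Continuous (P.force r f g) :=
  ((continuous_single 4).comp (continuous_const.mul (continuous_prim g))).prodMk
    ((continuous_single 4).comp (continuous_const.mul (continuous_prim f)))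

theorem force_zero (P : Params) (r : ℝ) : P.force r 0 0 = 0 := by
  funext x
  simp [force, prim_zero_right]

/-- The value at `1` of the delay line with input `p`. -/
def outflow (θ : ℝ) (h : L2 1) (p : ℝ) : ℝ :=
  traj (-θ • ContinuousLinearMap.id ℝ ℝ) (fun x => θ * prim h x) p 1

theorem outflow_eq (θ : ℝ) (h : L2 1) (p : ℝ) :
    outflow θ h p = NormedSpace.exp ((1 : ℝ) • (-θ • ContinuousLinearMap.id ℝ ℝ)) p
      + outflow θ h 0 := by
  simp only [outflow, traj]
  rw [duhamel_eq, add_assoc]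

theorem outflow_zero (θ : ℝ) (p : ℝ) :
    outflow θ 0 p = NormedSpace.exp ((1 : ℝ) • (-θ • ContinuousLinearMap.id ℝ ℝ)) p := by
  have : (fun x => θ * prim (0 : L2 1) x) = 0 := by funext x; simp [prim_zero_right]
  rw [outflow, traj, this, duhamel_zero_forcing]
  simp [prim_zero_right]

/-- The boundary conditions, with `e` for the transfer factor of the delay line. -/
def bc (P : Params) (e : ℝ →L[ℝ] ℝ) : Phase × Phase →ₗ[ℝ] Phase where
  toFun y := (![y.1.1 0, y.1.1 1, y.1.1 2, y.2.1 0, y.2.1 1],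
    ![y.1.2 0, y.1.2 1, y.2.2 0, y.2.2 1, y.2.2 2 - P.α * y.2.1 2 - P.β * e (y.2.1 2)])
  map_add' y y' := by
    ext i <;> fin_cases i <;> simp; ring
  map_smul' c y := by
    ext i <;> fin_cases i <;> simp [-smul_eq_mul]; simp; ring

/-- The delay line decouples: its resolvent equation `z_ρ = (σ/r)(h - z)` is solved from `z(0) =
ηₓₓ(L)`, and its value at `1` enters the feedback condition only as a number. What remains is the
ODE for `(η, ω)` with ten scalar conditions. -/
theorem exists_dom_of_bc {P : Params} (hL : 0 < P.L) (ha₁ : P.a₁ ≠ 0) {σ r : ℝ} (hσ : σ ≠ 0)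
    (hr : r ≠ 0) (f g : L2 P.L) (h : L2 1) (c : Phase) {Y : ℝ → Phase}
    (hY : Y = traj (P.sysOp r) (P.force r f g) c)
    (h1 : (Y 0).1 0 = 0) (h2 : (Y 0).1 1 = 0) (h3 : (Y 0).1 2 = 0) (h4 : (Y P.L).1 0 = 0)
    (h5 : (Y P.L).1 1 = 0) (h6 : (Y 0).2 0 = 0) (h7 : (Y 0).2 1 = 0) (h8 : (Y P.L).2 0 = 0)
    (h9 : (Y P.L).2 1 = 0)
    (h10 : (Y P.L).2 2 = P.α * (Y P.L).1 2 + P.β * outflow (σ / r) h ((Y P.L).1 2)) :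
    ∃ k : P.dom, (P.emb - r • P.frozen σ) k = ((f, g), h) ∧
      (∀ i : Fin 5, (k : P.Tuple).1 i.castSucc
        =ᵐ[volume.restrict (Ioo 0 P.L)] fun x => (Y x).1 i) ∧
      ∀ i : Fin 5, (k : P.Tuple).2.1 i.castSucc
        =ᵐ[volume.restrict (Ioo 0 P.L)] fun x => (Y x).2 i := by
  have hrow : ∀ (u v : Fin 5 → ℝ) (i : Fin 4), P.row r u v i.castSucc = u i.succ := by
    intro u v i
    fin_cases i <;> rfl
  obtain ⟨η, η1, η5, ηd, ηt⟩ := exists_chain_of_traj hL.le (P.sysOp r) (P.continuous_force r f g) c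
    (ContinuousLinearMap.fst ℝ (Fin 5 → ℝ) (Fin 5 → ℝ)) (g := g) (κ := 1 / (r * P.a₁))
    (fun y i => hrow _ _ i) (fun x => rfl)
  obtain ⟨ω, ω1, ω5, ωd, ωt⟩ := exists_chain_of_traj hL.le (P.sysOp r) (P.continuous_force r f g) c
    (ContinuousLinearMap.snd ℝ (Fin 5 → ℝ) (Fin 5 → ℝ)) (g := f) (κ := 1 / (r * P.a₁))
    (fun y i => hrow _ _ i) (fun x => rfl)
  rw [← hY] at η1 η5 ηt ω1 ω5 ωt
  obtain ⟨z, zd, zt⟩ := exists_weakDeriv_of_traj zero_le_one (σ / r) h ((Y P.L).1 2)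
  have t0 := zt 0
  rw [traj, duhamel_zero] at t0
  have key : ∀ {u v : Fin 6 → L2 P.L} {w : L2 P.L} {y : ℝ → Phase} {π π' : Phase → Fin 5 → ℝ},
      (∀ i : Fin 5, u i.castSucc =ᵐ[volume.restrict (Ioo 0 P.L)] fun x => π (y x) i) →
      (∀ i : Fin 5, v i.castSucc =ᵐ[volume.restrict (Ioo 0 P.L)] fun x => π' (y x) i) →
      (u 5 =ᵐ[volume.restrict (Ioo 0 P.L)]
        fun x => P.row r (π (y x)) (π' (y x)) 4 + 1 / (r * P.a₁) * w x) →
      v 0 - r • (-u 1 - P.a • u 3 - P.a₁ • u 5) = w := by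
    intro u v w y π π' hu hv h5
    have e : r • (-u 1 - P.a • u 3 - P.a₁ • u 5)
        = (-r) • u 1 + (-(r * P.a)) • u 3 + (-(r * P.a₁)) • u 5 := by module
    rw [e]
    refine Lp.ext ?_
    filter_upwards [hu 1, hu 3, hv 0, h5, Lp.coeFn_sub (v 0)
      ((-r) • u 1 + (-(r * P.a)) • u 3 + (-(r * P.a₁)) • u 5),
      Lp.coeFn_add ((-r) • u 1 + (-(r * P.a)) • u 3) ((-(r * P.a₁)) • u 5),
      Lp.coeFn_add ((-r) • u 1) ((-(r * P.a)) • u 3), Lp.coeFn_smul (-r) (u 1),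
      Lp.coeFn_smul (-(r * P.a)) (u 3), Lp.coeFn_smul (-(r * P.a₁)) (u 5)]
      with x x1 x2 x3 x4 x5 x6 x7 x8 x9 x10
    simp only [Fin.reduceCastSucc, Fin.castSucc_zero] at x1 x2 x3
    rw [x5, Pi.sub_apply, x6, Pi.add_apply, x7, Pi.add_apply, x8, x9, x10, Pi.smul_apply,
      Pi.smul_apply, Pi.smul_apply, x1, x2, x3, x4]
    simp only [row, smul_eq_mul, Matrix.cons_val]
    field_simp
    ring
  refine ⟨⟨(η, ω, ![z, (σ / r) • (h - z)]), (Y P.L).1 2, outflow (σ / r) h ((Y P.L).1 2), ?_⟩,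
    ?_, η1, ω1⟩
  · have a1 := ηt 0 0
    have a2 := ηt 0 P.L
    have a3 := ηt 1 0
    have a4 := ηt 1 P.L
    have a5 := ηt 2 0
    have b1 := ωt 0 0
    have b2 := ωt 0 P.L
    have b3 := ωt 1 0
    have b4 := ωt 1 P.L
    have b5 := ωt 2 P.L
    simp only [ContinuousLinearMap.coe_fst', ContinuousLinearMap.coe_snd',
      h1, h2, h3, h4, h5, h6, h7, h8, h9, h10] at a1 a2 a3 a4 a5 b1 b2 b3 b4 b5
    exact
    { η_deriv := ηd
      ω_deriv := ωd
      z_deriv := zd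
      η_zero := a1
      η_L := a2
      ηx_zero := a3
      ηx_L := a4
      ω_zero := b1
      ω_L := b2
      ωx_zero := b3
      ωx_L := b4
      ηxx_zero := a5
      ηxx_L := ηt 2 P.L
      z_zero := by simpa [prim] using t0
      z_one := zt 1
      ωxx_L := b5 }
  · rw [sub_apply, smul_apply, emb_apply, frozen_apply]
    simp only [Prod.smul_mk, Prod.mk_sub_mk, Matrix.cons_val_zero, Matrix.cons_val_one]
    rw [key (π := Prod.snd) (π' := Prod.fst) ω1 η1 ω5, key (π := Prod.fst) (π' := Prod.snd) η1 ω1 η5,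
      smul_smul, smul_smul]
    have : r * -(1 / σ) * (σ / r) = -1 := by field_simp
    rw [this]
    simp

/-- Fredholm alternative in dimension ten. The map from the initial vector of the homogeneous ODE to
its ten boundary values is injective, since a kernel vector yields a kernel element of the resolvent
operator, excluded by dissipativity; hence it is surjective. -/
theorem Admissible.surjective_resolvent {P : Params} (hP : P.Admissible) {σ r : ℝ} (hσ : 0 < σ)
    (hr : 0 < r) : Function.Surjective (P.emb - r • P.frozen σ) := by
  set e := NormedSpace.exp ((1 : ℝ) • (-(σ / r) • ContinuousLinearMap.id ℝ ℝ)) with he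
  set S := NormedSpace.exp (P.L • P.sysOp r) with hS
  let N : Phase →ₗ[ℝ] Phase := (P.bc e).comp
    (LinearMap.prod LinearMap.id (S : Phase →L[ℝ] Phase).toLinearMap)
  have hN : ∀ c, N c = P.bc e (c, S c) := fun c => rfl
  have hinj : Function.Injective N := by
    rw [injective_iff_map_eq_zero]
    intro c hc
    rw [hN] at hc
    have hY : ∀ x, traj (P.sysOp r) (P.force r 0 0) c x = NormedSpace.exp (x • P.sysOp r) c := by
      intro x
      rw [force_zero, traj, duhamel_zero_forcing]; simp
    have hY0 : traj (P.sysOp r) (P.force r 0 0) c 0 = c := by rw [hY]; simp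
    have hYL : traj (P.sysOp r) (P.force r 0 0) c P.L = S c := hY _
    have hc1 := congrFun (congrArg Prod.fst hc)
    have hc2 := congrFun (congrArg Prod.snd hc)
    obtain ⟨k, hk, k1, k2⟩ := exists_dom_of_bc (σ := σ) hP.L_pos hP.a₁_pos.ne' hσ.ne' hr.ne' 0 0 0 c rfl
      (by rw [hY0]; exact hc1 0) (by rw [hY0]; exact hc1 1) (by rw [hY0]; exact hc1 2)
      (by rw [hYL]; exact hc1 3) (by rw [hYL]; exact hc1 4) (by rw [hY0]; exact hc2 0)
      (by rw [hY0]; exact hc2 1) (by rw [hYL]; exact hc2 2) (by rw [hYL]; exact hc2 3)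
      (by
        rw [hYL, outflow_zero]
        have h4 : (S c).2 2 - P.α * (S c).1 2 - P.β * e ((S c).1 2) = 0 := hc2 4
        linarith)
    have hk0 : k = 0 := (hP.dissipative_frozen hσ).injective_sub hr (hk.trans (map_zero _).symm)
    have hcY := continuous_traj (P.sysOp r) (P.continuous_force r 0 0) c
    have z1 : ∀ i, c.1 i = 0 := fun i => by
      have h1 := k1 i
      rw [hk0] at h1
      have h2 := eqOn_of_ae_eq hP.L_pos (continuousOn_const (c := (0 : ℝ)))
        ((continuous_apply i).comp (continuous_fst.comp hcY)).continuousOn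
        ((Lp.coeFn_zero ℝ 2 (volume.restrict (Ioo 0 P.L))).symm.trans h1) ⟨le_rfl, hP.L_pos.le⟩
      simp only [Function.comp_apply, hY0] at h2
      exact h2.symm
    have z2 : ∀ i, c.2 i = 0 := fun i => by
      have h1 := k2 i
      rw [hk0] at h1
      have h2 := eqOn_of_ae_eq hP.L_pos (continuousOn_const (c := (0 : ℝ)))
        ((continuous_apply i).comp (continuous_snd.comp hcY)).continuousOn
        ((Lp.coeFn_zero ℝ 2 (volume.restrict (Ioo 0 P.L))).symm.trans h1) ⟨le_rfl, hP.L_pos.le⟩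
      simp only [Function.comp_apply, hY0] at h2
      exact h2.symm
    exact Prod.ext (funext z1) (funext z2)
  have hsurj := LinearMap.injective_iff_surjective.mp hinj
  rintro ⟨⟨f, g⟩, h⟩
  -- A particular solution with the initial parameter `0`. A homogeneous solution with initial
  -- vector `c` is then added to correct its boundary values, including the part of the outflow that
  -- is due to `h` alone.
  set Yp := traj (P.sysOp r) (P.force r f g) 0 with hYp
  obtain ⟨c, hc⟩ := hsurj ((0, ![0, 0, 0, 0, P.β * outflow (σ / r) h 0]) - P.bc e (Yp 0, Yp P.L))
  set Y := traj (P.sysOp r) (P.force r f g) c with hYdef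
  have hY : ∀ x, Y x = NormedSpace.exp (x • P.sysOp r) c + Yp x := fun x => by
    rw [hYdef, hYp, traj, traj, duhamel_eq, add_assoc]
  have hbc : P.bc e (Y 0, Y P.L) = (0, ![0, 0, 0, 0, P.β * outflow (σ / r) h 0]) := by
    rw [hN, eq_sub_iff_add_eq, ← map_add] at hc
    rw [← hc]
    congr 1
    simp [hY, hS]
  have hc1 := congrFun (congrArg Prod.fst hbc)
  have hc2 := congrFun (congrArg Prod.snd hbc)
  obtain ⟨k, hk, -, -⟩ := exists_dom_of_bc (σ := σ) hP.L_pos hP.a₁_pos.ne' hσ.ne' hr.ne' f g h c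
    hYdef (hc1 0) (hc1 1) (hc1 2) (hc1 3) (hc1 4) (hc2 0) (hc2 1) (hc2 2) (hc2 3)
    (by
      rw [outflow_eq]
      have h4 : (Y P.L).2 2 - P.α * (Y P.L).1 2 - P.β * e ((Y P.L).1 2)
        = P.β * outflow (σ / r) h 0 := hc2 4
      linarith)
  exact ⟨k, hk⟩

theorem Admissible.mDissipative_frozen {P : Params} (hP : P.Admissible) {σ : ℝ} (hσ : 0 < σ) :
    MDissipative P.emb (P.frozen σ) (P.form ((|P.β| + P.gap) * σ))
      (min 1 ((|P.β| + P.gap) * σ)) where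
  toDissipative := hP.dissipative_frozen hσ
  dense := P.denseRange_emb hP.L_pos
  surj _ hr := hP.surjective_resolvent hσ hr

/-- Classical solutions of the system with a constant delay. -/
theorem Admissible.exists_frozen_solution {P : Params} (hP : P.Admissible) {σ T : ℝ} (hσ : 0 < σ)
    (hT : 0 ≤ T) (k₀ : P.dom) : ∃ k : ℝ → P.dom, ContinuousOn k (Icc 0 T) ∧ k 0 = k₀ ∧
      ∀ t ∈ Icc 0 T, HasDerivWithinAt (fun s => P.emb (k s)) (P.frozen σ (k t)) (Icc 0 T) t := by
  have : CompleteSpace P.dom := (P.isClosed_dom hP.L_pos).completeSpace_coe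
  exact (hP.mDissipative_frozen hσ).exists_solution hT k₀

end Params

/-! ### Curves in `L²(0,1)` given by functions of two variables. -/

open Classical in
/-- The class of a square integrable function on `(0,ℓ)` (and `0` for other functions). -/
def toL2 (ℓ : ℝ) (f : ℝ → ℝ) : L2 ℓ :=
  if h : MemLp f 2 (volume.restrict (Ioo 0 ℓ)) then h.toLp f else 0

theorem coeFn_toL2 {ℓ : ℝ} {f : ℝ → ℝ} (h : MemLp f 2 (volume.restrict (Ioo 0 ℓ))) :
    toL2 ℓ f =ᵐ[volume.restrict (Ioo 0 ℓ)] f := by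
  rw [toL2, dif_pos h]; exact h.coeFn_toLp

theorem norm_le_of_ae {f : L2 1} {C : ℝ} (hC : 0 ≤ C)
    (h : ∀ᵐ x ∂volume.restrict (Ioo (0 : ℝ) 1), ‖f x‖ ≤ C) : ‖f‖ ≤ C := by
  have := Lp.norm_le_of_ae_bound hC h
  have h1 : measureUnivNNReal (volume.restrict (Ioo (0 : ℝ) 1)) = 1 := by
    rw [measureUnivNNReal]; simp
  simpa [h1] using this

theorem continuousOn_toL2 {h : ℝ} {f : ℝ → ℝ → ℝ}
    (hf : ContinuousOn (Function.uncurry f) (Icc 0 h ×ˢ Icc 0 1)) :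
    ContinuousOn (fun t => toL2 1 (f t)) (Icc 0 h) := by
  have hu := (isCompact_Icc.prod isCompact_Icc).uniformContinuousOn_of_continuous hf
  rw [Metric.uniformContinuousOn_iff] at hu
  have hm : ∀ t ∈ Icc 0 h, MemLp (f t) 2 (volume.restrict (Ioo 0 1)) := fun t ht =>
    memLp_of_continuousOn (hf.comp (f := fun ρ => (t, ρ)) (by fun_prop) fun ρ hρ => ⟨ht, hρ⟩)
  rw [Metric.continuousOn_iff]
  intro t ht ε hε
  obtain ⟨δ, hδ, H⟩ := hu (ε / 2) (by positivity)
  refine ⟨δ, hδ, fun s hs hst => ?_⟩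
  rw [dist_eq_norm]
  refine (norm_le_of_ae (C := ε / 2) (by positivity) ?_).trans_lt (by linarith)
  filter_upwards [Lp.coeFn_sub (toL2 1 (f s)) (toL2 1 (f t)), coeFn_toL2 (hm s hs),
    coeFn_toL2 (hm t ht), ae_restrict_mem measurableSet_Ioo] with ρ h1 h2 h3 hρ
  rw [h1, Pi.sub_apply, h2, h3, ← dist_eq_norm]
  exact (H (s, ρ) ⟨hs, Ioo_subset_Icc_self hρ⟩ (t, ρ) ⟨ht, Ioo_subset_Icc_self hρ⟩
    (by simpa [Prod.dist_eq] using hst)).le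

/-- For fixed `ρ` the mean value inequality bounds the remainder by the oscillation of `g` in time.
This oscillation is uniform in `ρ` because `g` is uniformly continuous on the compact rectangle. -/
theorem hasDerivWithinAt_toL2 {h : ℝ} {f g : ℝ → ℝ → ℝ}
    (hf : ∀ t ∈ Icc 0 h, ContinuousOn (f t) (Icc 0 1))
    (hg : ContinuousOn (Function.uncurry g) (Icc 0 h ×ˢ Icc 0 1))
    (hd : ∀ t ∈ Icc 0 h, ∀ ρ ∈ Icc (0 : ℝ) 1, HasDerivWithinAt (fun s => f s ρ) (g t ρ) (Icc 0 h) t)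
    {t : ℝ} (ht : t ∈ Icc 0 h) :
    HasDerivWithinAt (fun s => toL2 1 (f s)) (toL2 1 (g t)) (Icc 0 h) t := by
  have hu := (isCompact_Icc.prod isCompact_Icc).uniformContinuousOn_of_continuous hg
  rw [Metric.uniformContinuousOn_iff] at hu
  have hm : ∀ t ∈ Icc 0 h, MemLp (f t) 2 (volume.restrict (Ioo 0 1)) := fun t ht =>
    memLp_of_continuousOn (hf t ht)
  have hmg : MemLp (g t) 2 (volume.restrict (Ioo 0 1)) :=
    memLp_of_continuousOn (hg.comp (f := fun ρ => (t, ρ)) (by fun_prop) fun ρ hρ => ⟨ht, hρ⟩)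
  rw [hasDerivWithinAt_iff_isLittleO, Asymptotics.isLittleO_iff]
  intro ε hε
  obtain ⟨δ, hδ, H⟩ := hu ε hε
  filter_upwards [self_mem_nhdsWithin, mem_nhdsWithin_of_mem_nhds (Metric.ball_mem_nhds t hδ)]
    with s hs hst
  refine norm_le_of_ae (by positivity) ?_
  filter_upwards [Lp.coeFn_sub (toL2 1 (f s) - toL2 1 (f t)) ((s - t) • toL2 1 (g t)),
    Lp.coeFn_sub (toL2 1 (f s)) (toL2 1 (f t)), Lp.coeFn_smul (s - t) (toL2 1 (g t)),
    coeFn_toL2 (hm s hs), coeFn_toL2 (hm t ht), coeFn_toL2 hmg,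
    ae_restrict_mem measurableSet_Ioo] with ρ h1 h2 h3 h4 h5 h6 hρ
  rw [h1, Pi.sub_apply, h2, Pi.sub_apply, h3, Pi.smul_apply, h4, h5, h6, smul_eq_mul]
  have hρ' := Ioo_subset_Icc_self hρ
  have key := (((convex_Icc 0 h).inter (convex_ball t δ))).norm_image_sub_le_of_norm_hasDerivWithin_le
    (f := fun x => f x ρ - x * g t ρ) (f' := fun x => g x ρ - 1 * g t ρ) (C := ε)
    (fun x hx => ((hd x hx.1 ρ hρ').mono inter_subset_left).sub
      ((hasDerivWithinAt_id x _).mul_const (g t ρ)))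
    (fun x hx => by
      rw [one_mul, ← dist_eq_norm]
      refine (H (x, ρ) ⟨hx.1, hρ'⟩ (t, ρ) ⟨ht, hρ'⟩ ?_).le
      simpa [Prod.dist_eq] using hx.2) ⟨ht, Metric.mem_ball_self hδ⟩ ⟨hs, hst⟩
  refine le_trans (le_of_eq ?_) key
  congr 1
  ring

/-! ### Affine substitutions -/

theorem map_affine {a b : ℝ} (hb : b ≠ 0) :
    Measure.map (fun x => a - b * x) volume = ENNReal.ofReal |b⁻¹| • (volume : Measure ℝ) := by
  have h1 : (fun x : ℝ => a - b * x) = (fun x => a - x) ∘ fun x => b * x := rfl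
  rw [h1, ← Measure.map_map (by fun_prop) (by fun_prop), Real.map_volume_mul_left hb,
    Measure.map_smul, (Measure.measurePreserving_sub_left volume a).map_eq]

theorem eLpNorm_affine {a b : ℝ} (hb : 0 < b) {G : ℝ → ℝ} (hG : AEStronglyMeasurable G volume) :
    eLpNorm (fun x => G (a - b * x)) 2 volume
      = ENNReal.ofReal b⁻¹ ^ (1 / 2 : ℝ) * eLpNorm G 2 volume := by
  have h1 : AEStronglyMeasurable G (Measure.map (fun x => a - b * x) volume) := by
    rw [map_affine hb.ne']; exact hG.smul_measure _
  have h2 := eLpNorm_map_measure (p := 2) h1 (by fun_prop : Measurable fun x => a - b * x).aemeasurable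
  have h3 : (fun x => G (a - b * x)) = G ∘ fun x => a - b * x := rfl
  rw [h3, ← h2, map_affine hb.ne', eLpNorm_smul_measure_of_ne_top (by norm_num), abs_of_pos (by positivity)]
  simp

theorem memLp_affine {a b : ℝ} (hb : 0 < b) {G : ℝ → ℝ} (hG : MemLp G 2 volume) :
    MemLp (fun x => G (a - b * x)) 2 volume := by
  refine ⟨?_, ?_⟩
  · have h1 : AEStronglyMeasurable G (Measure.map (fun x => a - b * x) volume) := by
      rw [map_affine hb.ne']; exact hG.1.smul_measure _
    exact h1.comp_measurable (by fun_prop)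
  · rw [eLpNorm_affine hb hG.1]
    exact ENNReal.mul_lt_top (ENNReal.rpow_lt_top_of_nonneg (by norm_num) ENNReal.ofReal_ne_top) hG.2

theorem intervalIntegrable_of_memLp {G : ℝ → ℝ} (hG : MemLp G 2 volume) (a b : ℝ) :
    IntervalIntegrable G volume a b := by
  rw [intervalIntegrable_iff]
  have : IsFiniteMeasure (volume.restrict (uIoc a b)) := ⟨by simp [uIoc]⟩
  exact (hG.restrict (uIoc a b)).integrable (by norm_num)

theorem isRep_of_integral {ℓ : ℝ} (hℓ : 0 ≤ ℓ) {f g : L2 ℓ} {F G : ℝ → ℝ} {c : ℝ}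
    (hG : IntervalIntegrable G volume 0 ℓ) (hF : ∀ x, F x = c + ∫ t in (0 : ℝ)..x, G t)
    (hf : f =ᵐ[volume.restrict (Ioo 0 ℓ)] F) (hg : g =ᵐ[volume.restrict (Ioo 0 ℓ)] G) :
    IsRep f g F := by
  obtain rfl : F = fun x => c + ∫ t in (0 : ℝ)..x, G t := funext hF
  refine ⟨?_, hf, ?_⟩
  · have h1 : AbsolutelyContinuousOnInterval (fun _ : ℝ => c) 0 ℓ :=
      (contDiff_const.contDiffOn (𝕜 := ℝ)).absolutelyContinuousOnInterval
    exact h1.add (hG.absolutelyContinuousOnInterval_intervalIntegral (c := 0) (by simp))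
  · have := (ae_restrict_iff' (μ := volume) (measurableSet_Ioo (a := 0) (b := ℓ))).mpr
      (hG.ae_hasDerivAt_integral.mono fun x hx hxm =>
        (hx (by rw [uIcc_of_le hℓ]; exact Ioo_subset_Icc_self hxm) 0 (by simp)).const_add c)
    filter_upwards [this, hg] with x h1 h2
    rw [h2]; exact h1

/-! ### Transport -/

/-- The primitive of `G` with the value `c` at `0`. -/
def primAt (G : ℝ → ℝ) (c s : ℝ) : ℝ := c + ∫ r in (0 : ℝ)..s, G r

theorem continuous_primAt {G : ℝ → ℝ} (hG : MemLp G 2 volume) (c : ℝ) :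
    Continuous (primAt G c) :=
  continuous_const.add (intervalIntegral.continuous_primitive
    (fun a b => intervalIntegrable_of_memLp hG a b) 0)

theorem primAt_affine {G : ℝ → ℝ} (hG : MemLp G 2 volume) (c a : ℝ) {b : ℝ} (hb : b ≠ 0) (x : ℝ) :
    primAt G c (a - b * x) = primAt G c a + ∫ r in (0 : ℝ)..x, -b * G (a - b * r) := by
  have h1 := fun a b => intervalIntegrable_of_memLp hG a b
  rw [intervalIntegral.integral_const_mul, intervalIntegral.integral_comp_sub_mul _ hb, mul_zero,
    sub_zero, smul_eq_mul, primAt, primAt,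
    ← intervalIntegral.integral_add_adjacent_intervals (h1 0 a) (h1 a (a - b * x)),
    intervalIntegral.integral_symm a (a - b * x)]
  field_simp
  ring

section Transport

variable {h σ : ℝ} {θ θ' : ℝ → ℝ}

/-- The transport curve of a primitive of a continuous function. -/
theorem hasDerivWithinAt_transport_of_continuous {G : ℝ → ℝ} (hGc : Continuous G)
    (hG : MemLp G 2 volume) (c : ℝ) (hσ : 0 < σ)
    (hθ : ∀ t ∈ Icc 0 h, HasDerivWithinAt θ (θ' t) (Icc 0 h) t)
    (hθ' : ContinuousOn θ' (Icc 0 h)) (hθσ : ∀ t ∈ Icc 0 h, σ ≤ θ t) {t : ℝ} (ht : t ∈ Icc 0 h) :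
    HasDerivWithinAt (fun s => toL2 1 fun ρ => primAt G c (s - θ s * ρ))
      ((θ' t / θ t) • mulX 1 (toL2 1 fun ρ => -θ t * G (t - θ t * ρ))
        - (1 / θ t) • toL2 1 fun ρ => -θ t * G (t - θ t * ρ)) (Icc 0 h) t := by
  have hθc : ContinuousOn θ (Icc 0 h) := fun t ht => (hθ t ht).continuousWithinAt
  have c1 : ContinuousOn (fun x : ℝ × ℝ => θ x.1) (Icc 0 h ×ˢ Icc 0 1) :=
    hθc.comp continuousOn_fst fun x hx => hx.1
  have c2 : ContinuousOn (fun x : ℝ × ℝ => θ' x.1) (Icc 0 h ×ˢ Icc 0 1) :=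
    hθ'.comp continuousOn_fst fun x hx => hx.1
  have hPd : ∀ s, HasDerivAt (primAt G c) (G s) s := fun s =>
    (hGc.integral_hasStrictDerivAt 0 s).hasDerivAt.const_add c
  have key := hasDerivWithinAt_toL2 (h := h) (f := fun s ρ => primAt G c (s - θ s * ρ))
    (g := fun s ρ => G (s - θ s * ρ) * (1 - θ' s * ρ))
    (fun s _ => ((continuous_primAt hG c).comp (by fun_prop)).continuousOn)
    (by
      refine ContinuousOn.mul (hGc.comp_continuousOn ?_) ?_
      · exact continuousOn_fst.sub (c1.mul continuousOn_snd)
      · exact continuousOn_const.sub (c2.mul continuousOn_snd))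
    (fun s hs ρ _ => (hPd _).comp_hasDerivWithinAt s
      ((hasDerivWithinAt_id s _).sub ((hθ s hs).mul_const ρ))) ht
  -- The time derivative `G(t - θρ)(1 - θ'ρ)` has to be recognised as `(θ'ρ - 1)/θ` times the
  -- `ρ`-derivative `-θ G(t - θρ)`.
  refine key.congr_deriv ?_
  have hpos : 0 < θ t := hσ.trans_le (hθσ t ht)
  have m : MemLp (fun ρ => -θ t * G (t - θ t * ρ)) 2 (volume.restrict (Ioo 0 1)) :=
    ((memLp_affine hpos hG).const_mul _).restrict _
  have m' : MemLp (fun ρ => G (t - θ t * ρ) * (1 - θ' t * ρ)) 2 (volume.restrict (Ioo 0 1)) :=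
    memLp_of_continuousOn (by fun_prop)
  refine Lp.ext ?_
  set w := toL2 1 fun ρ => -θ t * G (t - θ t * ρ)
  filter_upwards [coeFn_toL2 m, coeFn_toL2 m', coeFn_mulX w,
    Lp.coeFn_sub ((θ' t / θ t) • mulX 1 w) ((1 / θ t) • w), Lp.coeFn_smul (θ' t / θ t) (mulX 1 w),
    Lp.coeFn_smul (1 / θ t) w] with ρ h1 h2 h3 h4 h5 h6
  rw [h2, h4, Pi.sub_apply, h5, h6, Pi.smul_apply, Pi.smul_apply, h3, h1, smul_eq_mul, smul_eq_mul]
  field_simp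
  ring

theorem continuousOn_transport_of_continuous {G : ℝ → ℝ} (hGc : Continuous G)
    (hθc : ContinuousOn θ (Icc 0 h)) :
    ContinuousOn (fun t => toL2 1 fun ρ => -θ t * G (t - θ t * ρ)) (Icc 0 h) := by
  have c1 : ContinuousOn (fun x : ℝ × ℝ => θ x.1) (Icc 0 h ×ˢ Icc 0 1) :=
    hθc.comp continuousOn_fst fun x hx => hx.1
  exact continuousOn_toL2 (c1.neg.mul (hGc.comp_continuousOn
    (continuousOn_fst.sub (c1.mul continuousOn_snd))))

/-- Apart from the factor `b`, the bound depends only on `σ`. Approximating `G` in `L²` thus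
approximates the whole curve uniformly in time. -/
theorem norm_toL2_affine_sub_le {G G' : ℝ → ℝ} (hG : MemLp G 2 volume) (hG' : MemLp G' 2 volume)
    (hσ : 0 < σ) {a b : ℝ} (hb : σ ≤ b) :
    ‖toL2 1 (fun ρ => -b * G (a - b * ρ)) - toL2 1 (fun ρ => -b * G' (a - b * ρ))‖
      ≤ b * ((ENNReal.ofReal σ⁻¹ ^ (1 / 2 : ℝ)).toReal * (eLpNorm (G - G') 2 volume).toReal) := by
  have hbp : 0 < b := hσ.trans_le hb
  have m := fun {G : ℝ → ℝ} (hG : MemLp G 2 volume) =>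
    (((memLp_affine hbp hG (a := a)).const_mul (-b)).restrict (Ioo 0 1))
  have m2 := memLp_affine hbp (hG.sub hG') (a := a)
  rw [toL2, dif_pos (m hG), toL2, dif_pos (m hG'), ← MemLp.toLp_sub, Lp.norm_toLp]
  have e : ((fun ρ => -b * G (a - b * ρ)) - fun ρ => -b * G' (a - b * ρ))
      = (-b) • fun ρ => (G - G') (a - b * ρ) := by
    funext ρ; simp; ring
  rw [e, eLpNorm_const_smul, ENNReal.toReal_mul, toReal_enorm, norm_neg, Real.norm_of_nonneg hbp.le]
  refine mul_le_mul_of_nonneg_left ?_ hbp.le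
  rw [← ENNReal.toReal_mul]
  have h1 : ENNReal.ofReal σ⁻¹ ^ (1 / 2 : ℝ) * eLpNorm (G - G') 2 volume < ∞ :=
    ENNReal.mul_lt_top (ENNReal.rpow_lt_top_of_nonneg (by norm_num) ENNReal.ofReal_ne_top)
      (hG.sub hG').2
  refine ENNReal.toReal_mono h1.ne ?_
  calc eLpNorm (fun ρ => (G - G') (a - b * ρ)) 2 (volume.restrict (Ioo 0 1))
      ≤ eLpNorm (fun ρ => (G - G') (a - b * ρ)) 2 volume := eLpNorm_mono_measure _ Measure.restrict_le_self
    _ = ENNReal.ofReal b⁻¹ ^ (1 / 2 : ℝ) * eLpNorm (G - G') 2 volume :=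
        eLpNorm_affine hbp (hG.sub hG').1
    _ ≤ _ := by gcongr

end Transport

theorem abs_integral_le_eLpNorm {H : ℝ → ℝ} (hH : MemLp H 2 volume) (a b : ℝ) :
    |∫ x in a..b, H x| ≤ (eLpNorm H 2 volume).toReal * |b - a| ^ (1 / 2 : ℝ) := by
  have : IsFiniteMeasure (volume.restrict (uIoc a b)) := ⟨by simp [uIoc]⟩
  have h1 := intervalIntegral.norm_integral_le_integral_norm_uIoc (f := H) (a := a) (b := b) (μ := volume)
  rw [integral_norm_eq_lintegral_enorm hH.1.restrict, ← eLpNorm_one_eq_lintegral_enorm] at h1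
  refine h1.trans ?_
  have hv : (volume.restrict (uIoc a b)) univ = ENNReal.ofReal |b - a| := by
    rw [Measure.restrict_apply_univ, uIoc, Real.volume_Ioc, max_sub_min_eq_abs]
  have h2 := eLpNorm_le_eLpNorm_mul_rpow_measure_univ (p := 1) (q := 2) (by norm_num)
    (hH.1.restrict (s := uIoc a b))
  rw [hv] at h2
  have h3 := h2.trans (mul_le_mul_left (eLpNorm_mono_measure H Measure.restrict_le_self) _)
  refine (ENNReal.toReal_mono ?_ h3).trans (le_of_eq ?_)
  · exact ENNReal.mul_ne_top hH.2.ne (ENNReal.rpow_ne_top_of_nonneg (by norm_num) ENNReal.ofReal_ne_top)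
  · rw [ENNReal.toReal_mul, ← ENNReal.toReal_rpow, ENNReal.toReal_ofReal (abs_nonneg _)]
    norm_num

theorem exists_continuous_approx {G : ℝ → ℝ} (hG : MemLp G 2 volume) :
    ∃ g : ℕ → ℝ → ℝ, (∀ n, Continuous (g n)) ∧ (∀ n, MemLp (g n) 2 volume) ∧
      Tendsto (fun n => (eLpNorm (g n - G) 2 volume).toReal) atTop (𝓝 0) := by
  have h1 : ∀ n : ℕ, ∃ g : ℝ → ℝ, Continuous g ∧ MemLp g 2 volume ∧
      eLpNorm (g - G) 2 volume ≤ ENNReal.ofReal (1 / ((n : ℝ) + 1)) := fun n => by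
    obtain ⟨g, -, h2, h3, h4⟩ := hG.exists_hasCompactSupport_eLpNorm_sub_le (by norm_num)
      (ε := ENNReal.ofReal (1 / ((n : ℝ) + 1))) (by rw [Ne, ENNReal.ofReal_eq_zero, not_le]; positivity)
    exact ⟨g, h3, h4, by rwa [eLpNorm_sub_comm]⟩
  choose g hg1 hg2 hg3 using h1
  refine ⟨g, hg1, hg2, squeeze_zero (fun _ => ENNReal.toReal_nonneg) (fun n => ?_)
    tendsto_one_div_add_atTop_nhds_zero_nat⟩
  exact ENNReal.toReal_le_of_le_ofReal (by positivity) (hg3 n)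

section Transport

variable {h σ : ℝ} {θ θ' : ℝ → ℝ} {G : ℝ → ℝ}

theorem memLp_transport_deriv (hG : MemLp G 2 volume) {a b : ℝ} (hb : 0 < b) :
    MemLp (fun ρ => -b * G (a - b * ρ)) 2 (volume.restrict (Ioo 0 1)) :=
  ((memLp_affine hb hG).const_mul _).restrict _

theorem memLp_transport_prim (hG : MemLp G 2 volume) (c a b : ℝ) :
    MemLp (fun ρ => primAt G c (a - b * ρ)) 2 (volume.restrict (Ioo 0 1)) :=
  memLp_of_continuousOn ((continuous_primAt hG c).comp (by fun_prop)).continuousOn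

theorem isRep_transport (hG : MemLp G 2 volume) (c a : ℝ) {b : ℝ} (hb : 0 < b) :
    IsRep (toL2 1 fun ρ => primAt G c (a - b * ρ)) (toL2 1 fun ρ => -b * G (a - b * ρ))
      (fun ρ => primAt G c (a - b * ρ)) :=
  isRep_of_integral zero_le_one (intervalIntegrable_of_memLp ((memLp_affine hb hG).const_mul (-b)) 0 1)
    (fun x => primAt_affine hG c a hb.ne' x)
    (coeFn_toL2 (memLp_transport_prim hG c a b)) (coeFn_toL2 (memLp_transport_deriv hG hb))

theorem hasTrace_transport (hG : MemLp G 2 volume) (c a b ρ : ℝ) :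
    HasTrace (toL2 1 fun ρ => primAt G c (a - b * ρ)) ρ (primAt G c (a - b * ρ)) :=
  ⟨_, ((continuous_primAt hG c).comp (by fun_prop)).continuousOn,
    coeFn_toL2 (memLp_transport_prim hG c a b), rfl⟩

/-- A function of `t - θ(t) ρ` solves the transport equation with variable delay. Since `G` is only
square integrable, continuous `g n` are used first; the limit is licit because the velocities
converge uniformly in time. -/
theorem transport_aux (hG : MemLp G 2 volume) (c : ℝ) (hh : 0 ≤ h) (hσ : 0 < σ)
    (hθ : ∀ t ∈ Icc 0 h, HasDerivWithinAt θ (θ' t) (Icc 0 h) t)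
    (hθ' : ContinuousOn θ' (Icc 0 h)) (hθσ : ∀ t ∈ Icc 0 h, σ ≤ θ t) :
    ContinuousOn (fun t => toL2 1 fun ρ => -θ t * G (t - θ t * ρ)) (Icc 0 h) ∧
    ∀ t ∈ Icc 0 h, HasDerivWithinAt (fun s => toL2 1 fun ρ => primAt G c (s - θ s * ρ))
      ((θ' t / θ t) • mulX 1 (toL2 1 fun ρ => -θ t * G (t - θ t * ρ))
        - (1 / θ t) • toL2 1 fun ρ => -θ t * G (t - θ t * ρ)) (Icc 0 h) t := by
  have hθc : ContinuousOn θ (Icc 0 h) := fun t ht => (hθ t ht).continuousWithinAt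
  obtain ⟨B, hB⟩ := isCompact_Icc.exists_bound_of_continuousOn hθc
  obtain ⟨g, hg1, hg2, hg3⟩ := exists_continuous_approx hG
  have hpos : ∀ t ∈ Icc 0 h, 0 < θ t := fun t ht => hσ.trans_le (hθσ t ht)
  have hB0 : 0 ≤ B := (norm_nonneg _).trans (hB 0 ⟨le_rfl, hh⟩)
  set K : ℝ := (ENNReal.ofReal σ⁻¹ ^ (1 / 2 : ℝ)).toReal with hK
  have e1 : Tendsto (fun n => B * (K * (eLpNorm (g n - G) 2 volume).toReal)) atTop (𝓝 0) := by
    simpa using (hg3.const_mul K).const_mul B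
  have hw : TendstoUniformlyOn (fun n t => toL2 1 fun ρ => -θ t * g n (t - θ t * ρ))
      (fun t => toL2 1 fun ρ => -θ t * G (t - θ t * ρ)) atTop (Icc 0 h) := by
    rw [Metric.tendstoUniformlyOn_iff]
    intro ε hε
    filter_upwards [e1.eventually (gt_mem_nhds hε)] with n hn t ht
    rw [dist_comm, dist_eq_norm]
    refine ((norm_toL2_affine_sub_le (hg2 n) hG hσ (hθσ t ht)).trans ?_).trans_lt hn
    exact mul_le_mul_of_nonneg_right ((le_abs_self _).trans (hB t ht)) (by positivity)
  have hcont := hw.continuousOn (Frequently.of_forall fun n =>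
    continuousOn_transport_of_continuous (hg1 n) hθc)
  refine ⟨hcont, fun t ht => ?_⟩
  obtain ⟨D, hD⟩ := isCompact_Icc.exists_bound_of_continuousOn
    (hθ'.div hθc fun t ht => (hpos t ht).ne')
  have hcoef : ∀ t ∈ Icc 0 h, ∀ w : L2 1, ‖(θ' t / θ t) • mulX 1 w - (1 / θ t) • w‖
      ≤ (D + 1 / σ) * ‖w‖ := fun t ht w => by
    have m1 : ‖mulX 1 w‖ ≤ ‖w‖ := by simpa using norm_mulX_le w
    calc _ ≤ ‖(θ' t / θ t) • mulX 1 w‖ + ‖(1 / θ t) • w‖ := norm_sub_le _ _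
      _ ≤ D * ‖w‖ + 1 / σ * ‖w‖ := by
        rw [norm_smul, norm_smul]
        have d1 : ‖θ' t / θ t‖ ≤ D := hD t ht
        have d2 : ‖1 / θ t‖ ≤ 1 / σ := by
          rw [Real.norm_of_nonneg (by have := hpos t ht; positivity)]
          exact one_div_le_one_div_of_le hσ (hθσ t ht)
        have d3 : 0 ≤ D := (norm_nonneg _).trans d1
        gcongr
      _ = _ := by ring
  have hD0 : 0 ≤ D := (norm_nonneg _).trans (hD t ht)
  refine hasDerivWithinAt_of_tendstoUniformlyOn
    (u := fun n s => toL2 1 fun ρ => primAt (g n) c (s - θ s * ρ))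
    (v := fun n t => (θ' t / θ t) • mulX 1 (toL2 1 fun ρ => -θ t * g n (t - θ t * ρ))
        - (1 / θ t) • toL2 1 fun ρ => -θ t * g n (t - θ t * ρ))
    (v₀ := fun t => (θ' t / θ t) • mulX 1 (toL2 1 fun ρ => -θ t * G (t - θ t * ρ))
        - (1 / θ t) • toL2 1 fun ρ => -θ t * G (t - θ t * ρ))
    (fun n t ht => hasDerivWithinAt_transport_of_continuous (hg1 n) (hg2 n) c hσ hθ hθ' hθσ ht)
    (fun n => ?_) (fun t ht => ?_) ?_ ht
  · have := continuousOn_transport_of_continuous (hg1 n) hθc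
    exact ((hθ'.div hθc fun t ht => (hpos t ht).ne').smul
      ((mulX 1).continuous.comp_continuousOn this)).sub
      ((continuousOn_const.div hθc fun t ht => (hpos t ht).ne').smul this)
  · rw [tendsto_iff_norm_sub_tendsto_zero]
    have e2 : Tendsto (fun n => (eLpNorm (g n - G) 2 volume).toReal * (|t| + θ t) ^ (1 / 2 : ℝ))
      atTop (𝓝 0) := by simpa using hg3.mul_const ((|t| + θ t) ^ (1 / 2 : ℝ))
    have hp := hpos t ht
    refine squeeze_zero (fun _ => norm_nonneg _) (fun n => ?_) e2
    refine norm_le_of_ae (by positivity) ?_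
    filter_upwards [Lp.coeFn_sub (toL2 1 fun ρ => primAt (g n) c (t - θ t * ρ))
      (toL2 1 fun ρ => primAt G c (t - θ t * ρ)),
      coeFn_toL2 (memLp_transport_prim (hg2 n) c t (θ t)),
      coeFn_toL2 (memLp_transport_prim hG c t (θ t)), ae_restrict_mem measurableSet_Ioo]
      with ρ h1 h2 h3 hρ
    rw [h1, Pi.sub_apply, h2, h3, primAt, primAt, add_sub_add_left_eq_sub,
      ← intervalIntegral.integral_sub (intervalIntegrable_of_memLp (hg2 n) _ _)
        (intervalIntegrable_of_memLp hG _ _)]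
    refine (abs_integral_le_eLpNorm ((hg2 n).sub hG) _ _).trans ?_
    refine mul_le_mul_of_nonneg_left (Real.rpow_le_rpow (abs_nonneg _) ?_ (by norm_num))
      ENNReal.toReal_nonneg
    rw [sub_zero]
    refine (abs_sub _ _).trans (add_le_add_right ?_ _)
    rw [abs_mul, abs_of_pos hp, abs_of_pos hρ.1]
    nlinarith [hρ.2]
  · rw [Metric.tendstoUniformlyOn_iff] at hw ⊢
    intro ε hε
    have hpos' : 0 < D + 1 / σ := by positivity
    filter_upwards [hw (ε / (D + 1 / σ)) (by positivity)] with n hn t ht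
    rw [dist_eq_norm]
    have e : ∀ w w' : L2 1, ((θ' t / θ t) • mulX 1 w - (1 / θ t) • w)
        - ((θ' t / θ t) • mulX 1 w' - (1 / θ t) • w')
        = (θ' t / θ t) • mulX 1 (w - w') - (1 / θ t) • (w - w') := fun w w' => by
      rw [map_sub, smul_sub, smul_sub]; abel
    rw [e]
    refine (hcoef t ht _).trans_lt ?_
    have := hn t ht
    rw [dist_eq_norm, lt_div_iff₀ hpos'] at this
    linarith

end Transport

/-! ### Inflow and outflow of a delay line with constant delay. -/

theorem eqOn_of_forall_test {h : ℝ} (hh : 0 < h) {f g : ℝ → ℝ} (hf : ContinuousOn f (Icc 0 h))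
    (hg : ContinuousOn g (Icc 0 h))
    (H : ∀ χ : ℝ → ℝ, ContDiff ℝ ((⊤ : ℕ∞) : WithTop ℕ∞) χ → (∀ x, x ∉ Ioo 0 h → χ x = 0) →
      ∫ x in (0 : ℝ)..h, f x * χ x = ∫ x in (0 : ℝ)..h, g x * χ x) : EqOn f g (Icc 0 h) := by
  have hI : ∀ {f : ℝ → ℝ}, ContinuousOn f (Icc 0 h) → IntegrableOn f (Icc 0 h) :=
    fun hf => hf.integrableOn_compact isCompact_Icc
  have h1 := isOpen_Ioo.ae_eq_zero_of_integral_contDiff_smul_eq_zero (U := Ioo 0 h)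
    (f := fun x => f x - g x) (μ := volume)
    ((hI (hf.sub hg)).mono_set Ioo_subset_Icc_self).locallyIntegrableOn
    (fun χ h1 h2 h3 => by
      have hz : ∀ x, x ∉ Ioo 0 h → χ x = 0 := fun x hx => image_eq_zero_of_notMem_tsupport
        fun hx' => hx (h3 hx')
      have h4 := H χ h1 hz
      rw [← sub_eq_zero, ← intervalIntegral.integral_sub
        (f := fun x => f x * χ x) (g := fun x => g x * χ x)
        (ContinuousOn.intervalIntegrable_of_Icc hh.le (hf.mul h1.continuous.continuousOn))
        (ContinuousOn.intervalIntegrable_of_Icc hh.le (hg.mul h1.continuous.continuousOn)),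
        intervalIntegral.integral_of_le hh.le, integral_Ioc_eq_integral_Ioo] at h4
      rw [← setIntegral_eq_integral_of_forall_compl_eq_zero (s := Ioo 0 h)
        (fun x hx => by rw [hz x hx, zero_smul])]
      refine Eq.trans ?_ h4
      refine integral_congr_ae (Eventually.of_forall fun x => ?_)
      simp only [smul_eq_mul]
      ring)
  refine eqOn_of_ae_eq hh hf hg ?_
  rw [EventuallyEq, ae_restrict_iff' measurableSet_Ioo]
  exact h1.mono fun x hx hm => sub_eq_zero.mp (hx hm)

section Characteristics

variable {σ h : ℝ} {z0 z1 : ℝ → L2 1} {p q : ℝ → ℝ}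

/-- The test function `ψ(ρ - t/σ)` is itself transported, so the interior terms cancel after
integration by parts and only the two traces remain. -/
theorem inner_characteristics (hh : 0 ≤ h)
    (hd : ∀ t ∈ Icc 0 h, HasDerivWithinAt z0 (-(1 / σ) • z1 t) (Icc 0 h) t)
    (hw : ∀ t ∈ Icc 0 h, HasWeakDeriv (z0 t) (z1 t))
    (hp : ∀ t ∈ Icc 0 h, HasTrace (z0 t) 0 (p t)) (hq : ∀ t ∈ Icc 0 h, HasTrace (z0 t) 1 (q t))
    (hpc : ContinuousOn p (Icc 0 h)) (hqc : ContinuousOn q (Icc 0 h)) {ψ : ℝ → ℝ}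
    (hψ : ContDiff ℝ ((⊤ : ℕ∞) : WithTop ℕ∞) ψ) :
    inner ℝ (z0 h) (toL2 1 fun ρ => ψ (ρ - h / σ)) - inner ℝ (z0 0) (toL2 1 fun ρ => ψ (ρ - 0 / σ))
      = ∫ t in (0 : ℝ)..h, 1 / σ * (p t * ψ (0 - t / σ) - q t * ψ (1 - t / σ)) := by
  have hψc := hψ.continuous
  have hψ'c : Continuous (deriv ψ) := hψ.continuous_deriv (by simp)
  have hψd : ∀ x, HasDerivAt ψ (deriv ψ x) x := fun x =>
    (hψ.differentiable (by simp)).differentiableAt.hasDerivAt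
  have hm : ∀ t, MemLp (fun ρ => ψ (ρ - t / σ)) 2 (volume.restrict (Ioo 0 1)) := fun t =>
    memLp_of_continuousOn (by fun_prop)
  have hm' : ∀ t, MemLp (fun ρ => deriv ψ (ρ - t / σ)) 2 (volume.restrict (Ioo 0 1)) := fun t =>
    memLp_of_continuousOn (by fun_prop)
  have hm2 : ∀ t, MemLp (fun ρ => -(1 / σ) * deriv ψ (ρ - t / σ)) 2 (volume.restrict (Ioo 0 1)) :=
    fun t => (hm' t).const_mul _
  have hψw : ∀ t, HasWeakDeriv (toL2 1 fun ρ => ψ (ρ - t / σ))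
      (toL2 1 fun ρ => deriv ψ (ρ - t / σ)) := fun t => by
    refine (isRep_of_integral (F := fun ρ => ψ (ρ - t / σ)) (G := fun ρ => deriv ψ (ρ - t / σ))
      (c := ψ (0 - t / σ)) zero_le_one
      ((by fun_prop : Continuous fun ρ => deriv ψ (ρ - t / σ)).intervalIntegrable _ _)
      (fun x => ?_) (coeFn_toL2 (hm t)) (coeFn_toL2 (hm' t))).hasWeakDeriv zero_le_one
    rw [intervalIntegral.integral_eq_sub_of_hasDerivAt (f := fun ρ => ψ (ρ - t / σ))
      (fun ρ _ => (hψd _).comp_sub_const _ _)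
      ((by fun_prop : Continuous fun ρ => deriv ψ (ρ - t / σ)).intervalIntegrable _ _)]
    ring
  have hψt : ∀ t ρ, HasTrace (toL2 1 fun ρ => ψ (ρ - t / σ)) ρ (ψ (ρ - t / σ)) := fun t ρ =>
    ⟨_, (by fun_prop : Continuous fun ρ => ψ (ρ - t / σ)).continuousOn, coeFn_toL2 (hm t), rfl⟩
  have hder : ∀ t ∈ Icc 0 h, HasDerivWithinAt (fun t => toL2 1 fun ρ => ψ (ρ - t / σ))
      (-(1 / σ) • toL2 1 fun ρ => deriv ψ (ρ - t / σ)) (Icc 0 h) t := fun t ht => by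
    have := hasDerivWithinAt_toL2 (h := h) (f := fun t ρ => ψ (ρ - t / σ))
      (g := fun t ρ => -(1 / σ) * deriv ψ (ρ - t / σ)) (fun t _ => by fun_prop)
      (by simp only [Function.uncurry_def]; fun_prop)
      (fun t _ ρ _ => by
        have := (hψd (ρ - t / σ)).comp_hasDerivWithinAt t
          (((hasDerivWithinAt_id t (Icc 0 h)).div_const σ).const_sub ρ)
        exact this.congr_deriv (by ring)) ht
    refine this.congr_deriv (Lp.ext ?_)
    filter_upwards [coeFn_toL2 (hm2 t), coeFn_toL2 (hm' t),
      Lp.coeFn_smul (-(1 / σ)) (toL2 1 fun ρ => deriv ψ (ρ - t / σ))] with ρ h1 h2 h3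
    rw [h1, h3, Pi.smul_apply, h2, smul_eq_mul]
  have key := integral_eq_sub_of_hasDerivWithinAt (T := h)
    (f := fun t => (inner ℝ (z0 t) (toL2 1 fun ρ => ψ (ρ - t / σ)) : ℝ))
    (f' := fun t => 1 / σ * (p t * ψ (0 - t / σ) - q t * ψ (1 - t / σ))) (fun t ht => by
      refine ((hd t ht).inner ℝ (hder t ht)).congr_deriv ?_
      have h1 := inner_by_parts one_pos (hw t ht) (hψw t) (hp t ht) (hq t ht) (hψt t 0) (hψt t 1)
      rw [real_inner_smul_right, real_inner_smul_left]
      linear_combination (-(1 / σ)) * h1) (by fun_prop) (t := h) ⟨hh, le_rfl⟩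
  exact key.symm

/-- During half a delay a signal travels half the line: what has entered fills `(0, 1/2)` at the
end, and what leaves came from `(1/2, 1)` at the start. The proof is by duality, for the solution is
only known as a curve in `L²`. -/
theorem characteristics (hσ : 0 < σ)
    (hd : ∀ t ∈ Icc 0 (σ / 2), HasDerivWithinAt z0 (-(1 / σ) • z1 t) (Icc 0 (σ / 2)) t)
    (hw : ∀ t ∈ Icc 0 (σ / 2), HasWeakDeriv (z0 t) (z1 t))
    (hp : ∀ t ∈ Icc 0 (σ / 2), HasTrace (z0 t) 0 (p t))
    (hq : ∀ t ∈ Icc 0 (σ / 2), HasTrace (z0 t) 1 (q t))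
    (hpc : ContinuousOn p (Icc 0 (σ / 2))) (hqc : ContinuousOn q (Icc 0 (σ / 2)))
    {Z₀ Z : ℝ → ℝ} (hZ₀ : ContinuousOn Z₀ (Icc 0 1)) (hZ : ContinuousOn Z (Icc 0 1))
    (hz₀ : z0 0 =ᵐ[volume.restrict (Ioo 0 1)] Z₀)
    (hz : z0 (σ / 2) =ᵐ[volume.restrict (Ioo 0 1)] Z) :
    EqOn p (fun t => Z (1 / 2 - t / σ)) (Icc 0 (σ / 2)) ∧
      EqOn q (fun t => Z₀ (1 - t / σ)) (Icc 0 (σ / 2)) := by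
  have hh : 0 < σ / 2 := by positivity
  have hσ2 : σ / 2 / σ = 1 / 2 := by field_simp
  have dual := fun {ψ : ℝ → ℝ} (hψ : ContDiff ℝ ((⊤ : ℕ∞) : WithTop ℕ∞) ψ) =>
    inner_characteristics hh.le hd hw hp hq hpc hqc hψ
  have inner_eq : ∀ {f : L2 1} {F ψ : ℝ → ℝ}, f =ᵐ[volume.restrict (Ioo 0 1)] F → Continuous ψ →
      inner ℝ f (toL2 1 ψ) = ∫ x in Ioo 0 1, F x * ψ x := fun {f F ψ} hf hψ => by
    rw [L2.inner_eq]
    refine integral_congr_ae ?_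
    filter_upwards [hf, coeFn_toL2 (memLp_of_continuousOn hψ.continuousOn)] with x h1 h2
    rw [h1, h2]
  have e1 : ∀ t : ℝ, t / σ * σ = t := fun t => by field_simp
  constructor
  · have hsub : MapsTo (fun t => 1 / 2 - t / σ) (Icc 0 (σ / 2)) (Icc 0 1) := fun t ht => by
      have h1 : t / σ ≤ 1 / 2 := by rw [div_le_iff₀ hσ]; linarith [ht.2]
      have h2 : 0 ≤ t / σ := div_nonneg ht.1 hσ.le
      constructor <;> linarith
    refine eqOn_of_forall_test hh hpc (hZ.comp (by fun_prop) hsub) fun χ hχ hχ0 => ?_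
    -- This choice places `χ(t)` at the inflow, while the initial profile and the outflow meet `χ`
    -- only outside `(0, σ/2)`.
    have h1 := dual (ψ := fun r => χ (-(σ * r))) (hχ.comp (by fun_prop))
    have hχc := hχ.continuous
    rw [inner_eq hz (by fun_prop), inner_eq hz₀ (by fun_prop)] at h1
    have h2 : ∫ x in Ioo 0 1, Z₀ x * χ (-(σ * (x - 0 / σ))) = 0 := by
      rw [setIntegral_congr_fun (g := fun _ => 0) measurableSet_Ioo fun x hx => ?_]
      · simp
      · simp only [zero_div, sub_zero]
        rw [hχ0, mul_zero]
        rintro ⟨h3, -⟩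
        nlinarith [hx.1]
    have h3 : ∫ x in Ioo 0 1, Z x * χ (-(σ * (x - σ / 2 / σ)))
        = ∫ x in (0 : ℝ)..1 / 2, Z x * χ (-(σ * (x - 1 / 2))) := by
      rw [hσ2, intervalIntegral.integral_of_le (by norm_num), integral_Ioc_eq_integral_Ioo]
      refine setIntegral_eq_of_subset_of_forall_sdiff_eq_zero measurableSet_Ioo
        (Ioo_subset_Ioo_right (by norm_num)) fun x hx => ?_
      rw [hχ0, mul_zero]
      rintro ⟨h3, -⟩
      exact hx.2 ⟨hx.1.1, by nlinarith⟩
    have h4 := intervalIntegral.integral_comp_sub_div (a := 0) (b := σ / 2)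
      (fun x => Z x * χ (-(σ * (x - 1 / 2)))) hσ.ne' (1 / 2)
    rw [hσ2, sub_self, zero_div, sub_zero, smul_eq_mul, ← h3] at h4
    rw [h2, sub_zero, intervalIntegral.integral_const_mul] at h1
    rw [h1] at h4
    have h5 : ∫ x in (0 : ℝ)..σ / 2, Z (1 / 2 - x / σ) * χ (-(σ * (1 / 2 - x / σ - 1 / 2)))
        = ∫ x in (0 : ℝ)..σ / 2, Z (1 / 2 - x / σ) * χ x := by
      congr 1; funext x; congr 2; linear_combination e1 x
    have h6 : ∫ t in (0 : ℝ)..σ / 2, (p t * χ (-(σ * (0 - t / σ))) - q t * χ (-(σ * (1 - t / σ))))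
        = ∫ t in (0 : ℝ)..σ / 2, p t * χ t := by
      refine intervalIntegral.integral_congr fun t ht => ?_
      rw [uIcc_of_le hh.le] at ht
      have a1 : -(σ * (0 - t / σ)) = t := by linear_combination e1 t
      have a2 : -(σ * (1 - t / σ)) = t - σ := by linear_combination e1 t
      simp only [a1, a2]
      rw [hχ0 (t - σ) (fun h7 => by linarith [h7.1, ht.2]), mul_zero, sub_zero]
    rw [h5, h6] at h4
    rw [h4]
    field_simp
  · have hsub : MapsTo (fun t => 1 - t / σ) (Icc 0 (σ / 2)) (Icc 0 1) := fun t ht => by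
      have h1 : t / σ ≤ 1 / 2 := by rw [div_le_iff₀ hσ]; linarith [ht.2]
      have h2 : 0 ≤ t / σ := div_nonneg ht.1 hσ.le
      constructor <;> linarith
    refine eqOn_of_forall_test hh hqc (hZ₀.comp (by fun_prop) hsub) fun χ hχ hχ0 => ?_
    -- Here `χ(t)` sits at the outflow, while the final profile and the inflow meet `χ` only outside
    -- `(0, σ/2)`.
    have h1 := dual (ψ := fun r => χ (σ * (1 - r))) (hχ.comp (by fun_prop))
    have hχc := hχ.continuous
    rw [inner_eq hz (by fun_prop), inner_eq hz₀ (by fun_prop)] at h1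
    have h2 : ∫ x in Ioo 0 1, Z x * χ (σ * (1 - (x - σ / 2 / σ))) = 0 := by
      rw [setIntegral_congr_fun (g := fun _ => 0) measurableSet_Ioo fun x hx => ?_]
      · simp
      · simp only [hσ2]
        rw [hχ0, mul_zero]
        rintro ⟨-, h3⟩
        nlinarith [hx.2]
    have h3 : ∫ x in Ioo 0 1, Z₀ x * χ (σ * (1 - (x - 0 / σ)))
        = ∫ x in (1 / 2 : ℝ)..1, Z₀ x * χ (σ * (1 - x)) := by
      simp only [zero_div, sub_zero]
      rw [intervalIntegral.integral_of_le (by norm_num), integral_Ioc_eq_integral_Ioo]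
      refine setIntegral_eq_of_subset_of_forall_sdiff_eq_zero measurableSet_Ioo
        (Ioo_subset_Ioo_left (by norm_num)) fun x hx => ?_
      rw [hχ0, mul_zero]
      rintro ⟨-, h3⟩
      exact hx.2 ⟨by nlinarith, hx.1.2⟩
    have h4 := intervalIntegral.integral_comp_sub_div (a := 0) (b := σ / 2)
      (fun x => Z₀ x * χ (σ * (1 - x))) hσ.ne' 1
    rw [hσ2, zero_div, sub_zero, smul_eq_mul, show (1 - 1 / 2 : ℝ) = 1 / 2 by norm_num, ← h3] at h4
    rw [h2, zero_sub, intervalIntegral.integral_const_mul] at h1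
    have h5 : ∫ x in (0 : ℝ)..σ / 2, Z₀ (1 - x / σ) * χ (σ * (1 - (1 - x / σ)))
        = ∫ x in (0 : ℝ)..σ / 2, Z₀ (1 - x / σ) * χ x := by
      congr 1; funext x; congr 2; linear_combination e1 x
    have h6 : ∫ t in (0 : ℝ)..σ / 2, (p t * χ (σ * (1 - (0 - t / σ))) - q t * χ (σ * (1 - (1 - t / σ))))
        = -∫ t in (0 : ℝ)..σ / 2, q t * χ t := by
      rw [← intervalIntegral.integral_neg]
      refine intervalIntegral.integral_congr fun t ht => ?_
      rw [uIcc_of_le hh.le] at ht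
      have a1 : σ * (1 - (0 - t / σ)) = σ + t := by linear_combination e1 t
      have a2 : σ * (1 - (1 - t / σ)) = t := by linear_combination e1 t
      simp only [a1, a2]
      rw [hχ0 (σ + t) (fun h7 => by linarith [h7.2, ht.1]), mul_zero, zero_sub]
    rw [h5] at h4
    rw [h6] at h1
    rw [h4, ← neg_neg (∫ x in Ioo 0 1, Z₀ x * χ (σ * (1 - (x - 0 / σ)))), h1]
    field_simp

end Characteristics

/-- Substitution of an increasing function in a primitive of a square integrable function. -/
theorem exists_primAt_comp {h c₀ c : ℝ} (hc₀ : 0 < c₀) {γ γ' G : ℝ → ℝ} (hG : MemLp G 2 volume)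
    (hγ : ∀ t ∈ Icc 0 h, HasDerivWithinAt γ (γ' t) (Icc 0 h) t) (hγ' : ContinuousOn γ' (Icc 0 h))
    (hpos : ∀ t ∈ Icc 0 h, c₀ ≤ γ' t) :
    MemLp (fun t => γ' t * G (γ t)) 2 (volume.restrict (Icc 0 h)) ∧
    ∀ t ∈ Icc 0 h, primAt G c (γ t) = primAt G c (γ 0) + ∫ r in (0 : ℝ)..t, γ' r * G (γ r) := by
  have hγc : ContinuousOn γ (Icc 0 h) := fun t ht => (hγ t ht).continuousWithinAt
  have hmono : StrictMonoOn γ (Icc 0 h) := by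
    refine strictMonoOn_of_deriv_pos (convex_Icc 0 h) hγc fun x hx => ?_
    rw [interior_Icc] at hx
    have h1 := (hγ x (Ioo_subset_Icc_self hx)).hasDerivAt (Icc_mem_nhds hx.1 hx.2)
    rw [h1.deriv]
    exact hc₀.trans_le (hpos x (Ioo_subset_Icc_self hx))
  have himg : ∀ t ∈ Icc 0 h, γ '' Icc 0 t = Icc (γ 0) (γ t) := fun t ht => by
    have hs : Icc 0 t ⊆ Icc 0 h := Icc_subset_Icc_right ht.2
    refine Subset.antisymm ?_ (intermediate_value_Icc ht.1 (hγc.mono hs))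
    rintro _ ⟨x, hx, rfl⟩
    exact ⟨hmono.monotoneOn (hs ⟨le_rfl, ht.1⟩) (hs hx) hx.1,
      hmono.monotoneOn (hs hx) ht hx.2⟩
  have habs : ∀ t ∈ Icc 0 h, |γ' t| = γ' t := fun t ht => abs_of_pos (hc₀.trans_le (hpos t ht))
  obtain ⟨B, hB⟩ := isCompact_Icc.exists_bound_of_continuousOn hγ'
  have i1 : IntegrableOn (fun t => γ' t * G (γ t)) (Icc 0 h) := by
    rcases lt_or_ge h 0 with hh | hh
    · rw [Icc_eq_empty hh.not_ge]; exact integrableOn_empty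
    have := (integrableOn_image_iff_integrableOn_abs_deriv_smul measurableSet_Icc hγ hmono.injOn G).mp
      (by
        rw [himg h ⟨hh, le_rfl⟩]
        have : IsFiniteMeasure (volume.restrict (Icc (γ 0) (γ h))) := ⟨by simp⟩
        exact (hG.restrict _).integrable (by norm_num))
    exact this.congr_fun (fun t ht => by simp only [habs t ht, smul_eq_mul]) measurableSet_Icc
  have i2 : IntegrableOn (fun t => γ' t * G (γ t) ^ 2) (Icc 0 h) := by
    rcases lt_or_ge h 0 with hh | hh
    · rw [Icc_eq_empty hh.not_ge]; exact integrableOn_empty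
    have := (integrableOn_image_iff_integrableOn_abs_deriv_smul measurableSet_Icc hγ hmono.injOn
      (fun x => G x ^ 2)).mp hG.integrable_sq.integrableOn
    exact this.congr_fun (fun t ht => by simp only [habs t ht, smul_eq_mul]) measurableSet_Icc
  refine ⟨?_, fun t ht => ?_⟩
  -- The square is `γ' · (γ' G(γ)²)`; the first factor is bounded and the second is integrable by
  -- the change of variables.
  · rw [memLp_two_iff_integrable_sq i1.aestronglyMeasurable]
    refine (i2.const_mul B).mono (i1.aestronglyMeasurable.pow 2) ?_
    filter_upwards [ae_restrict_mem measurableSet_Icc] with t ht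
    have h1 := hB t ht
    have h2 := hc₀.trans_le (hpos t ht)
    rw [Real.norm_of_nonneg h2.le] at h1
    rw [Real.norm_of_nonneg (sq_nonneg _),
      Real.norm_of_nonneg (mul_nonneg (h2.le.trans h1) (mul_nonneg h2.le (sq_nonneg _)))]
    nlinarith [mul_nonneg (mul_nonneg h2.le (sq_nonneg (G (γ t)))) (sub_nonneg.mpr h1)]
  · have hs : Icc 0 t ⊆ Icc 0 h := Icc_subset_Icc_right ht.2
    have h1 := integral_image_eq_integral_abs_deriv_smul measurableSet_Icc
      (fun x hx => (hγ x (hs hx)).mono hs) (hmono.mono hs).injOn G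
    rw [himg t ht, integral_Icc_eq_integral_Ioc, integral_Icc_eq_integral_Ioc,
      ← intervalIntegral.integral_of_le (hmono.monotoneOn (hs ⟨le_rfl, ht.1⟩) ht ht.1),
      ← intervalIntegral.integral_of_le ht.1] at h1
    have h2 : ∫ r in (0 : ℝ)..t, |γ' r| • G (γ r) = ∫ r in (0 : ℝ)..t, γ' r * G (γ r) := by
      refine intervalIntegral.integral_congr fun r hr => ?_
      rw [uIcc_of_le ht.1] at hr
      simp only [habs r (hs hr), smul_eq_mul]
    rw [← h2, ← h1, primAt, primAt, add_assoc, intervalIntegral.integral_add_adjacent_intervals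
      (intervalIntegrable_of_memLp hG _ _) (intervalIntegrable_of_memLp hG _ _)]

theorem memLp_indicator_coeFn (g : L2 1) : MemLp ((Ioo (0 : ℝ) 1).indicator g) 2 volume :=
  (memLp_indicator_iff_restrict measurableSet_Ioo).mpr (Lp.memLp g)

theorem primAt_congr {G G' : ℝ → ℝ} {c s : ℝ} (h : ∀ᵐ r, r ∈ uIoc 0 s → G r = G' r) :
    primAt G c s = primAt G' c s := by
  rw [primAt, primAt, intervalIntegral.integral_congr_ae h]

theorem primAt_zero (G : ℝ → ℝ) (c : ℝ) : primAt G c 0 = c := by simp [primAt]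

theorem HasWeakDeriv.ae_eq_primAt {f g : L2 1} (h : HasWeakDeriv f g) {p : ℝ}
    (hp : HasTrace f 0 p) :
    f =ᵐ[volume.restrict (Ioo 0 1)] primAt ((Ioo (0 : ℝ) 1).indicator g) p := by
  obtain ⟨c, hc⟩ := h.exists_isRep one_pos
  have h1 := hp.eq_of_rep one_pos hc.continuousOn hc.ae_eq ⟨le_rfl, zero_le_one⟩
  simp only [intervalIntegral.integral_same, add_zero] at h1
  subst h1
  filter_upwards [hc.ae_eq, ae_restrict_mem measurableSet_Ioo] with x hx hxm
  rw [hx, primAt]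
  congr 1
  refine intervalIntegral.integral_congr_ae (Eventually.of_forall fun r hr => ?_)
  rw [uIoc_of_le hxm.1.le] at hr
  exact (indicator_of_mem (show r ∈ Ioo (0 : ℝ) 1 from ⟨hr.1, hr.2.trans_lt hxm.2⟩) _).symm

theorem primAt_scaled {G : ℝ → ℝ} (hG : MemLp G 2 volume) (c a : ℝ) {b : ℝ} (hb : b ≠ 0) (x : ℝ) :
    primAt (fun r => -b * G (a - b * r)) (primAt G c a) x = primAt G c (a - b * x) :=
  (primAt_affine hG c a hb x).symm

/-- A function on `(0,1)` with prescribed boundary values and prescribed values on `(1/2,1)`. -/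
theorem exists_extension {σ : ℝ} (hσ : 0 < σ) (p₀ q₀ : ℝ) {Q : ℝ → ℝ}
    (hQ : MemLp Q 2 (volume.restrict (Icc 0 (σ / 2)))) :
    ∃ (z z' : L2 1) (Z : ℝ → ℝ), Continuous Z ∧ z =ᵐ[volume.restrict (Ioo 0 1)] Z ∧
      HasWeakDeriv z z' ∧ HasTrace z 0 p₀ ∧ HasTrace z 1 q₀ ∧
      ∀ t ∈ Icc 0 (σ / 2), Z (1 - t / σ) = primAt Q q₀ t := by
  -- In the time variable `t = σ(1 - ρ)` the profile follows the primitive of `Q` up to `σ/2` and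
  -- then goes linearly, with slope `c`, to the value `p₀` at `t = σ`.
  set c := (p₀ - primAt Q q₀ (σ / 2)) / (σ / 2) with hc
  have hQ1 : MemLp ((Icc 0 (σ / 2)).indicator Q) 2 volume :=
    (memLp_indicator_iff_restrict measurableSet_Icc).mpr hQ
  have hQ2 : MemLp ((Ioc (σ / 2) σ).indicator fun _ => c) 2 volume :=
    memLp_indicator_const 2 measurableSet_Ioc c (Or.inr (by simp))
  set R := (Icc 0 (σ / 2)).indicator Q + (Ioc (σ / 2) σ).indicator fun _ => c with hR
  have hRm : MemLp R 2 volume := hQ1.add hQ2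
  have hle : σ / 2 ≤ σ := by linarith
  have h0 : ∀ t ∈ Icc 0 (σ / 2), primAt R q₀ t = primAt Q q₀ t := fun t ht =>
    primAt_congr (Eventually.of_forall fun r hr => by
      rw [uIoc_of_le ht.1] at hr
      have h1 : r ∈ Icc 0 (σ / 2) := ⟨hr.1.le, hr.2.trans ht.2⟩
      rw [hR, Pi.add_apply, indicator_of_mem h1,
        indicator_of_notMem (fun h2 => absurd h1.2 (not_le.mpr h2.1)), add_zero])
  have h1 : primAt R q₀ σ = p₀ := by
    have e1 : ∫ r in (σ / 2)..σ, R r = ∫ r in (σ / 2)..σ, c :=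
      intervalIntegral.integral_congr_ae (Eventually.of_forall fun r hr => by
        rw [uIoc_of_le hle] at hr
        rw [hR, Pi.add_apply, indicator_of_mem hr,
          indicator_of_notMem (fun h2 => absurd h2.2 (not_le.mpr hr.1)), zero_add])
    have e2 := h0 (σ / 2) ⟨by positivity, le_rfl⟩
    rw [primAt, ← intervalIntegral.integral_add_adjacent_intervals
      (intervalIntegrable_of_memLp hRm 0 (σ / 2)) (intervalIntegrable_of_memLp hRm (σ / 2) σ), e1,
      ← add_assoc, ← primAt, e2, intervalIntegral.integral_const, smul_eq_mul, hc]
    field_simp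
    ring
  have ha : ∀ ρ, σ - σ * ρ = σ * (1 - ρ) := fun ρ => by ring
  refine ⟨toL2 1 fun ρ => primAt R q₀ (σ - σ * ρ), toL2 1 fun ρ => -σ * R (σ - σ * ρ), _,
    (continuous_primAt hRm q₀).comp (by fun_prop : Continuous fun ρ => σ - σ * ρ),
    coeFn_toL2 (memLp_transport_prim hRm q₀ σ σ),
    (isRep_transport hRm q₀ σ hσ).hasWeakDeriv zero_le_one, ?_, ?_, fun t ht => ?_⟩
  · have := hasTrace_transport hRm q₀ σ σ 0
    rwa [mul_zero, sub_zero, h1] at this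
  · have := hasTrace_transport hRm q₀ σ σ 1
    rwa [mul_one, sub_self, primAt_zero] at this
  · rw [← h0 t ht, Function.comp_apply]
    congr 1
    field_simp
    ring

/-! ### Construction of classical solutions, step by step. -/

namespace Params

variable {P : Params}

/-- The state determined by a tuple of derivatives. -/
def toState (P : Params) : P.Tuple →L[ℝ] State P.L :=
  ((P.coη 0).prod (P.coω 0)).prod (P.coz 0)

/-- One step of the construction of classical solutions, of half the minimal delay. -/
theorem Admissible.exists_step (hP : P.Admissible) {s : ℝ} (hs : 0 ≤ s) {k₀ : P.Tuple}
    (hk₀ : k₀ ∈ P.dom) :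
    ∃ k : ℝ → P.Tuple, ContinuousOn k (Icc 0 (P.τ 0 / 2)) ∧ k 0 = k₀ ∧
      ∀ t ∈ Icc 0 (P.τ 0 / 2), k t ∈ P.dom ∧ HasDerivWithinAt (fun r => P.toState (k r))
        (P.A (s + t) (k t).1 (k t).2.1 (k t).2.2) (Icc 0 (P.τ 0 / 2)) t := by
  obtain ⟨η₀, ω₀, z₀⟩ := k₀
  obtain ⟨p₀, q₀, hk₀⟩ := hk₀
  simp only at hk₀
  set σ := P.τ 0 with hσdef
  have hσ : 0 < σ := hP.τ_zero_pos
  set h := σ / 2 with hh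
  have hpos : 0 < h := by positivity
  set θ : ℝ → ℝ := fun t => P.τ (s + t) with hθdef
  set θ' : ℝ → ℝ := fun t => P.τ' (s + t) with hθ'def
  have hmaps : MapsTo (fun t => s + t) (Icc 0 h) (Ici 0) := fun t ht => add_nonneg hs ht.1
  have hθ : ∀ t ∈ Icc 0 h, HasDerivWithinAt θ (θ' t) (Icc 0 h) t := fun t ht => by
    have := (hP.hasDerivWithinAt_τ (hmaps ht)).comp t
      ((hasDerivWithinAt_id t (Icc 0 h)).const_add s) hmaps
    rwa [mul_one] at this
  have hθ' : ContinuousOn θ' (Icc 0 h) := hP.continuousOn_τ'.comp (by fun_prop) hmaps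
  have hθσ : ∀ t ∈ Icc 0 h, σ ≤ θ t := fun t ht => hP.τ_ge _ (hmaps ht)
  have h0m : (0 : ℝ) ∈ Icc 0 h := ⟨le_rfl, hpos.le⟩
  have hθ0 : 0 < θ 0 := hσ.trans_le (hθσ 0 h0m)
  -- the history
  set g := (Ioo (0 : ℝ) 1).indicator (z₀ 1) with hg
  have hgm : MemLp g 2 volume := memLp_indicator_coeFn (z₀ 1)
  -- The profile `z₀` rewritten as a signal in time: its value at `ρ` is what entered at time `-θ(0)
  -- ρ`.
  set Gm : ℝ → ℝ := fun r => -(1 / θ 0) * g (0 - 1 / θ 0 * r) with hGm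
  have hGmm : MemLp Gm 2 volume := (memLp_affine (by positivity) hgm).const_mul _
  have hhist : ∀ x, primAt Gm p₀ (0 - θ 0 * x) = primAt g p₀ x := fun x => by
    have := primAt_scaled hgm p₀ 0 (b := 1 / θ 0) (by positivity) (0 - θ 0 * x)
    rw [primAt_zero] at this
    rw [hGm, this]
    congr 1
    field_simp
    ring
  have hz₀ : z₀ 0 =ᵐ[volume.restrict (Ioo 0 1)] primAt g p₀ := hk₀.z_deriv.ae_eq_primAt hk₀.z_zero
  have hz₀1 : primAt g p₀ 1 = q₀ := hk₀.z_one.eq_of_rep one_pos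
    (continuous_primAt hgm p₀).continuousOn hz₀ ⟨zero_le_one, le_rfl⟩
  -- the outgoing trace
  obtain ⟨hQ1, hQ2⟩ := exists_primAt_comp (h := h) (c := p₀) (c₀ := 1 - P.d)
    (by linarith [hP.d_lt_one])
    (γ := fun t => t - θ t) (γ' := fun t => 1 - θ' t) hGmm
    (fun t ht => (hasDerivWithinAt_id t _).sub (hθ t ht)) (by fun_prop)
    (fun t ht => by linarith [hP.τ'_le _ (hmaps ht)])
  have hQ3 : primAt Gm p₀ (0 - θ 0) = q₀ := by
    have := hhist 1
    rwa [mul_one, hz₀1] at this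
  -- An auxiliary initial profile for the line of constant delay `σ`, made to emit on `[0, σ/2]` the
  -- outgoing trace of the true line. It keeps the end values `p₀` and `q₀`, so the boundary
  -- conditions still hold at the initial time.
  obtain ⟨y, y', Y, hY, hyY, hyw, hy0, hy1, hYq⟩ := exists_extension hσ p₀ q₀ hQ1
  have hYq' : ∀ t ∈ Icc 0 h, Y (1 - t / σ) = primAt Gm p₀ (t - θ t) := fun t ht => by
    rw [hYq t ht, hQ2 t ht, hQ3]; rfl
  have hky : P.InDomain η₀ ω₀ ![y, y'] p₀ q₀ :=
    { hk₀ with z_deriv := hyw, z_zero := hy0, z_one := hy1 }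
  -- the system with the constant delay
  obtain ⟨k, hk1, hk2, hk3⟩ := hP.exists_frozen_solution hσ hpos.le
    ⟨(η₀, ω₀, ![y, y']), p₀, q₀, hky⟩
  choose p q hpq using fun t => (k t).2
  have ck : ContinuousOn (fun t => (k t : P.Tuple)) (Icc 0 h) :=
    continuous_subtype_val.comp_continuousOn hk1
  have cη : ContinuousOn (fun t => (k t : P.Tuple).1) (Icc 0 h) := continuous_fst.comp_continuousOn ck
  have cω : ContinuousOn (fun t => (k t : P.Tuple).2.1) (Icc 0 h) :=
    (continuous_fst.comp continuous_snd).comp_continuousOn ck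
  have cz : ∀ i, ContinuousOn (fun t => (k t : P.Tuple).2.2 i) (Icc 0 h) := fun i =>
    ((continuous_apply i).comp (continuous_snd.comp continuous_snd)).comp_continuousOn ck
  have hpc : ContinuousOn p (Icc 0 h) := fun t ht =>
    tendsto_trace one_pos (Or.inl rfl)
      (Eventually.of_forall fun r => ⟨(hpq r).z_deriv, (hpq r).z_zero⟩)
      (hpq t).z_deriv (hpq t).z_zero (cz 0 t ht) (cz 1 t ht)
  have hqc : ContinuousOn q (Icc 0 h) := fun t ht =>
    tendsto_trace one_pos (Or.inr rfl)
      (Eventually.of_forall fun r => ⟨(hpq r).z_deriv, (hpq r).z_one⟩)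
      (hpq t).z_deriv (hpq t).z_one (cz 0 t ht) (cz 1 t ht)
  have hk0 : (k 0 : P.Tuple) = (η₀, ω₀, ![y, y']) := by rw [hk2]
  have hp0 : p 0 = p₀ := by
    have := (hpq 0).z_zero
    rw [hk0] at this
    exact this.unique one_pos hy0 ⟨le_rfl, zero_le_one⟩
  set w := (Ioo (0 : ℝ) 1).indicator ((k h : P.Tuple).2.2 1) with hw
  have hwm : MemLp w 2 volume := memLp_indicator_coeFn _
  -- `char2` identifies the auxiliary outflow with the true one. `char1` recovers `p` from the final
  -- auxiliary profile, so `p` is a primitive of an `L²` function: continuity alone would not put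
  -- the new `z` in `H¹`.
  obtain ⟨char1, char2⟩ := characteristics (p := p) (q := q) hσ (z0 := fun t => (k t : P.Tuple).2.2 0)
    (z1 := fun t => (k t : P.Tuple).2.2 1)
    (fun t ht => (hasDerivWithinAt_snd (hk3 t ht)))
    (fun t _ => (hpq t).z_deriv) (fun t _ => (hpq t).z_zero) (fun t _ => (hpq t).z_one) hpc hqc
    hY.continuousOn (continuous_primAt hwm (p h)).continuousOn (by simp only [hk0]; exact hyY)
    ((hpq h).z_deriv.ae_eq_primAt (hpq h).z_zero)
  -- the incoming trace
  set Gp : ℝ → ℝ := fun r => -(1 / σ) * w (1 / 2 - 1 / σ * r) with hGp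
  have hGpm : MemLp Gp 2 volume := (memLp_affine (by positivity) hwm).const_mul _
  have hin : ∀ t ∈ Icc 0 h, primAt Gp p₀ t = p t := fun t ht => by
    have e1 := char1 h0m
    have e2 := char1 ht
    have e3 := primAt_scaled hwm (p h) (1 / 2) (b := 1 / σ) (by positivity) t
    simp only [zero_div, sub_zero] at e1
    rw [← e1, hp0, one_div_mul_eq_div] at e3
    rw [e2]
    exact e3
  set G : ℝ → ℝ := (Iic 0).indicator Gm + (Ioi 0).indicator Gp with hG
  have hGm' : MemLp G 2 volume :=
    (hGmm.indicator measurableSet_Iic).add (hGpm.indicator measurableSet_Ioi)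
  have hGpos : ∀ t ∈ Icc 0 h, primAt G p₀ t = p t := fun t ht => by
    rw [← hin t ht]
    refine primAt_congr (Eventually.of_forall fun r hr => ?_)
    rw [uIoc_of_le ht.1] at hr
    rw [hG, Pi.add_apply, indicator_of_notMem (show r ∉ Iic 0 from fun h2 => absurd hr.1 (not_lt.mpr h2)),
      indicator_of_mem (show r ∈ Ioi 0 from hr.1), zero_add]
  have hGneg : ∀ r ≤ 0, primAt G p₀ r = primAt Gm p₀ r := fun r hr => by
    refine primAt_congr (Eventually.of_forall fun x hx => ?_)
    rw [uIoc_of_ge hr] at hx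
    rw [hG, Pi.add_apply, indicator_of_mem (show x ∈ Iic 0 from hx.2),
      indicator_of_notMem (show x ∉ Ioi 0 from fun h2 => absurd hx.2 (not_le.mpr h2)), add_zero]
  obtain ⟨T1, T2⟩ := transport_aux hGm' p₀ hpos.le hσ hθ hθ' hθσ
  have hθpos : ∀ t ∈ Icc 0 h, 0 < θ t := fun t ht => hσ.trans_le (hθσ t ht)
  set z : ℝ → Fin 2 → L2 1 := fun t => ![toL2 1 fun ρ => primAt G p₀ (t - θ t * ρ),
    toL2 1 fun ρ => -θ t * G (t - θ t * ρ)] with hz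
  have hdom : ∀ t ∈ Icc 0 h, P.InDomain (k t : P.Tuple).1 (k t : P.Tuple).2.1 (z t) (p t) (q t) :=
    fun t ht =>
    { hpq t with
      z_deriv := (isRep_transport hGm' p₀ t (hθpos t ht)).hasWeakDeriv zero_le_one
      z_zero := by
        have := hasTrace_transport hGm' p₀ t (θ t) 0
        rwa [mul_zero, sub_zero, hGpos t ht] at this
      z_one := by
        have := hasTrace_transport hGm' p₀ t (θ t) 1
        -- The delay is at least `σ` and the step lasts `σ/2`, so the outflow reads only the
        -- history.
        have e : t - θ t ≤ 0 := by linarith [hθσ t ht, ht.2]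
        rw [mul_one, hGneg _ e, ← hYq' t ht] at this
        rw [char2 ht]
        exact this }
  have hz0 : z 0 = z₀ := by
    have e1 : z 0 0 = z₀ 0 := by
      refine Lp.ext ?_
      filter_upwards [hz₀, coeFn_toL2 (memLp_transport_prim hGm' p₀ 0 (θ 0)),
        ae_restrict_mem measurableSet_Ioo] with ρ h1 h2 hρ
      have e : 0 - θ 0 * ρ ≤ 0 := by have := mul_pos hθ0 hρ.1; linarith
      rw [h1, ← hhist, ← hGneg _ e]
      exact h2
    -- The second entry needs no computation, since weak derivatives are unique.
    have e2 := (hdom 0 h0m).z_deriv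
    rw [e1] at e2
    have e3 := e2.unique hk₀.z_deriv
    funext i
    fin_cases i
    · exact e1
    · exact e3
  have hcz : ContinuousOn z (Icc 0 h) := by
    refine continuousOn_pi.mpr fun i => ?_
    fin_cases i
    · exact fun t ht => (T2 t ht).continuousWithinAt
    · exact T1
  refine ⟨fun t => ((k t : P.Tuple).1, (k t : P.Tuple).2.1, z t), cη.prodMk (cω.prodMk hcz), ?_,
    fun t ht => ⟨⟨p t, q t, hdom t ht⟩, ?_⟩⟩
  · simp only [hk0, hz0]
  -- The first two components of the operator do not involve the delay, so the auxiliary `(η, ω)` is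
  -- kept and only the delay line is exchanged.
  · refine ((hasDerivWithinAt_fst (hk3 t ht)).prodMk (T2 t ht)).congr_deriv ?_
    simp only [A, toLp_transport]
    rfl

end Params

theorem hasDerivWithinAt_of_imp {E : Type*} [NormedAddCommGroup E] [NormedSpace ℝ E] {f : ℝ → E}
    {f' : E} {s : Set ℝ} (hs : IsClosed s) {t : ℝ} (h : t ∈ s → HasDerivWithinAt f f' s t) :
    HasDerivWithinAt f f' s t := by
  by_cases ht : t ∈ s
  · exact h ht
  · exact HasFDerivWithinAt.of_notMem_closure (by rwa [hs.closure_eq])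

namespace Params

variable {P : Params}

/-- `k` is a curve in the domain that solves the system on `[0,T]`. -/
def IsStrong (P : Params) (T : ℝ) (k : ℝ → P.Tuple) : Prop :=
  ContinuousOn k (Icc 0 T) ∧ ∀ t ∈ Icc 0 T, k t ∈ P.dom ∧
    HasDerivWithinAt (fun r => P.toState (k r)) (P.A t (k t).1 (k t).2.1 (k t).2.2) (Icc 0 T) t

/-- The new step starts from the full tuple at time `S`. The glued curve is therefore continuous in
the domain norm, and both one-sided derivatives at `S` have the same value. -/
theorem Admissible.exists_isStrong_add (hP : P.Admissible) {S : ℝ} (hS : 0 ≤ S) {k : ℝ → P.Tuple}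
    (hk : P.IsStrong S k) : ∃ k', P.IsStrong (S + P.τ 0 / 2) k' ∧ k' 0 = k 0 := by
  obtain ⟨hk1, hk2⟩ := hk
  have hh : 0 < P.τ 0 / 2 := by have := hP.τ_zero_pos; positivity
  set h := P.τ 0 / 2
  obtain ⟨l, hl1, hl2, hl3⟩ := hP.exists_step hS (hk2 S ⟨hS, le_rfl⟩).1
  set m : ℝ → P.Tuple := fun t => if t ≤ S then k t else l (t - S) with hm
  have e1 : EqOn m k (Icc 0 S) := fun t ht => if_pos ht.2
  have e2 : EqOn m (fun t => l (t - S)) (Icc S (S + h)) := fun t ht => by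
    rcases ht.1.eq_or_lt with rfl | h1
    · simp only [hm, le_refl, if_true, sub_self, hl2]
    · exact if_neg (not_le.mpr h1)
  have hun : Icc 0 (S + h) = Icc 0 S ∪ Icc S (S + h) :=
    (Icc_union_Icc_eq_Icc hS (by linarith)).symm
  have hmaps : MapsTo (fun t => t - S) (Icc S (S + h)) (Icc 0 h) := fun t ht =>
    ⟨by linarith [ht.1], by linarith [ht.2]⟩
  refine ⟨m, ⟨?_, fun t ht => ⟨?_, ?_⟩⟩, e1 ⟨le_rfl, hS⟩⟩
  · rw [hun]
    exact (hk1.congr e1).union_of_isClosed ((hl1.comp (by fun_prop) hmaps).congr e2)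
      isClosed_Icc isClosed_Icc
  · rw [hun] at ht
    rcases ht with ht | ht
    · rw [e1 ht]; exact (hk2 t ht).1
    · rw [e2 ht]; exact (hl3 _ (hmaps ht)).1
  · rw [hun]
    refine HasDerivWithinAt.union ?_ ?_
    · refine hasDerivWithinAt_of_imp isClosed_Icc fun ht => ?_
      rw [e1 ht]
      exact (hk2 t ht).2.congr_of_mem (fun r hr => by rw [e1 hr]) ht
    · refine hasDerivWithinAt_of_imp isClosed_Icc fun ht => ?_
      rw [e2 ht]
      have h1 := (hl3 _ (hmaps ht)).2.scomp t ((hasDerivWithinAt_id t (Icc S (S + h))).sub_const S)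
        hmaps
      rw [one_smul, add_sub_cancel] at h1
      exact h1.congr_of_mem (fun r hr => by simp only [e2 hr]; rfl) ht

/-- The step length `τ(0)/2` is the same at every stage, so finitely many steps cover `[0,T]`. -/
theorem Admissible.exists_isStrong (hP : P.Admissible) {T : ℝ} {k₀ : P.Tuple}
    (hk₀ : k₀ ∈ P.dom) : ∃ k, P.IsStrong T k ∧ k 0 = k₀ := by
  have hh : 0 < P.τ 0 / 2 := by have := hP.τ_zero_pos; positivity
  have key : ∀ n : ℕ, ∃ k, P.IsStrong (n * (P.τ 0 / 2)) k ∧ k 0 = k₀ := fun n => by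
    induction n with
    | zero =>
      refine ⟨fun _ => k₀, ⟨continuousOn_const, fun t ht => ⟨hk₀, ?_⟩⟩, rfl⟩
      rw [Nat.cast_zero, zero_mul, Icc_self]
      exact HasFDerivWithinAt.of_finite (finite_singleton 0)
    | succ n ih =>
      obtain ⟨k, h1, h2⟩ := ih
      obtain ⟨k', h3, h4⟩ := hP.exists_isStrong_add (by positivity) h1
      refine ⟨k', ?_, h4.trans h2⟩
      rwa [Nat.cast_succ, add_mul, one_mul]
  obtain ⟨n, hn⟩ := exists_nat_ge (T / (P.τ 0 / 2))
  rw [div_le_iff₀ hh] at hn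
  obtain ⟨k, ⟨h1, h2⟩, h3⟩ := key n
  have hsub : Icc 0 T ⊆ Icc 0 (n * (P.τ 0 / 2)) := Icc_subset_Icc_right hn
  exact ⟨k, ⟨h1.mono hsub, fun t ht => ⟨(h2 t (hsub ht)).1, (h2 t (hsub ht)).2.mono hsub⟩⟩, h3⟩

theorem Admissible.exists_isClassicalSolution (hP : P.Admissible) {T : ℝ} (hT : 0 ≤ T) (k₀ : P.dom) :
    ∃ V p q, P.IsClassicalSolution T V p q ∧ V ⟨0, le_rfl, hT⟩ = P.emb k₀ := by
  obtain ⟨k, ⟨h1, h2⟩, h3⟩ := hP.exists_isStrong (T := T) k₀.2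
  choose p q hpq using fun t : Icc (0 : ℝ) T => (h2 t t.2).1
  refine ⟨⟨fun t => P.toState (k t),
    P.toState.continuous.comp (continuousOn_iff_continuous_domRestrict.mp h1)⟩,
    fun t => p (projIcc 0 T hT t), fun t => q (projIcc 0 T hT t),
    ⟨fun t => (k t).1, fun t => (k t).2.1, fun t => (k t).2.2, continuous_fst.comp_continuousOn h1,
      (continuous_fst.comp continuous_snd).comp_continuousOn h1,
      (continuous_snd.comp continuous_snd).comp_continuousOn h1, fun t ht => ?_,
      fun t ht => (h2 t ht).2, fun t => rfl⟩, ?_⟩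
  · have := hpq ⟨t, ht⟩
    simpa only [projIcc_of_mem hT ht] using this
  · simp only [ContinuousMap.coe_mk, h3]
    rfl

end Params

/-! ### Mild solutions as the closure of the classical ones. -/

/-- A linear map that is bounded below on a subspace with dense image has a continuous inverse on
the closure of the subspace. -/
theorem exists_inverse_on_closure {X E : Type*} [NormedAddCommGroup X] [NormedSpace ℝ X]
    [CompleteSpace X] [NormedAddCommGroup E] [NormedSpace ℝ E] [CompleteSpace E]
    (S : Submodule ℝ X) (e : X →L[ℝ] E) {C : ℝ} (hC : ∀ x ∈ S, ‖x‖ ≤ C * ‖e x‖)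
    (hd : Dense (e '' S)) :
    ∃ Φ : E →L[ℝ] X, (∀ y, Φ y ∈ closure (S : Set X)) ∧ (∀ y, e (Φ y) = y) ∧
      ∀ x ∈ closure (S : Set X), Φ (e x) = x := by
  have hC' : ∀ x ∈ S.topologicalClosure, ‖x‖ ≤ max C 0 * ‖e x‖ := fun x hx => by
    have hcl : IsClosed {x : X | ‖x‖ ≤ max C 0 * ‖e x‖} :=
      isClosed_le (by fun_prop) (by fun_prop)
    refine closure_minimal (fun x hx => ?_) hcl hx
    exact (hC x hx).trans (by gcongr; exact le_max_left _ _)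
  have : CompleteSpace S.topologicalClosure := S.isClosed_topologicalClosure.completeSpace_coe
  set f : S.topologicalClosure →L[ℝ] E := e.comp S.topologicalClosure.subtypeL with hf
  have hanti : AntilipschitzWith (max C 0).toNNReal f :=
    AddMonoidHomClass.antilipschitz_of_bound f fun x => by
      rw [Real.coe_toNNReal _ (le_max_right _ _)]
      exact hC' x x.2
  have hker : f.ker = ⊥ := LinearMap.ker_eq_bot.mpr hanti.injective
  have hrange : f.range = ⊤ := by
    rw [LinearMap.range_eq_top, ← range_eq_univ]
    -- Bounded below on a complete space, the map has closed range; the range is also dense.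
    have h1 : IsClosed (range f) := hanti.isClosed_range f.uniformContinuous
    have h2 : Dense (range f) := hd.mono (by
      rintro _ ⟨x, hx, rfl⟩
      exact ⟨⟨x, S.le_topologicalClosure hx⟩, rfl⟩)
    exact h1.closure_eq.symm.trans h2.closure_eq
  set F := ContinuousLinearEquiv.ofBijective f hker hrange with hF
  refine ⟨S.topologicalClosure.subtypeL.comp (F.symm : E →L[ℝ] S.topologicalClosure),
    fun y => (F.symm y).2, fun y => F.apply_symm_apply y, fun x hx => ?_⟩
  exact congrArg Subtype.val (F.symm_apply_apply ⟨x, hx⟩)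

theorem norm_sq_eq_integral {E : Type*} [NormedAddCommGroup E] {T : ℝ} (hT : 0 ≤ T)
    {f : Lp E 2 (volume.restrict (Ioo (0 : ℝ) T))} {g : ℝ → E}
    (h : f =ᵐ[volume.restrict (Ioo 0 T)] g) : ‖f‖ ^ 2 = ∫ t in (0 : ℝ)..T, ‖g t‖ ^ 2 := by
  rw [← integral_Ioo_eq hT, Lp.norm_def,
    (Lp.memLp f).eLpNorm_eq_integral_rpow_norm (by norm_num) (by norm_num)]
  have h0 : 0 ≤ ∫ t in Ioo 0 T, ‖f t‖ ^ (2 : ℝ≥0∞).toReal :=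
    integral_nonneg fun _ => by positivity
  rw [ENNReal.toReal_ofReal (by positivity), ← Real.rpow_natCast, ← Real.rpow_mul h0]
  simp only [ENNReal.toReal_ofNat, Nat.cast_ofNat, ne_eq, OfNat.ofNat_ne_zero, not_false_eq_true,
    inv_mul_cancel₀, Real.rpow_one, Real.rpow_ofNat]
  exact integral_congr_ae (h.mono fun x hx => by simp only [hx])

theorem continuous_normSq {L : ℝ} : Continuous (X0.normSq (L := L)) := by
  unfold X0.normSq
  fun_prop

theorem X0.normSq_nonneg {L : ℝ} (u : X0 L) : 0 ≤ u.normSq := by unfold X0.normSq; positivity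

theorem normSq_add_le {L : ℝ} (u : State L) : u.1.normSq + ‖u.2‖ ^ 2 ≤ 3 * ‖u‖ ^ 2 := by
  have h1 : ‖u.1.1‖ ≤ ‖u‖ := (norm_fst_le u.1).trans (norm_fst_le u)
  have h2 : ‖u.1.2‖ ≤ ‖u‖ := (norm_snd_le u.1).trans (norm_fst_le u)
  have h3 : ‖u.2‖ ≤ ‖u‖ := norm_snd_le u
  have := pow_le_pow_left₀ (norm_nonneg _) h1 2
  have := pow_le_pow_left₀ (norm_nonneg _) h2 2
  have := pow_le_pow_left₀ (norm_nonneg _) h3 2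
  rw [X0.normSq]
  linarith

theorem norm_sq_le_normSq_add {L : ℝ} (u : State L) : ‖u‖ ^ 2 ≤ u.1.normSq + ‖u.2‖ ^ 2 := by
  rw [X0.normSq, Prod.norm_def, Prod.norm_def]
  have h : ∀ x y : ℝ, 0 ≤ x → 0 ≤ y → max x y ^ 2 ≤ x ^ 2 + y ^ 2 := fun x y hx hy => by
    rcases max_cases x y with h | h <;> rw [h.1] <;> nlinarith
  have h1 := h _ _ (norm_nonneg u.1.1) (norm_nonneg u.1.2)
  have h2 := h _ _ ((norm_nonneg u.1.1).trans (le_max_left _ ‖u.1.2‖)) (norm_nonneg u.2)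
  linarith

theorem le_sqrt_mul {x y K : ℝ} (hK : 0 ≤ K) (hy : 0 ≤ y) (h : x ^ 2 ≤ K * y ^ 2) : x ≤ √K * y := by
  refine le_of_sq_le_sq ?_ (by positivity)
  rwa [mul_pow, Real.sq_sqrt hK]

namespace Params

variable {P : Params} {T : ℝ}

/-- The constant in the bound on the boundary traces. -/
def traceConst (a₁ α β d M : ℝ) : ℝ :=
  (1 + |β| * M) / (2 * a₁ * α - |β| - |β| * a₁ ^ 2 / (1 - d))
    + (M + (1 + |β| * M) / (2 * a₁ * α - |β| - |β| * a₁ ^ 2 / (1 - d))) / (1 - d)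

theorem Admissible.M_pos (hP : P.Admissible) : 0 < P.M :=
  hP.τ_zero_pos.trans_le (hP.τ_le 0 le_rfl)

theorem Admissible.initial_le (hP : P.Admissible) (u : State P.L) :
    u.1.normSq + |P.β| * (P.τ 0 * ‖u.2‖ ^ 2) ≤ (1 + |P.β| * P.M) * (u.1.normSq + ‖u.2‖ ^ 2) := by
  have h1 := hP.τ_le 0 le_rfl
  have h2 := u.1.normSq_nonneg
  have h3 : |P.β| * (P.τ 0 * ‖u.2‖ ^ 2) ≤ |P.β| * (P.M * ‖u.2‖ ^ 2) := by gcongr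
  have h4 : 0 ≤ |P.β| * P.M * u.1.normSq := by have := hP.M_pos; positivity
  nlinarith [sq_nonneg ‖u.2‖]

theorem Admissible.traceConst_nonneg (hP : P.Admissible) :
    0 ≤ traceConst P.a₁ P.α P.β P.d P.M := by
  have hg := hP.gap_pos
  have hd : 0 < 1 - P.d := by linarith [hP.d_lt_one]
  have hM := hP.M_pos
  rw [gap] at hg
  rw [traceConst]
  positivity

theorem IsClassicalSolution.normSq_le (hP : P.Admissible) (hT : 0 ≤ T)
    {V : C(Icc (0 : ℝ) T, State P.L)} {p q : ℝ → ℝ} (h : P.IsClassicalSolution T V p q)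
    (t : Icc (0 : ℝ) T) :
    (V t).1.normSq + |P.β| * P.τ t * ‖(V t).2‖ ^ 2 ≤ (V ⟨0, le_rfl, hT⟩).1.normSq
      + |P.β| * P.τ 0 * ‖(V ⟨0, le_rfl, hT⟩).2‖ ^ 2 := by
  have h1 := h.energy_ineq hP hT le_rfl t
  have h2 : 0 ≤ P.gap * ∫ s in (0 : ℝ)..t, p s ^ 2 :=
    mul_nonneg hP.gap_pos.le (intervalIntegral.integral_nonneg t.2.1 fun _ _ => sq_nonneg _)
  rw [add_sub_cancel_right] at h1
  linarith

/-- The energy inequality with `κ = |β|` bounds `∫ p²`, and the integrated transport identity then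
bounds `∫ q²`. -/
theorem IsClassicalSolution.traces_le (hP : P.Admissible) (hT : 0 ≤ T)
    {V : C(Icc (0 : ℝ) T, State P.L)} {p q : ℝ → ℝ} (h : P.IsClassicalSolution T V p q) :
    (∫ t in (0 : ℝ)..T, p t ^ 2) + (∫ t in (0 : ℝ)..T, q t ^ 2) ≤ traceConst P.a₁ P.α P.β P.d P.M *
      ((V ⟨0, le_rfl, hT⟩).1.normSq + ‖(V ⟨0, le_rfl, hT⟩).2‖ ^ 2) := by
  have hg := hP.gap_pos
  have hd : 0 < 1 - P.d := by linarith [hP.d_lt_one]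
  have hM := hP.M_pos
  have h1 := h.energy_ineq hP hT le_rfl ⟨T, hT, le_rfl⟩
  have h2 := h.trace_ineq hP hT
  have h3 := hP.initial_le (V ⟨0, le_rfl, hT⟩)
  rw [add_sub_cancel_right] at h1
  set u := V ⟨0, le_rfl, hT⟩
  set v := V ⟨T, hT, le_rfl⟩
  have h4 : 0 ≤ |P.β| * (P.τ T * ‖v.2‖ ^ 2) := by have := hP.τ_pos hT; positivity
  have h5 := v.1.normSq_nonneg
  have h6 : P.τ 0 * ‖u.2‖ ^ 2 ≤ P.M * (u.1.normSq + ‖u.2‖ ^ 2) := by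
    have e1 := hP.τ_le 0 le_rfl
    have e2 := u.1.normSq_nonneg
    nlinarith [sq_nonneg ‖u.2‖, mul_nonneg hM.le e2]
  set N := u.1.normSq + ‖u.2‖ ^ 2
  set I := ∫ t in (0 : ℝ)..T, p t ^ 2
  set J := ∫ t in (0 : ℝ)..T, q t ^ 2
  have h7 : I ≤ (1 + |P.β| * P.M) / P.gap * N := by
    rw [div_mul_eq_mul_div, le_div_iff₀ hg]
    simp only at h1
    linarith
  have h8 : J ≤ (P.M + (1 + |P.β| * P.M) / P.gap) / (1 - P.d) * N := by
    rw [div_mul_eq_mul_div, le_div_iff₀ hd]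
    linarith
  have h9 : traceConst P.a₁ P.α P.β P.d P.M = (1 + |P.β| * P.M) / P.gap
    + (P.M + (1 + |P.β| * P.M) / P.gap) / (1 - P.d) := rfl
  rw [h9]
  linarith

/-- The weight `|β| + gap` replaces `|β|`: for `β = 0` the energy of the theorem gives no control of
`z`. -/
theorem IsClassicalSolution.norm_sq_le (hP : P.Admissible) (hT : 0 ≤ T)
    {V : C(Icc (0 : ℝ) T, State P.L)} {p q : ℝ → ℝ} (h : P.IsClassicalSolution T V p q)
    (t : Icc (0 : ℝ) T) :
    ‖V t‖ ^ 2 ≤ (1 + 1 / ((|P.β| + P.gap) * P.τ 0)) * (1 + (|P.β| + P.gap) * P.τ 0) * 3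
      * ‖V ⟨0, le_rfl, hT⟩‖ ^ 2 := by
  have hg := hP.gap_pos
  have hκ : 0 < |P.β| + P.gap := by positivity
  have h1 := h.energy_ineq hP hT (le_add_of_nonneg_right hg.le : |P.β| ≤ |P.β| + P.gap) t
  rw [show P.gap + |P.β| - (|P.β| + P.gap) = 0 by ring, zero_mul, add_zero] at h1
  set u := V ⟨0, le_rfl, hT⟩
  have h2 := norm_sq_le_normSq_add (V t)
  have h3 := normSq_add_le u
  have h4 := hP.τ_zero_pos
  have h5 := hP.τ_ge t t.2.1
  have e1 := u.1.normSq_nonneg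
  have e2 := (V t).1.normSq_nonneg
  set b := (|P.β| + P.gap) * P.τ 0 with hb
  have hb0 : 0 < b := by positivity
  have h6 : b * ‖(V t).2‖ ^ 2 ≤ (|P.β| + P.gap) * (P.τ t * ‖(V t).2‖ ^ 2) := by
    rw [hb, mul_assoc]; gcongr
  have h7 : (V t).1.normSq + b * ‖(V t).2‖ ^ 2 ≤ (1 + b) * (3 * ‖u‖ ^ 2) := by
    have h8 : u.1.normSq + (|P.β| + P.gap) * (P.τ 0 * ‖u.2‖ ^ 2)
        ≤ (1 + b) * (u.1.normSq + ‖u.2‖ ^ 2) := by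
      rw [← mul_assoc, ← hb]
      nlinarith [sq_nonneg ‖u.2‖, mul_nonneg hb0.le e1]
    exact (by linarith : _ ≤ _).trans (h8.trans (by gcongr))
  have h9 : (V t).1.normSq + ‖(V t).2‖ ^ 2
      ≤ (1 + 1 / b) * ((V t).1.normSq + b * ‖(V t).2‖ ^ 2) := by
    have : (1 + 1 / b) * ((V t).1.normSq + b * ‖(V t).2‖ ^ 2)
      = (V t).1.normSq + ‖(V t).2‖ ^ 2 + ((V t).1.normSq / b + b * ‖(V t).2‖ ^ 2) := by
      field_simp; ring
    rw [this]
    have : 0 ≤ (V t).1.normSq / b + b * ‖(V t).2‖ ^ 2 := by positivity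
    linarith
  calc ‖V t‖ ^ 2 ≤ (1 + 1 / b) * ((V t).1.normSq + b * ‖(V t).2‖ ^ 2) := h2.trans h9
    _ ≤ (1 + 1 / b) * ((1 + b) * (3 * ‖u‖ ^ 2)) := by gcongr
    _ = _ := by ring

end Params

namespace Params

variable {P : Params} {T : ℝ}

/-- The classical solutions together with their boundary traces. -/
def graph (P : Params) (T : ℝ) : Submodule ℝ (C(Icc (0 : ℝ) T, State P.L) × L2 T × L2 T) where
  carrier := {x | ∃ p q, P.IsClassicalSolution T x.1 p q ∧
    x.2.1 =ᵐ[volume.restrict (Ioo 0 T)] p ∧ x.2.2 =ᵐ[volume.restrict (Ioo 0 T)] q}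
  zero_mem' := ⟨_, _, .zero, Lp.coeFn_zero ℝ 2 _, Lp.coeFn_zero ℝ 2 _⟩
  add_mem' := by
    rintro x y ⟨p, q, h1, h2, h3⟩ ⟨p', q', h1', h2', h3'⟩
    exact ⟨_, _, h1.add h1', (Lp.coeFn_add _ _).trans (h2.add h2'),
      (Lp.coeFn_add _ _).trans (h3.add h3')⟩
  smul_mem' := by
    rintro c x ⟨p, q, h1, h2, h3⟩
    exact ⟨_, _, h1.smul c, (Lp.coeFn_smul _ _).trans (h2.const_smul c),
      (Lp.coeFn_smul _ _).trans (h3.const_smul c)⟩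

/-- The initial value. -/
def initial (P : Params) (hT : 0 ≤ T) : C(Icc (0 : ℝ) T, State P.L) →L[ℝ] State P.L :=
  ContinuousMap.evalCLM ℝ ⟨0, le_rfl, hT⟩

theorem initial_apply (hT : 0 ≤ T) (V : C(Icc (0 : ℝ) T, State P.L)) :
    P.initial hT V = V ⟨0, le_rfl, hT⟩ := rfl

theorem IsClassicalSolution.exists_mem_graph (hP : P.Admissible)
    {V : C(Icc (0 : ℝ) T, State P.L)} {p q : ℝ → ℝ} (h : P.IsClassicalSolution T V p q) :
    ∃ R S : L2 T, (V, R, S) ∈ P.graph T ∧ R =ᵐ[volume.restrict (Ioo 0 T)] p ∧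
      S =ᵐ[volume.restrict (Ioo 0 T)] q := by
  obtain ⟨cp, cq⟩ := h.continuousOn_traces hP
  have h1 := (memLp_of_continuousOn cp).coeFn_toLp
  have h2 := (memLp_of_continuousOn cq).coeFn_toLp
  exact ⟨_, _, ⟨p, q, h, h1, h2⟩, h1, h2⟩

theorem norm_sq_trace (hT : 0 ≤ T) {R : L2 T} {p : ℝ → ℝ}
    (h : R =ᵐ[volume.restrict (Ioo 0 T)] p) : ‖R‖ ^ 2 = ∫ t in (0 : ℝ)..T, p t ^ 2 := by
  rw [norm_sq_eq_integral hT h]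
  simp

theorem Admissible.dense_initial (hP : P.Admissible) (hT : 0 ≤ T) :
    Dense {u : State P.L | ∃ V p q, P.IsClassicalSolution T V p q ∧ P.initial hT V = u} := by
  refine (P.denseRange_emb hP.L_pos).mono ?_
  rintro _ ⟨k, rfl⟩
  exact hP.exists_isClassicalSolution hT k

theorem IsClassicalSolution.norm_le (hP : P.Admissible) (hT : 0 ≤ T)
    {V : C(Icc (0 : ℝ) T, State P.L)} {p q : ℝ → ℝ} (h : P.IsClassicalSolution T V p q) :
    ‖V‖ ≤ √((1 + 1 / ((|P.β| + P.gap) * P.τ 0)) * (1 + (|P.β| + P.gap) * P.τ 0) * 3)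
      * ‖P.initial hT V‖ := by
  refine (ContinuousMap.norm_le _ (by positivity)).mpr fun t =>
    le_sqrt_mul ?_ (norm_nonneg _) (h.norm_sq_le hP hT t)
  have := hP.gap_pos
  have := hP.τ_zero_pos
  positivity

theorem traces_norm_le (hP : P.Admissible) (hT : 0 ≤ T)
    {x : C(Icc (0 : ℝ) T, State P.L) × L2 T × L2 T} (hx : x ∈ P.graph T) :
    ‖x.2.1‖ ^ 2 + ‖x.2.2‖ ^ 2 ≤ traceConst P.a₁ P.α P.β P.d P.M *
      ((x.1 ⟨0, le_rfl, hT⟩).1.normSq + ‖(x.1 ⟨0, le_rfl, hT⟩).2‖ ^ 2) := by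
  obtain ⟨p, q, h1, h2, h3⟩ := hx
  rw [norm_sq_trace hT h2, norm_sq_trace hT h3]
  exact h1.traces_le hP hT

/-- The solution map, with values in the closure of the classical solutions. -/
theorem Admissible.exists_solutionMap (hP : P.Admissible) (hT : 0 ≤ T) :
    ∃ Φ : State P.L →L[ℝ] C(Icc (0 : ℝ) T, State P.L) × L2 T × L2 T,
      (∀ u, Φ u ∈ closure (P.graph T : Set (C(Icc (0 : ℝ) T, State P.L) × L2 T × L2 T))) ∧
      (∀ u, (Φ u).1 ⟨0, le_rfl, hT⟩ = u) ∧
      ∀ x ∈ closure (P.graph T : Set (C(Icc (0 : ℝ) T, State P.L) × L2 T × L2 T)),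
        Φ (x.1 ⟨0, le_rfl, hT⟩) = x := by
  have hc := hP.traceConst_nonneg
  set c := √((1 + 1 / ((|P.β| + P.gap) * P.τ 0)) * (1 + (|P.β| + P.gap) * P.τ 0) * 3)
  refine exists_inverse_on_closure (P.graph T) ((P.initial hT).comp (ContinuousLinearMap.fst ℝ _ _))
    (C := c + √(traceConst P.a₁ P.α P.β P.d P.M * 3)) (fun x hx => ?_) ?_
  · have h1 := traces_norm_le hP hT hx
    have h2 := h1.trans (mul_le_mul_of_nonneg_left (normSq_add_le _) hc)
    rw [← mul_assoc] at h2
    obtain ⟨p, q, h, -, -⟩ := hx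
    have e0 := h.norm_le hP hT
    have e1 := le_sqrt_mul (x := ‖x.2.1‖) (by positivity) (norm_nonneg _)
      ((le_add_of_nonneg_right (sq_nonneg _)).trans h2)
    have e2 := le_sqrt_mul (x := ‖x.2.2‖) (by positivity) (norm_nonneg _)
      ((le_add_of_nonneg_left (sq_nonneg _)).trans h2)
    rw [ContinuousLinearMap.comp_apply, ContinuousLinearMap.coe_fst', add_mul]
    rw [initial_apply] at e0 ⊢
    have e3 : 0 ≤ c * ‖x.1 ⟨0, le_rfl, hT⟩‖ := by positivity
    have e4 : 0 ≤ √(traceConst P.a₁ P.α P.β P.d P.M * 3) * ‖x.1 ⟨0, le_rfl, hT⟩‖ := by positivity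
    exact max_le (by linarith) (max_le (by linarith) (by linarith))
  · refine (hP.dense_initial hT).mono ?_
    rintro _ ⟨V, p, q, h, rfl⟩
    obtain ⟨R, S, h1, -, -⟩ := h.exists_mem_graph hP
    exact ⟨_, h1, rfl⟩

theorem isMildSolution_of_mem_closure {x : C(Icc (0 : ℝ) T, State P.L) × L2 T × L2 T}
    (hx : x ∈ closure (P.graph T : Set (C(Icc (0 : ℝ) T, State P.L) × L2 T × L2 T))) :
    P.IsMildSolution T x.1 := by
  obtain ⟨y, hy, hlim⟩ := mem_closure_iff_seq_limit.mp hx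
  refine ⟨fun n => (y n).1, fun n => ?_, (continuous_fst.tendsto x).comp hlim⟩
  obtain ⟨p, q, h, -, -⟩ := hy n
  exact ⟨p, q, h⟩

/-- Turns the definition by sequences into membership in one closed subspace, where existence,
uniqueness and estimates of traces can be read off. -/
theorem hasBoundaryTraces_iff (hP : P.Admissible) {U : C(Icc (0 : ℝ) T, State P.L)} {p q : L2 T} :
    P.HasBoundaryTraces T U p q ↔
      (U, p, q) ∈ closure (P.graph T : Set (C(Icc (0 : ℝ) T, State P.L) × L2 T × L2 T)) := by
  have key : ∀ {R : ℕ → L2 T} {r : ℕ → ℝ → ℝ} {p : L2 T},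
      (∀ n, R n =ᵐ[volume.restrict (Ioo 0 T)] r n) →
      (Tendsto (fun n => eLpNorm (fun t => r n t - p t) 2 (volume.restrict (Ioo 0 T))) atTop (𝓝 0)
        ↔ Tendsto R atTop (𝓝 p)) := fun {R r p} h => by
    rw [Lp.tendsto_Lp_iff_tendsto_eLpNorm']
    refine tendsto_congr fun n => eLpNorm_congr_ae ?_
    exact (h n).symm.sub (ae_eq_refl (p : ℝ → ℝ))
  constructor
  · rintro ⟨V, r, s, h1, h2, h3, h4⟩
    choose R S hRS hR hS using fun n => (h1 n).exists_mem_graph hP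
    exact mem_closure_of_tendsto (h2.prodMk_nhds (((key hR).mp h3).prodMk_nhds ((key hS).mp h4)))
      (Eventually.of_forall hRS)
  · intro h
    obtain ⟨y, hy, hlim⟩ := mem_closure_iff_seq_limit.mp h
    choose r s h1 h2 h3 using hy
    exact ⟨fun n => (y n).1, r, s, h1, (continuous_fst.tendsto _).comp hlim,
      (key h2).mpr (((continuous_fst.comp continuous_snd).tendsto _).comp hlim),
      (key h3).mpr (((continuous_snd.comp continuous_snd).tendsto _).comp hlim)⟩

/-- Transfers every closed relation between a solution and its traces from classical to mild
solutions. -/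
theorem HasBoundaryTraces.of_isClosed (hP : P.Admissible)
    (f : C(Icc (0 : ℝ) T, State P.L) → L2 T → L2 T → Prop)
    (hcl : IsClosed {x : C(Icc (0 : ℝ) T, State P.L) × L2 T × L2 T | f x.1 x.2.1 x.2.2})
    (hf : ∀ V R S, (V, R, S) ∈ P.graph T → f V R S)
    {U : C(Icc (0 : ℝ) T, State P.L)} {p q : L2 T} (h : P.HasBoundaryTraces T U p q) : f U p q := by
  have h1 : (P.graph T : Set (C(Icc (0 : ℝ) T, State P.L) × L2 T × L2 T))
      ⊆ {x | f x.1 x.2.1 x.2.2} := fun x hx => hf x.1 x.2.1 x.2.2 hx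
  exact closure_minimal h1 hcl ((hasBoundaryTraces_iff hP).mp h)

/-- Mild solutions are defined without reference to traces. Yet each approximating classical
solution is reproduced by `Φ` from its initial value, and the initial values converge, so continuity
of `Φ` identifies the limit. -/
theorem isSolution_iff (hP : P.Admissible) (hT : 0 ≤ T)
    {Φ : State P.L →L[ℝ] C(Icc (0 : ℝ) T, State P.L) × L2 T × L2 T}
    (h1 : ∀ u, Φ u ∈ closure (P.graph T : Set (C(Icc (0 : ℝ) T, State P.L) × L2 T × L2 T)))
    (h2 : ∀ u, (Φ u).1 ⟨0, le_rfl, hT⟩ = u)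
    (h3 : ∀ x ∈ closure (P.graph T : Set (C(Icc (0 : ℝ) T, State P.L) × L2 T × L2 T)),
        Φ (x.1 ⟨0, le_rfl, hT⟩) = x) {U₀ : State P.L} {U : C(Icc (0 : ℝ) T, State P.L)} :
    P.IsSolution T U₀ U ↔ U = (Φ U₀).1 := by
  constructor
  · rintro ⟨⟨V, hV, hlim⟩, h0⟩
    have e0 : U ⟨0, le_rfl, hT⟩ = U₀ := h0 _ rfl
    have e1 : ∀ n, (Φ (P.initial hT (V n))).1 = V n := fun n => by
      obtain ⟨p, q, h⟩ := hV n
      obtain ⟨R, S, h4, -, -⟩ := h.exists_mem_graph hP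
      exact congrArg Prod.fst (h3 _ (subset_closure h4))
    have e2 : Tendsto (fun n => (Φ (P.initial hT (V n))).1) atTop (𝓝 (Φ (P.initial hT U)).1) :=
      ((continuous_fst.comp (Φ.continuous.comp (P.initial hT).continuous)).tendsto U).comp hlim
    simp only [e1] at e2
    rw [initial_apply, e0] at e2
    exact tendsto_nhds_unique hlim e2
  · rintro rfl
    refine ⟨isMildSolution_of_mem_closure (h1 U₀), fun t ht => ?_⟩
    obtain rfl : t = ⟨0, le_rfl, hT⟩ := Subtype.ext ht
    exact h2 U₀

theorem IsSolution.initial_eq (hT : 0 ≤ T) {U₀ : State P.L} {U : C(Icc (0 : ℝ) T, State P.L)}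
    (h : P.IsSolution T U₀ U) : U ⟨0, le_rfl, hT⟩ = U₀ := h.2 _ rfl

theorem Admissible.existsUnique (hP : P.Admissible) (hT : 0 ≤ T) (U₀ : State P.L) :
    (∃! U, P.IsSolution T U₀ U) ∧
      ∀ U, P.IsSolution T U₀ U → ∃! pq : L2 T × L2 T, P.HasBoundaryTraces T U pq.1 pq.2 := by
  obtain ⟨Φ, h1, h2, h3⟩ := hP.exists_solutionMap hT
  have hiff := fun {U₀ U} => isSolution_iff hP hT h1 h2 h3 (U₀ := U₀) (U := U)
  refine ⟨⟨(Φ U₀).1, hiff.mpr rfl, fun U hU => hiff.mp hU⟩, fun U hU => ?_⟩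
  have hU0 := hU.initial_eq hT
  rw [hiff] at hU
  subst hU
  refine ⟨(Φ U₀).2, (hasBoundaryTraces_iff hP).mpr (h1 U₀), fun pq hpq => ?_⟩
  have := h3 _ ((hasBoundaryTraces_iff hP).mp hpq)
  rw [h2] at this
  rw [this]

theorem IsSolution.energy_le (hP : P.Admissible) (hT : 0 ≤ T) {U₀ : State P.L}
    {U : C(Icc (0 : ℝ) T, State P.L)} (h : P.IsSolution T U₀ U) (t : Icc (0 : ℝ) T) :
    (U t).1.normSq + |P.β| * P.τ t * ‖(U t).2‖ ^ 2
      ≤ U₀.1.normSq + |P.β| * P.τ 0 * ‖U₀.2‖ ^ 2 := by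
  obtain ⟨⟨V, hV, hlim⟩, h0⟩ := h
  have e0 : U ⟨0, le_rfl, hT⟩ = U₀ := h0 _ rfl
  have hcl : IsClosed {W : C(Icc (0 : ℝ) T, State P.L) |
      (W t).1.normSq + |P.β| * P.τ t * ‖(W t).2‖ ^ 2 ≤ (W ⟨0, le_rfl, hT⟩).1.normSq
        + |P.β| * P.τ 0 * ‖(W ⟨0, le_rfl, hT⟩).2‖ ^ 2} := by
    have := continuous_normSq (L := P.L)
    exact isClosed_le (by fun_prop) (by fun_prop)
  have := hcl.mem_of_tendsto hlim (Eventually.of_forall fun n => by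
    obtain ⟨p, q, h⟩ := hV n
    exact h.normSq_le hP hT t)
  rwa [mem_ofPred_eq, e0] at this

theorem continuous_eval_normSq {L : ℝ} {Y : Type*} [TopologicalSpace Y] (t : Icc (0 : ℝ) T) :
    Continuous fun x : C(Icc (0 : ℝ) T, State L) × Y => (x.1 t).1.normSq :=
  continuous_normSq.comp (continuous_fst.comp ((continuous_eval_const t).comp continuous_fst))

theorem continuous_eval_norm {L : ℝ} {Y : Type*} [TopologicalSpace Y] (t : Icc (0 : ℝ) T) :
    Continuous fun x : C(Icc (0 : ℝ) T, State L) × Y => ‖(x.1 t).2‖ ^ 2 :=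
  (continuous_norm.comp (continuous_snd.comp ((continuous_eval_const t).comp continuous_fst))).pow 2

theorem HasBoundaryTraces.norm_le (hP : P.Admissible) (hT : 0 ≤ T) {U : C(Icc (0 : ℝ) T, State P.L)}
    {p q : L2 T} (h : P.HasBoundaryTraces T U p q) :
    ‖p‖ ^ 2 + ‖q‖ ^ 2 ≤ traceConst P.a₁ P.α P.β P.d P.M *
      ((U ⟨0, le_rfl, hT⟩).1.normSq + ‖(U ⟨0, le_rfl, hT⟩).2‖ ^ 2) := by
  have hcl : IsClosed {x : C(Icc (0 : ℝ) T, State P.L) × L2 T × L2 T |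
      ‖x.2.1‖ ^ 2 + ‖x.2.2‖ ^ 2 ≤ traceConst P.a₁ P.α P.β P.d P.M *
        ((x.1 ⟨0, le_rfl, hT⟩).1.normSq + ‖(x.1 ⟨0, le_rfl, hT⟩).2‖ ^ 2)} := by
    have cp : Continuous fun x : C(Icc (0 : ℝ) T, State P.L) × L2 T × L2 T => ‖x.2.1‖ ^ 2 := by
      fun_prop
    have cq : Continuous fun x : C(Icc (0 : ℝ) T, State P.L) × L2 T × L2 T => ‖x.2.2‖ ^ 2 := by
      fun_prop
    exact isClosed_le (cp.add cq)
      (continuous_const.mul ((continuous_eval_normSq _).add (continuous_eval_norm _)))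
  exact h.of_isClosed hP _ hcl fun V R S hx => traces_norm_le hP hT hx

theorem continuous_integral_normSq {L : ℝ} (hT : 0 ≤ T) :
    Continuous fun W : C(Icc (0 : ℝ) T, State L) =>
      ∫ t in (0 : ℝ)..T, (W (projIcc 0 T hT t)).1.normSq := by
  have hc := continuous_normSq (L := L)
  refine continuous_iff_continuousAt.mpr fun W => ?_
  refine intervalIntegral.tendsto_integral_filter_of_dominated_convergence
    (fun _ => 3 * (‖W‖ + 1) ^ 2) (Eventually.of_forall fun V => ?_) ?_ (by simp)
    (Eventually.of_forall fun t _ => ?_)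
  · have : Continuous fun t => (V (projIcc 0 T hT t)).1.normSq :=
      hc.comp (continuous_fst.comp (V.continuous.comp continuous_projIcc))
    exact this.aestronglyMeasurable
  · filter_upwards [Metric.ball_mem_nhds W one_pos] with V hV
    refine Eventually.of_forall fun t _ => ?_
    have h1 : ‖V‖ ≤ ‖W‖ + 1 := by
      have := norm_le_norm_add_norm_sub' V W
      rw [mem_ball_iff_norm] at hV
      linarith
    have h2 := normSq_add_le (V (projIcc 0 T hT t))
    have h3 := (V.norm_coe_le_norm (projIcc 0 T hT t)).trans h1
    rw [Real.norm_of_nonneg (X0.normSq_nonneg _)]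
    nlinarith [pow_le_pow_left₀ (norm_nonneg _) h3 2, sq_nonneg ‖(V (projIcc 0 T hT t)).2‖]
  · exact (by fun_prop : Continuous fun V : C(Icc (0 : ℝ) T, State L) =>
      (V (projIcc 0 T hT t)).1.normSq).tendsto W

theorem HasBoundaryTraces.observability (hP : P.Admissible) (hT : 0 < T)
    {U : C(Icc (0 : ℝ) T, State P.L)} {p q : L2 T} (h : P.HasBoundaryTraces T U p q) :
    (U ⟨0, le_rfl, hT.le⟩).1.normSq
      ≤ 1 / T * (∫ t in (0 : ℝ)..T, (U (projIcc 0 T hT.le t)).1.normSq)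
        + P.a₁ * (2 * P.α + |P.β|) * ‖p‖ ^ 2 + P.a₁ * |P.β| * ‖q‖ ^ 2 := by
  have hcl : IsClosed {x : C(Icc (0 : ℝ) T, State P.L) × L2 T × L2 T |
      (x.1 ⟨0, le_rfl, hT.le⟩).1.normSq
      ≤ 1 / T * (∫ t in (0 : ℝ)..T, (x.1 (projIcc 0 T hT.le t)).1.normSq)
        + P.a₁ * (2 * P.α + |P.β|) * ‖x.2.1‖ ^ 2 + P.a₁ * |P.β| * ‖x.2.2‖ ^ 2} := by
    have cp : Continuous fun x : C(Icc (0 : ℝ) T, State P.L) × L2 T × L2 T => ‖x.2.1‖ ^ 2 := by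
      fun_prop
    have cq : Continuous fun x : C(Icc (0 : ℝ) T, State P.L) × L2 T × L2 T => ‖x.2.2‖ ^ 2 := by
      fun_prop
    have ci := (continuous_integral_normSq (L := P.L) hT.le).comp
      (continuous_fst (X := C(Icc (0 : ℝ) T, State P.L)) (Y := L2 T × L2 T))
    exact isClosed_le (continuous_eval_normSq _)
      (((continuous_const.mul ci).add (continuous_const.mul cp)).add (continuous_const.mul cq))
  refine h.of_isClosed hP (fun U p q => (U ⟨0, le_rfl, hT.le⟩).1.normSq
      ≤ 1 / T * (∫ t in (0 : ℝ)..T, (U (projIcc 0 T hT.le t)).1.normSq)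
        + P.a₁ * (2 * P.α + |P.β|) * ‖p‖ ^ 2 + P.a₁ * |P.β| * ‖q‖ ^ 2) hcl fun V R S hx => ?_
  obtain ⟨r, s, h1, h2, h3⟩ := hx
  rw [norm_sq_trace hT.le h2, norm_sq_trace hT.le h3]
  exact h1.observability hP hT

theorem HasBoundaryTraces.transport_observability (hP : P.Admissible) (hT : 0 ≤ T) {K : ℝ}
    (hK : ∀ t ∈ Icc 0 T, -K ≤ P.τ' t)
    {U : C(Icc (0 : ℝ) T, State P.L)} {p q : L2 T} (h : P.HasBoundaryTraces T U p q) :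
    P.τ 0 * ‖(U ⟨0, le_rfl, hT⟩).2‖ ^ 2
      ≤ P.M * ‖(U ⟨T, hT, le_rfl⟩).2‖ ^ 2 + (1 + K) * ‖q‖ ^ 2 := by
  have hcl : IsClosed {x : C(Icc (0 : ℝ) T, State P.L) × L2 T × L2 T |
      P.τ 0 * ‖(x.1 ⟨0, le_rfl, hT⟩).2‖ ^ 2
      ≤ P.M * ‖(x.1 ⟨T, hT, le_rfl⟩).2‖ ^ 2 + (1 + K) * ‖x.2.2‖ ^ 2} := by
    have cq : Continuous fun x : C(Icc (0 : ℝ) T, State P.L) × L2 T × L2 T => ‖x.2.2‖ ^ 2 := by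
      fun_prop
    exact isClosed_le (continuous_const.mul (continuous_eval_norm _))
      ((continuous_const.mul (continuous_eval_norm _)).add (continuous_const.mul cq))
  refine h.of_isClosed hP (fun U _ q => P.τ 0 * ‖(U ⟨0, le_rfl, hT⟩).2‖ ^ 2
      ≤ P.M * ‖(U ⟨T, hT, le_rfl⟩).2‖ ^ 2 + (1 + K) * ‖q‖ ^ 2) hcl fun V R S hx => ?_
  obtain ⟨r, s, h1, h2, h3⟩ := hx
  rw [norm_sq_trace hT h3]
  exact h1.transport_observability hP hT hK

end Params

/-! ### Smoothing for mild solutions and continuity of the solution map. -/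

theorem H20.ext_fst {ℓ : ℝ} {w w' : H20 ℓ}
    (h : (w : L2 ℓ × L2 ℓ × L2 ℓ).1 = (w' : L2 ℓ × L2 ℓ × L2 ℓ).1) : w = w' := by
  obtain ⟨⟨f, f', f''⟩, h1, h2, hr⟩ := w
  obtain ⟨⟨g, g', g''⟩, h3, h4, hr'⟩ := w'
  obtain rfl : f = g := h
  obtain rfl := h1.unique h3
  obtain rfl := h2.unique h4
  rfl

/-- Convergence in `L²(0,T; H²₀)` gives convergence almost everywhere along a subsequence, which
suffices to compare the two limits at almost every time. -/
theorem isClosed_solutionSpace (L T : ℝ) : IsClosed (solutionSpace L T :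
    Set (C(Icc (0 : ℝ) T, X0 L) × Lp (H20 L × H20 L) 2 (volume.restrict (Ioo (0 : ℝ) T)))) := by
  refine isClosed_of_closure_subset fun x hx => ?_
  obtain ⟨y, hy, hlim⟩ := mem_closure_iff_seq_limit.mp hx
  have h1 : Tendsto (fun n => (y n).1) atTop (𝓝 x.1) := (continuous_fst.tendsto x).comp hlim
  have h2 : Tendsto (fun n => (y n).2) atTop (𝓝 x.2) := (continuous_snd.tendsto x).comp hlim
  obtain ⟨φ, hφ, hae⟩ := (tendstoInMeasure_of_tendsto_Lp h2).exists_seq_tendsto_ae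
  have hy' : ∀ n, ∀ᵐ t ∂(volume.restrict (Ioo (0 : ℝ) T)), ∀ ht : t ∈ Icc 0 T,
    ((((y n).2 t).1 : L2 L × L2 L × L2 L).1, (((y n).2 t).2 : L2 L × L2 L × L2 L).1)
      = (y n).1 ⟨t, ht⟩ := hy
  change ∀ᵐ t ∂(volume.restrict (Ioo (0 : ℝ) T)), ∀ ht : t ∈ Icc 0 T,
    (((x.2 t).1 : L2 L × L2 L × L2 L).1, ((x.2 t).2 : L2 L × L2 L × L2 L).1) = x.1 ⟨t, ht⟩
  filter_upwards [hae, ae_all_iff.mpr hy'] with t h3 h4 ht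
  have h5 : Tendsto (fun n => (y (φ n)).1 ⟨t, ht⟩) atTop (𝓝 (x.1 ⟨t, ht⟩)) :=
    ((continuous_eval_const _).tendsto x.1).comp (h1.comp hφ.tendsto_atTop)
  simp only [← h4 _ ht] at h5
  have hc : Continuous fun w : H20 L × H20 L =>
      ((w.1 : L2 L × L2 L × L2 L).1, (w.2 : L2 L × L2 L × L2 L).1) :=
    (continuous_fst.comp (continuous_subtype_val.comp continuous_fst)).prodMk
      (continuous_fst.comp (continuous_subtype_val.comp continuous_snd))
  exact tendsto_nhds_unique ((hc.tendsto (x.2 t)).comp h3) h5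

/-- The `X₀`-component of a curve in the state space. -/
def fstCurve (L T : ℝ) : C(Icc (0 : ℝ) T, State L) →L[ℝ] C(Icc (0 : ℝ) T, X0 L) :=
  (ContinuousLinearMap.fst ℝ (X0 L) (L2 1)).compLeftContinuous ℝ (Icc (0 : ℝ) T)

namespace Params

variable {P : Params} {T : ℝ}

/-- The space of classical solutions. -/
def classicalSolutions (P : Params) (T : ℝ) : Submodule ℝ C(Icc (0 : ℝ) T, State P.L) where
  carrier := {V | ∃ p q, P.IsClassicalSolution T V p q}
  zero_mem' := ⟨_, _, .zero⟩
  add_mem' := by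
    rintro V V' ⟨p, q, h⟩ ⟨p', q', h'⟩
    exact ⟨_, _, h.add h'⟩
  smul_mem' := by
    rintro c V ⟨p, q, h⟩
    exact ⟨_, _, h.smul c⟩

/-- The classical solutions together with the same curve in `L²(0,T; [H²₀(0,L)]²)`. -/
def smoothGraph (P : Params) (T : ℝ) : Submodule ℝ
    (C(Icc (0 : ℝ) T, State P.L) × Lp (H20 P.L × H20 P.L) 2 (volume.restrict (Ioo (0 : ℝ) T))) :=
  (P.classicalSolutions T).comap (LinearMap.fst ℝ _ _) ⊓
    (solutionSpace P.L T).comap (((fstCurve P.L T).comp (ContinuousLinearMap.fst ℝ _ _)).prod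
      (ContinuousLinearMap.snd ℝ _ _)).toLinearMap

theorem mem_smoothGraph {x : C(Icc (0 : ℝ) T, State P.L) ×
      Lp (H20 P.L × H20 P.L) 2 (volume.restrict (Ioo (0 : ℝ) T))} :
    x ∈ P.smoothGraph T ↔ (∃ p q, P.IsClassicalSolution T x.1 p q) ∧
      (fstCurve P.L T x.1, x.2) ∈ solutionSpace P.L T := Iff.rfl

/-- A number strictly between `√(3a/(5a₁))` and `π/L`. -/
def wave (L a a₁ : ℝ) : ℝ := (√(3 * a / (5 * a₁)) + Real.pi / L) / 2

/-- The restriction on `L` says `√(3a/(5a₁)) < π/L`. A value of `k` below `π/L` is allowed in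
Wirtinger's inequality, and one above `√(3a/(5a₁))` makes the smoothing coefficient positive. -/
theorem Admissible.wave_spec (hP : P.Admissible)
    (hL : P.L < √(5 * P.a₁ / (3 * P.a)) * Real.pi) :
    0 < wave P.L P.a P.a₁ ∧ wave P.L P.a P.a₁ * P.L < Real.pi ∧
      0 < 5 * P.a₁ / 2 - 3 * P.a / (2 * wave P.L P.a P.a₁ ^ 2) := by
  have h1 := hP.L_pos
  have h2 := hP.a_pos
  have h3 := hP.a₁_pos
  set μ := √(3 * P.a / (5 * P.a₁)) with hμ
  have hμ0 : 0 < μ := Real.sqrt_pos.mpr (by positivity)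
  have h4 : √(5 * P.a₁ / (3 * P.a)) = μ⁻¹ := by rw [hμ, ← Real.sqrt_inv, inv_div]
  have h5 : μ ^ 2 = 3 * P.a / (5 * P.a₁) := Real.sq_sqrt (by positivity)
  rw [h4, inv_mul_eq_div, lt_div_iff₀ hμ0] at hL
  have h6 : μ < Real.pi / P.L := by rw [lt_div_iff₀ h1]; linarith
  have h7 : wave P.L P.a P.a₁ = (μ + Real.pi / P.L) / 2 := rfl
  set k := wave P.L P.a P.a₁
  have h8 : μ < k := by linarith
  have h9 : k < Real.pi / P.L := by linarith
  have hk : 0 < k := hμ0.trans h8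
  refine ⟨hk, by rwa [lt_div_iff₀ h1] at h9, ?_⟩
  have h10 : 3 * P.a < 5 * P.a₁ * k ^ 2 := by
    rw [eq_div_iff (by positivity)] at h5
    have : μ ^ 2 < k ^ 2 := by gcongr
    nlinarith
  rw [sub_pos, div_lt_div_iff₀ (by positivity) (by positivity)]
  linarith

/-- The constant in the smoothing estimate. -/
def smoothConst (L a a₁ α β d M : ℝ) : ℝ :=
  (1 + 1 / wave L a a₁ ^ 2) ^ 2 * ((L / 2 * ((1 + |β| * M) + 1)
    + a₁ * L / 2 * ((1 + 2 * α ^ 2) * traceConst a₁ α β d M + 2 * β ^ 2 * traceConst a₁ α β d M))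
      / (5 * a₁ / 2 - 3 * a / (2 * wave L a a₁ ^ 2)))

theorem Admissible.smoothConst_nonneg (hP : P.Admissible)
    (hL : P.L < √(5 * P.a₁ / (3 * P.a)) * Real.pi) :
    0 ≤ smoothConst P.L P.a P.a₁ P.α P.β P.d P.M := by
  obtain ⟨-, -, h⟩ := hP.wave_spec hL
  have := hP.traceConst_nonneg
  have := hP.L_pos
  have := hP.M_pos
  have := hP.a₁_pos
  rw [smoothConst]
  positivity

theorem IsClassicalSolution.exists_smooth_curve (hP : P.Admissible) (hT : 0 ≤ T)
    (hL : P.L < √(5 * P.a₁ / (3 * P.a)) * Real.pi)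
    {V : C(Icc (0 : ℝ) T, State P.L)} {p q : ℝ → ℝ} (h : P.IsClassicalSolution T V p q) :
    ∃ W : ℝ → H20 P.L × H20 P.L, ContinuousOn W (Icc 0 T) ∧
      (∀ t : Icc (0 : ℝ) T, (((W t).1 : L2 P.L × L2 P.L × L2 P.L).1,
        ((W t).2 : L2 P.L × L2 P.L × L2 P.L).1) = (V t).1) ∧
      ∫ t in (0 : ℝ)..T, ‖W t‖ ^ 2 ≤ smoothConst P.L P.a P.a₁ P.α P.β P.d P.M *
        ((V ⟨0, le_rfl, hT⟩).1.normSq + ‖(V ⟨0, le_rfl, hT⟩).2‖ ^ 2) := by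
  obtain ⟨hk, hkl, hc⟩ := hP.wave_spec hL
  obtain ⟨W, h1, h2, h3⟩ := h.exists_smoothing hP hT hk hkl
  refine ⟨W, h1, h2, ?_⟩
  have hL0 := hP.L_pos
  have ha₁ := hP.a₁_pos
  have t1 := h.traces_le hP hT
  have t2 := h.normSq_le hP hT ⟨T, hT, le_rfl⟩
  have t3 := hP.initial_le (V ⟨0, le_rfl, hT⟩)
  set u := V ⟨0, le_rfl, hT⟩
  set v := V ⟨T, hT, le_rfl⟩
  set N := u.1.normSq + ‖u.2‖ ^ 2 with hN
  set C := traceConst P.a₁ P.α P.β P.d P.M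
  set k := wave P.L P.a P.a₁
  set c := 5 * P.a₁ / 2 - 3 * P.a / (2 * k ^ 2)
  have i1 : 0 ≤ ∫ t in (0 : ℝ)..T, p t ^ 2 := intervalIntegral.integral_nonneg hT fun _ _ => sq_nonneg _
  have i2 : 0 ≤ ∫ t in (0 : ℝ)..T, q t ^ 2 := intervalIntegral.integral_nonneg hT fun _ _ => sq_nonneg _
  have t4 : v.1.normSq ≤ (1 + |P.β| * P.M) * N := by
    have : 0 ≤ |P.β| * P.τ T * ‖v.2‖ ^ 2 := by have := hP.τ_pos hT; positivity
    simp only at t2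
    linarith
  have t5 : u.1.normSq ≤ N := le_add_of_nonneg_right (sq_nonneg _)
  have t6 : (∫ t in (0 : ℝ)..T, p t ^ 2) ≤ C * N := by linarith
  have t7 : (∫ t in (0 : ℝ)..T, q t ^ 2) ≤ C * N := by linarith
  have t8 : P.L / 2 * (v.1.normSq + u.1.normSq)
      + P.a₁ * P.L / 2 * ((1 + 2 * P.α ^ 2) * (∫ t in (0 : ℝ)..T, p t ^ 2)
        + 2 * P.β ^ 2 * ∫ t in (0 : ℝ)..T, q t ^ 2)
      ≤ P.L / 2 * ((1 + |P.β| * P.M) * N + N)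
      + P.a₁ * P.L / 2 * ((1 + 2 * P.α ^ 2) * (C * N) + 2 * P.β ^ 2 * (C * N)) := by
    gcongr
  have cW1 : ContinuousOn (fun t => ((W t).1 : L2 P.L × L2 P.L × L2 P.L).2.2) (Icc 0 T) :=
    (continuous_snd.comp (continuous_snd.comp
      (continuous_subtype_val.comp continuous_fst))).comp_continuousOn h1
  have cW2 : ContinuousOn (fun t => ((W t).2 : L2 P.L × L2 P.L × L2 P.L).2.2) (Icc 0 T) :=
    (continuous_snd.comp (continuous_snd.comp
      (continuous_subtype_val.comp continuous_snd))).comp_continuousOn h1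
  have t9 : ∫ t in (0 : ℝ)..T, ‖W t‖ ^ 2 ≤ ∫ t in (0 : ℝ)..T, (1 + 1 / k ^ 2) ^ 2 *
      (‖((W t).1 : L2 P.L × L2 P.L × L2 P.L).2.2‖ ^ 2
        + ‖((W t).2 : L2 P.L × L2 P.L × L2 P.L).2.2‖ ^ 2) := by
    refine intervalIntegral.integral_mono_on hT
      (ContinuousOn.intervalIntegrable_of_Icc hT (h1.norm.pow 2))
      (ContinuousOn.intervalIntegrable_of_Icc hT
        (continuousOn_const.mul ((cW1.norm.pow 2).add (cW2.norm.pow 2)))) fun t _ => ?_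
    have e1 := norm_H20_sq_le hL0 hk hkl (W t).1
    have e2 := norm_H20_sq_le hL0 hk hkl (W t).2
    rw [Prod.norm_def, mul_add]
    rcases max_cases ‖(W t).1‖ ‖(W t).2‖ with e | e <;> rw [e.1]
    · have : 0 ≤ (1 + 1 / k ^ 2) ^ 2 * ‖((W t).2 : L2 P.L × L2 P.L × L2 P.L).2.2‖ ^ 2 := by positivity
      linarith
    · have : 0 ≤ (1 + 1 / k ^ 2) ^ 2 * ‖((W t).1 : L2 P.L × L2 P.L × L2 P.L).2.2‖ ^ 2 := by positivity
      linarith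
  rw [intervalIntegral.integral_const_mul] at t9
  refine t9.trans ?_
  have e : smoothConst P.L P.a P.a₁ P.α P.β P.d P.M * N = (1 + 1 / k ^ 2) ^ 2 *
      ((P.L / 2 * ((1 + |P.β| * P.M) * N + N)
      + P.a₁ * P.L / 2 * ((1 + 2 * P.α ^ 2) * (C * N) + 2 * P.β ^ 2 * (C * N))) / c) := by
    rw [smoothConst]
    ring
  rw [e]
  refine mul_le_mul_of_nonneg_left ?_ (by positivity)
  rw [le_div_iff₀ hc, mul_comm]
  exact h3.trans t8

/-- The `L²(0,T; H²₀)` component is determined almost everywhere by the underlying curve, because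
weak derivatives are unique; it therefore coincides with the curve for which the estimate was
proved. -/
theorem smoothGraph_le (hP : P.Admissible) (hT : 0 ≤ T)
    (hL : P.L < √(5 * P.a₁ / (3 * P.a)) * Real.pi)
    {x : C(Icc (0 : ℝ) T, State P.L) × Lp (H20 P.L × H20 P.L) 2 (volume.restrict (Ioo (0 : ℝ) T))}
    (hx : x ∈ P.smoothGraph T) :
    ‖x.2‖ ^ 2 ≤ smoothConst P.L P.a P.a₁ P.α P.β P.d P.M *
      ((x.1 ⟨0, le_rfl, hT⟩).1.normSq + ‖(x.1 ⟨0, le_rfl, hT⟩).2‖ ^ 2) := by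
  rw [mem_smoothGraph] at hx
  obtain ⟨⟨p, q, h⟩, hs⟩ := hx
  obtain ⟨W, h1, h2, h3⟩ := h.exists_smooth_curve hP hT hL
  refine le_of_eq_of_le (norm_sq_eq_integral hT (g := W) ?_) h3
  have hs' : ∀ᵐ t ∂(volume.restrict (Ioo (0 : ℝ) T)), ∀ ht : t ∈ Icc 0 T,
    (((x.2 t).1 : L2 P.L × L2 P.L × L2 P.L).1, ((x.2 t).2 : L2 P.L × L2 P.L × L2 P.L).1)
      = (x.1 ⟨t, ht⟩).1 := hs
  filter_upwards [hs', ae_restrict_mem measurableSet_Ioo] with t h4 ht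
  have h5 := (h4 (Ioo_subset_Icc_self ht)).trans (h2 ⟨t, Ioo_subset_Icc_self ht⟩).symm
  rw [Prod.mk.injEq] at h5
  exact Prod.ext (H20.ext_fst h5.1) (H20.ext_fst h5.2)

theorem IsClassicalSolution.exists_mem_smoothGraph (hP : P.Admissible) (hT : 0 ≤ T)
    (hL : P.L < √(5 * P.a₁ / (3 * P.a)) * Real.pi)
    {V : C(Icc (0 : ℝ) T, State P.L)} {p q : ℝ → ℝ} (h : P.IsClassicalSolution T V p q) :
    ∃ w, (V, w) ∈ P.smoothGraph T := by
  obtain ⟨W, h1, h2, -⟩ := h.exists_smooth_curve hP hT hL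
  have hm := memLp_of_continuousOn' h1
  refine ⟨hm.toLp W, mem_smoothGraph.mpr ⟨⟨p, q, h⟩, ?_⟩⟩
  change ∀ᵐ t ∂(volume.restrict (Ioo (0 : ℝ) T)), ∀ ht : t ∈ Icc 0 T,
    (((hm.toLp W t).1 : L2 P.L × L2 P.L × L2 P.L).1, ((hm.toLp W t).2 : L2 P.L × L2 P.L × L2 P.L).1)
      = (V ⟨t, ht⟩).1
  filter_upwards [hm.coeFn_toLp] with t ht htm
  rw [ht]
  exact h2 ⟨t, htm⟩

theorem smoothGraph_norm_le (hP : P.Admissible) (hT : 0 ≤ T)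
    (hL : P.L < √(5 * P.a₁ / (3 * P.a)) * Real.pi)
    {x : C(Icc (0 : ℝ) T, State P.L) × Lp (H20 P.L × H20 P.L) 2 (volume.restrict (Ioo (0 : ℝ) T))}
    (hx : x ∈ P.smoothGraph T) :
    ‖x‖ ≤ (√((1 + 1 / ((|P.β| + P.gap) * P.τ 0)) * (1 + (|P.β| + P.gap) * P.τ 0) * 3)
      + √(smoothConst P.L P.a P.a₁ P.α P.β P.d P.M * 3)) * ‖P.initial hT x.1‖ := by
  have hc := hP.smoothConst_nonneg hL
  set c := √((1 + 1 / ((|P.β| + P.gap) * P.τ 0)) * (1 + (|P.β| + P.gap) * P.τ 0) * 3)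
  have h1 := smoothGraph_le hP hT hL hx
  have h2 := h1.trans (mul_le_mul_of_nonneg_left (normSq_add_le _) hc)
  rw [← mul_assoc] at h2
  obtain ⟨⟨p, q, h⟩, -⟩ := mem_smoothGraph.mp hx
  have e0 := h.norm_le hP hT
  have e1 := le_sqrt_mul (x := ‖x.2‖) (by positivity) (norm_nonneg _) h2
  rw [add_mul]
  rw [initial_apply] at e0 ⊢
  have e3 : 0 ≤ c * ‖x.1 ⟨0, le_rfl, hT⟩‖ := by positivity
  have e4 : 0 ≤ √(smoothConst P.L P.a P.a₁ P.α P.β P.d P.M * 3) * ‖x.1 ⟨0, le_rfl, hT⟩‖ := by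
    positivity
  exact max_le (by linarith) (by linarith)

theorem mem_solutionSpace_of_mem_closure
    {x : C(Icc (0 : ℝ) T, State P.L) × Lp (H20 P.L × H20 P.L) 2 (volume.restrict (Ioo (0 : ℝ) T))}
    (hx : x ∈ closure (P.smoothGraph T : Set (C(Icc (0 : ℝ) T, State P.L) ×
      Lp (H20 P.L × H20 P.L) 2 (volume.restrict (Ioo (0 : ℝ) T))))) :
    (fstCurve P.L T x.1, x.2) ∈ solutionSpace P.L T := by
  obtain ⟨y, hy, hlim⟩ := mem_closure_iff_seq_limit.mp hx
  have l1 := ((fstCurve P.L T).continuous.tendsto _).comp ((continuous_fst.tendsto _).comp hlim)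
  have l2 := (continuous_snd.tendsto _).comp hlim
  exact (isClosed_solutionSpace P.L T).mem_of_tendsto (l1.prodMk_nhds l2)
    (Eventually.of_forall fun n => (mem_smoothGraph.mp (hy n)).2)

theorem isMildSolution_of_mem_closure_smoothGraph
    {x : C(Icc (0 : ℝ) T, State P.L) × Lp (H20 P.L × H20 P.L) 2 (volume.restrict (Ioo (0 : ℝ) T))}
    (hx : x ∈ closure (P.smoothGraph T : Set (C(Icc (0 : ℝ) T, State P.L) ×
      Lp (H20 P.L × H20 P.L) 2 (volume.restrict (Ioo (0 : ℝ) T))))) : P.IsMildSolution T x.1 := by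
  obtain ⟨y, hy, hlim⟩ := mem_closure_iff_seq_limit.mp hx
  exact ⟨fun n => (y n).1, fun n => (mem_smoothGraph.mp (hy n)).1,
    (continuous_fst.tendsto _).comp hlim⟩

theorem norm_sq_le_of_mem_closure_smoothGraph (hP : P.Admissible) (hT : 0 ≤ T)
    (hL : P.L < √(5 * P.a₁ / (3 * P.a)) * Real.pi)
    {x : C(Icc (0 : ℝ) T, State P.L) × Lp (H20 P.L × H20 P.L) 2 (volume.restrict (Ioo (0 : ℝ) T))}
    (hx : x ∈ closure (P.smoothGraph T : Set (C(Icc (0 : ℝ) T, State P.L) ×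
      Lp (H20 P.L × H20 P.L) 2 (volume.restrict (Ioo (0 : ℝ) T))))) :
    ‖x.2‖ ^ 2 ≤ smoothConst P.L P.a P.a₁ P.α P.β P.d P.M *
      ((x.1 ⟨0, le_rfl, hT⟩).1.normSq + ‖(x.1 ⟨0, le_rfl, hT⟩).2‖ ^ 2) := by
  obtain ⟨y, hy, hlim⟩ := mem_closure_iff_seq_limit.mp hx
  have l1 := (((continuous_snd.tendsto _).comp hlim).norm).pow 2
  have l2 := ((continuous_eval_normSq (⟨0, le_rfl, hT⟩ : Icc (0 : ℝ) T)).tendsto x).comp hlim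
  have l3 := ((continuous_eval_norm (⟨0, le_rfl, hT⟩ : Icc (0 : ℝ) T)).tendsto x).comp hlim
  exact le_of_tendsto_of_tendsto' l1 ((l2.add l3).const_mul _)
    fun n => smoothGraph_le hP hT hL (hy n)


end Params

namespace Params

variable {P : Params} {T : ℝ}

set_option maxHeartbeats 1000000 in
theorem Admissible.exists_closure_smoothGraph (hP : P.Admissible) (hT : 0 ≤ T)
    (hL : P.L < √(5 * P.a₁ / (3 * P.a)) * Real.pi) :
    ∃ Φ : State P.L →L[ℝ] C(Icc (0 : ℝ) T, State P.L) ×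
        Lp (H20 P.L × H20 P.L) 2 (volume.restrict (Ioo (0 : ℝ) T)),
      (∀ u, Φ u ∈ closure (P.smoothGraph T : Set (C(Icc (0 : ℝ) T, State P.L) ×
        Lp (H20 P.L × H20 P.L) 2 (volume.restrict (Ioo (0 : ℝ) T))))) ∧
      ∀ u, (Φ u).1 ⟨0, le_rfl, hT⟩ = u := by
  have : CompleteSpace (H20 P.L) := (isClosed_H20 hP.L_pos).completeSpace_coe
  set e := (P.initial hT).comp (ContinuousLinearMap.fst ℝ C(Icc (0 : ℝ) T, State P.L)
    (Lp (H20 P.L × H20 P.L) 2 (volume.restrict (Ioo (0 : ℝ) T)))) with he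
  have hd : Dense (e '' (P.smoothGraph T : Set (C(Icc (0 : ℝ) T, State P.L) ×
      Lp (H20 P.L × H20 P.L) 2 (volume.restrict (Ioo (0 : ℝ) T))))) := by
    refine (hP.dense_initial hT).mono ?_
    rintro _ ⟨V, p, q, h, rfl⟩
    refine Exists.elim (h.exists_mem_smoothGraph hP hT hL) fun w hw => ?_
    exact ⟨(V, w), hw, rfl⟩
  exact (exists_inverse_on_closure (P.smoothGraph T) e
    (fun x hx => smoothGraph_norm_le hP hT hL hx) hd).imp fun Φ h => ⟨h.1, h.2.1⟩

set_option maxHeartbeats 1000000 in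
/-- The solution map, with the first two components in `L²(0,T; [H²₀(0,L)]²)`. -/
theorem Admissible.exists_smoothSolutionMap (hP : P.Admissible) (hT : 0 ≤ T)
    (hL : P.L < √(5 * P.a₁ / (3 * P.a)) * Real.pi) :
    ∃ Φ : State P.L →L[ℝ] C(Icc (0 : ℝ) T, State P.L) ×
        Lp (H20 P.L × H20 P.L) 2 (volume.restrict (Ioo (0 : ℝ) T)),
      (∀ u, P.IsSolution T u (Φ u).1) ∧
      (∀ u, (fstCurve P.L T (Φ u).1, (Φ u).2) ∈ solutionSpace P.L T) ∧
      ∀ u, ‖(Φ u).2‖ ^ 2 ≤ smoothConst P.L P.a P.a₁ P.α P.β P.d P.M * (u.1.normSq + ‖u.2‖ ^ 2) := by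
  refine (hP.exists_closure_smoothGraph hT hL).imp fun Φ ⟨h1, h2⟩ => ?_
  refine ⟨fun u => ⟨isMildSolution_of_mem_closure_smoothGraph (h1 u), fun t ht => ?_⟩,
    fun u => mem_solutionSpace_of_mem_closure (h1 u), fun u => ?_⟩
  · obtain rfl : t = ⟨0, le_rfl, hT⟩ := Subtype.ext ht
    exact h2 u
  · have := norm_sq_le_of_mem_closure_smoothGraph hP hT hL (h1 u)
    rwa [h2 u] at this

/-- The product norm is a maximum, so each of the two second derivatives is bounded by `‖w t‖`;
hence the factor `2`. -/
theorem integral_second_derivatives_le {L : ℝ}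
    (w : Lp (H20 L × H20 L) 2 (volume.restrict (Ioo (0 : ℝ) T))) (hT : 0 ≤ T) :
    ∫ t in Ioo 0 T, (‖((w t).1 : L2 L × L2 L × L2 L).2.2‖ ^ 2
      + ‖((w t).2 : L2 L × L2 L × L2 L).2.2‖ ^ 2) ≤ 2 * ‖w‖ ^ 2 := by
  rw [norm_sq_eq_integral hT (ae_eq_refl w), ← integral_Ioo_eq hT, ← integral_const_mul]
  have hi := ((Lp.memLp w).integrable_norm_pow (by norm_num)).const_mul 2
  refine integral_mono_of_nonneg (Eventually.of_forall fun t => by positivity) hi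
    (Eventually.of_forall fun t => ?_)
  have h1 : ‖((w t).1 : L2 L × L2 L × L2 L).2.2‖ ≤ ‖w t‖ :=
    ((norm_snd_le ((w t).1 : L2 L × L2 L × L2 L).2).trans (norm_snd_le ((w t).1 : L2 L × L2 L × L2 L))).trans
      (norm_fst_le (w t))
  have h2 : ‖((w t).2 : L2 L × L2 L × L2 L).2.2‖ ≤ ‖w t‖ :=
    ((norm_snd_le ((w t).2 : L2 L × L2 L × L2 L).2).trans (norm_snd_le ((w t).2 : L2 L × L2 L × L2 L))).trans
      (norm_snd_le (w t))
  have h3 := pow_le_pow_left₀ (norm_nonneg _) h1 2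
  have h4 := pow_le_pow_left₀ (norm_nonneg _) h2 2
  simp only
  linarith

set_option maxHeartbeats 1000000 in
theorem Admissible.exists_continuous_solutionMap (hP : P.Admissible) (hT : 0 ≤ T)
    (hL : P.L < √(5 * P.a₁ / (3 * P.a)) * Real.pi) :
    ∃ Ψ : State P.L → solutionSpace P.L T × C(Icc (0 : ℝ) T, L2 1), Continuous Ψ ∧
      ∀ (U₀ : State P.L) U, P.IsSolution T U₀ U ↔
        ∀ t, U t = ((Ψ U₀).1.1.1 t, (Ψ U₀).2 t) := by
  refine Exists.elim (hP.exists_smoothSolutionMap hT hL) fun Φ ⟨h1, h2, _⟩ => ?_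
  have c1 : Continuous fun u => (Φ u).1 := continuous_fst.comp Φ.continuous
  have c2 : Continuous fun u => (Φ u).2 := continuous_snd.comp Φ.continuous
  refine ⟨fun u => (⟨(fstCurve P.L T (Φ u).1, (Φ u).2), h2 u⟩,
    (ContinuousLinearMap.snd ℝ (X0 P.L) (L2 1)).compLeftContinuous ℝ (Icc (0 : ℝ) T) (Φ u).1), ?_,
    fun U₀ U => ?_⟩
  · exact ((((fstCurve P.L T).continuous.comp c1).prodMk c2).subtype_mk _).prodMk
      (ContinuousLinearMap.continuous _ |>.comp c1)
  · have e : (∀ t, U t = (fstCurve P.L T (Φ U₀).1 t,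
        (ContinuousLinearMap.snd ℝ (X0 P.L) (L2 1)).compLeftContinuous ℝ (Icc (0 : ℝ) T) (Φ U₀).1 t))
        ↔ U = (Φ U₀).1 := by
      rw [ContinuousMap.ext_iff]
      exact Iff.rfl
    refine Iff.trans ⟨fun hU => ?_, ?_⟩ e.symm
    · exact (hP.existsUnique hT U₀).1.unique hU (h1 U₀)
    · rintro rfl
      exact h1 U₀

set_option maxHeartbeats 1000000 in
theorem IsSolution.exists_smooth (hP : P.Admissible) (hT : 0 ≤ T)
    (hL : P.L < √(5 * P.a₁ / (3 * P.a)) * Real.pi) {U₀ : State P.L}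
    {U : C(Icc (0 : ℝ) T, State P.L)} (hU : P.IsSolution T U₀ U) :
    ∃ w : solutionSpace P.L T, (∀ t, w.1.1 t = (U t).1) ∧
      ∫ t in Ioo 0 T, (‖((w.1.2 t).1 : L2 P.L × L2 P.L × L2 P.L).2.2‖ ^ 2
          + ‖((w.1.2 t).2 : L2 P.L × L2 P.L × L2 P.L).2.2‖ ^ 2)
        ≤ 2 * smoothConst P.L P.a P.a₁ P.α P.β P.d P.M * (U₀.1.normSq + ‖U₀.2‖ ^ 2) := by
  refine Exists.elim (hP.exists_smoothSolutionMap hT hL) fun Φ ⟨h1, h2, h3⟩ => ?_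
  have h4 : U = (Φ U₀).1 := (hP.existsUnique hT U₀).1.unique hU (h1 U₀)
  refine ⟨⟨(fstCurve P.L T (Φ U₀).1, (Φ U₀).2), h2 U₀⟩, fun t => ?_, ?_⟩
  · rw [h4]; rfl
  · refine (integral_second_derivatives_le (Φ U₀).2 hT).trans ?_
    rw [mul_assoc]
    exact mul_le_mul_of_nonneg_left (h3 U₀) zero_le_two

end Params

end Boussinesq

end

/-! ### The theorem. -/

open Boussinesq in
theorem proposition2p4 :
    -- solutions and their boundary traces are well defined
    (∀ (P : Params) (T : ℝ), P.Admissible → 0 < T → ∀ U₀ : State P.L,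
      (∃! U, P.IsSolution T U₀ U) ∧
      ∀ U, P.IsSolution T U₀ U → ∃! pq : L2 T × L2 T, P.HasBoundaryTraces T U pq.1 pq.2) ∧
    -- energy bound
    (∀ (P : Params) (T : ℝ), P.Admissible → 0 < T → ∀ (U₀ : State P.L) U, P.IsSolution T U₀ U →
      ∀ t : Icc (0 : ℝ) T,
        (U t).1.normSq + |P.β| * P.τ t * ‖(U t).2‖ ^ 2
          ≤ U₀.1.normSq + |P.β| * P.τ 0 * ‖U₀.2‖ ^ 2) ∧
    -- bound on the boundary traces
    (∃ C : (a₁ α β d M : ℝ) → ℝ,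
      ∀ (P : Params) (T : ℝ), P.Admissible → 0 < T → ∀ (U₀ : State P.L) U, P.IsSolution T U₀ U →
      ∀ p q : L2 T, P.HasBoundaryTraces T U p q →
        ‖p‖ ^ 2 + ‖q‖ ^ 2 ≤ C P.a₁ P.α P.β P.d P.M * (U₀.1.normSq + ‖U₀.2‖ ^ 2)) ∧
    -- observability-type bound on `(η₀, ω₀)`
    (∀ (P : Params) (T : ℝ), P.Admissible → ∀ hT : 0 < T, ∀ (U₀ : State P.L) U, P.IsSolution T U₀ U →
      ∀ p q : L2 T, P.HasBoundaryTraces T U p q →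
        U₀.1.normSq ≤ 1 / T * (∫ t in (0 : ℝ)..T, (U (Set.projIcc 0 T hT.le t)).1.normSq)
          + P.a₁ * (2 * P.α + |P.β|) * ‖p‖ ^ 2 + P.a₁ * |P.β| * ‖q‖ ^ 2) ∧
    -- observability-type bound on `z₀`
    (∃ C₁ : (d M τ₀ K : ℝ) → ℝ,
      ∀ (P : Params) (T K : ℝ), P.Admissible → ∀ hT : 0 < T,
      (∀ t ∈ Icc 0 T, -K ≤ P.τ' t) → ∀ (U₀ : State P.L) U, P.IsSolution T U₀ U →
      ∀ p q : L2 T, P.HasBoundaryTraces T U p q →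
        ‖U₀.2‖ ^ 2 ≤ C₁ P.d P.M (P.τ 0) K *
          (‖(U ⟨T, hT.le, le_rfl⟩).2‖ ^ 2 + ‖q‖ ^ 2)) ∧
    -- Kato smoothing
    (∃ C : (L T a a₁ α β d M : ℝ) → ℝ,
      ∀ (P : Params) (T : ℝ), P.Admissible → 0 < T →
      P.L < √(5 * P.a₁ / (3 * P.a)) * Real.pi →
      ∀ (U₀ : State P.L) U, P.IsSolution T U₀ U →
      ∃ w : solutionSpace P.L T, (∀ t, w.1.1 t = (U t).1) ∧
        ∫ t in Ioo 0 T, (‖((w.1.2 t).1 : L2 P.L × L2 P.L × L2 P.L).2.2‖ ^ 2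
            + ‖((w.1.2 t).2 : L2 P.L × L2 P.L × L2 P.L).2.2‖ ^ 2)
          ≤ C P.L T P.a P.a₁ P.α P.β P.d P.M * (U₀.1.normSq + ‖U₀.2‖ ^ 2)) ∧
    -- the map from the data to the solution is well defined and continuous
    (∀ (P : Params) (T : ℝ), P.Admissible → 0 < T →
      P.L < √(5 * P.a₁ / (3 * P.a)) * Real.pi →
      ∃ Ψ : State P.L → solutionSpace P.L T × C(Icc (0 : ℝ) T, L2 1), Continuous Ψ ∧
        ∀ (U₀ : State P.L) U, P.IsSolution T U₀ U ↔
          ∀ t, U t = ((Ψ U₀).1.1.1 t, (Ψ U₀).2 t)) := by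
  refine ⟨fun P T hP hT U₀ => hP.existsUnique hT.le U₀,
    fun P T hP hT U₀ U hU t => hU.energy_le hP hT.le t,
    ⟨Params.traceConst, fun P T hP hT U₀ U hU p q hpq => ?_⟩,
    fun P T hP hT U₀ U hU p q hpq => ?_,
    -- The backward transport estimate reads `τ(0) ‖z₀‖² ≤ M ‖z(T)‖² + (1 + K) ‖q‖²`; the larger
    -- coefficient divided by `τ(0)` serves for both terms.
    ⟨fun _ M τ₀ K => max M (1 + K) / τ₀, fun P T K hP hT hK U₀ U hU p q hpq => ?_⟩,
    ⟨fun L _ a a₁ α β d M => 2 * Params.smoothConst L a a₁ α β d M,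
      fun P T hP hT hL U₀ U hU => hU.exists_smooth hP hT.le hL⟩,
    fun P T hP hT hL => hP.exists_continuous_solutionMap hT.le hL⟩
  · have := hpq.norm_le hP hT.le
    rwa [hU.initial_eq hT.le] at this
  · have := hpq.observability hP hT
    rwa [hU.initial_eq hT.le] at this
  · have h1 := hpq.transport_observability hP hT.le hK
    rw [hU.initial_eq hT.le] at h1
    rw [div_mul_eq_mul_div, le_div_iff₀ hP.τ_zero_pos, mul_comm]
    refine h1.trans ?_
    rw [mul_add]
    gcongr
    · exact le_max_left _ _
    · exact le_max_right _ _
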